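/- **Setting.** Let $0\le b<a$. In the stochastic block model $G(n,a/n,b/n)$, each of $n$ nodes receives an independent uniform spin $\sigma_v\in\{+1,-1\}$ and, given $\sigma$, each pair $\{u,v\}$ of distinct nodes is joined by an edge independently with probability $a/n$ if $\sigma_u=\sigma_v$ and $b/n$ otherwise. In the semirandom block model, a (possibly randomized) monotone adversary sees $\sigma$ and this graph, and may add any edges between nodes of equal spin and delete any edges between nodes of opposite spin; the resulting graph is observed. A vector $\hat\sigma\in\{+1,-1\}^n$ achieves $\eta$-partial recovery if at least $\eta n$ of its entries agree with $\sigma$, or at least $\eta n$ of the entries of $-\hat\sigma$ do. An algorithm achieves partial recovery in the semirandom block model if for some $\eta>\frac12$ and against every monotone adversary its output achieves $\eta$-partial recovery a.a.s., that is, with probability $1-o(1)$ as $n\to\infty$ with $a,b$ fixed. **Theorem.** 1. There are a constant $C>1$ and a deterministic algorithm, which receives only the observed graph and runs in time polynomial in $n$, that achieves partial recovery in the semirandom block model for all fixed $0\le b<a$ with $a>20$ and $k(1-2\varepsilon)^2>C$, where $k=\frac{a+b}{2}$ and $\varepsilon=\frac{b}{a+b}$. 2. For the observed graph let $A$ be its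 adjacency matrix with ones placed on the diagonal, let $J$ be the all-ones matrix and $\lambda'=\frac{\log n}{n}$, and consider the semidefinite program $$\text{maximize } \langle A-\lambda' J,Z\rangle\quad\text{over symmetric } Z\in\mathbb R^{n\times n} \text{ with } Z\succeq 0 \text{ and } Z_{ii}\le 1 \text{ for all } i .$$ For every $n\ge1$ and every graph it has an optimal solution $\hat Z$, and $\hat Z$ has an eigenvector $\hat v$ for its largest eigenvalue. If $0\le b<a$, $a>20$, $\eta<1$ and $$(a-b)^2\ \ge\ 10^4(1-\eta)^{-2}(a+b),$$ then against every monotone adversary the following holds a.a.s.: for every optimal $\hat Z$, every eigenvector $\hat v$ of $\hat Z$ for its largest eigenvalue, and every $\hat\sigma\in\{+1,-1\}^n$ with $\hat\sigma_i=\operatorname{sign}(\hat v_i)$ whenever $\hat v_i\neq0$, the vector $\hat\sigma$ achieves $\eta$-partial recovery. -/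

import Mathlib

open Filter Topology
open scoped ENNReal

namespace SemirandomSDP

/-! ### Spins and partial recovery -/

/-- An assignment of spins in `{+1, -1}` to `n` nodes. -/
abbrev Spins (n : ℕ) : Type := Fin n → ℤˣ

/-- The guess `τ` achieves `η`-partial recovery of `σ`: at least `η n` spins match, or at least
`η n` spins match after a global flip. -/
def IsPartialRecovery {n : ℕ} (η : ℝ) (τ σ : Spins n) : Prop :=
  η * n ≤ ((Finset.univ.filter fun v => τ v = σ v).card : ℝ) ∨
    η * n ≤ ((Finset.univ.filter fun v => -τ v = σ v).card : ℝ)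

/-! ### The stochastic block model and its semirandom version -/

open Classical in
/-- The probability of the potential edge `e` given the spins: `a / n` if its endpoints have the
same spin and `b / n` otherwise (cut off at `1`, which only matters for small `n`). -/
noncomputable def edgeProb (a b : ℝ) {n : ℕ} (σ : Spins n) (e : Sym2 (Fin n)) : ℝ≥0∞ :=
  min 1 (ENNReal.ofReal ((if ∀ u ∈ e, ∀ v ∈ e, σ u = σ v then a else b) / n))

open Classical in
/-- The probability that independent edges with probabilities `edgeProb` form the graph `G`. -/
noncomputable def graphWeight (a b : ℝ) {n : ℕ} (σ : Spins n) (G : SimpleGraph (Fin n)) : ℝ≥0∞ :=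
  ∏ e ∈ Finset.univ.filter (fun e : Sym2 (Fin n) => ¬ e.IsDiag),
    if e ∈ G.edgeSet then edgeProb a b σ e else 1 - edgeProb a b σ e

open Classical in
theorem sum_graphWeight (a b : ℝ) {n : ℕ} (σ : Spins n) :
    ∑ G : SimpleGraph (Fin n), graphWeight a b σ G = 1 := by
  set D := Finset.univ.filter (fun e : Sym2 (Fin n) => ¬ e.IsDiag) with hD
  have h1 : ∏ e ∈ D, (edgeProb a b σ e + (1 - edgeProb a b σ e)) = 1 := by
    refine Finset.prod_eq_one fun e _ => ?_
    exact add_tsub_cancel_of_le (min_le_left _ _)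
  rw [← h1, Finset.prod_add]
  refine Finset.sum_bij' (fun G _ => D.filter (fun e => e ∈ G.edgeSet))
    (fun s _ => SimpleGraph.fromEdgeSet (s : Set (Sym2 (Fin n)))) ?_ ?_ ?_ ?_ ?_
  · intro G _
    simp
  · intro s _
    simp
  · intro G _
    apply SimpleGraph.edgeSet_injective
    ext e
    have := fun h : e ∈ G.edgeSet => G.not_isDiag_of_mem_edgeSet h
    simp [hD]
    tauto
  · intro s hs
    ext e
    have h2 : e ∈ s → e ∈ D := fun h => Finset.mem_powerset.1 hs h
    simp [hD] at h2 ⊢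
    tauto
  · intro G _
    rw [graphWeight, ← Finset.prod_filter_mul_prod_filter_not D (fun e => e ∈ G.edgeSet)]
    congr 1
    · exact Finset.prod_congr rfl fun e he => by simp [(Finset.mem_filter.1 he).2]
    · rw [← Finset.filter_not]
      exact Finset.prod_congr rfl fun e he => by simp [(Finset.mem_filter.1 he).2]

/-- The conditional law of the stochastic block model graph `G(n, a/n, b/n)` given the spins. -/
noncomputable def blockModel (a b : ℝ) {n : ℕ} (σ : Spins n) : PMF (SimpleGraph (Fin n)) := by
  classical
  exact PMF.ofFintype (graphWeight a b σ) (sum_graphWeight a b σ)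

/-- `G` arises from `H` by adding edges within the communities of `σ` and deleting edges between
them. -/
def IsMonotoneChange {n : ℕ} (σ : Spins n) (H G : SimpleGraph (Fin n)) : Prop :=
  ∀ u v, (σ u = σ v → H.Adj u v → G.Adj u v) ∧ (σ u ≠ σ v → G.Adj u v → H.Adj u v)

/-- A (possibly randomized) monotone adversary: it sees the spins and the precursor graph, and
outputs a graph that is a monotone change of the precursor. -/
structure MonotoneAdversary (n : ℕ) where
  move : Spins n → SimpleGraph (Fin n) → PMF (SimpleGraph (Fin n))
  monotone : ∀ σ H G, G ∈ (move σ H).support → IsMonotoneChange σ H G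

/-- The joint law of the hidden spins and the observed graph in the semirandom block model:
independent uniform spins, a precursor graph from the block model, then the adversary. -/
noncomputable def semirandomModel (a b : ℝ) {n : ℕ} (adv : MonotoneAdversary n) :
    PMF (Spins n × SimpleGraph (Fin n)) :=
  (PMF.uniformOfFintype (Spins n)).bind fun σ =>
    (blockModel a b σ).bind fun H => (adv.move σ H).map fun G => (σ, G)

/-- The event `E` holds a.a.s. (with probability `1 - o(1)` as `n → ∞`) in the semirandom block
model, against every monotone adversary. -/
def HoldsAAS (a b : ℝ) (E : ∀ n : ℕ, Spins n → SimpleGraph (Fin n) → Prop) : Prop :=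
  ∀ adv : ∀ n : ℕ, MonotoneAdversary n,
    Tendsto (fun n : ℕ => (semirandomModel a b (adv n)).toOuterMeasure {x | E n x.1 x.2})
      atTop (𝓝 1)

/-- A spin estimator: it outputs a vector of spins for each graph. -/
abbrev Estimator : Type := ∀ n : ℕ, SimpleGraph (Fin n) → Spins n

/-- The estimator achieves partial recovery in the semirandom block model. -/
def AchievesPartialRecovery (a b : ℝ) (f : Estimator) : Prop :=
  ∃ η : ℝ, 1 / 2 < η ∧ HoldsAAS a b fun n σ G => IsPartialRecovery η (f n G) σ

/-! ### The semidefinite program and its rounding -/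

/-- The feasible region: positive semidefinite matrices with diagonal entries at most `1`. -/
def feasible (n : ℕ) : Set (Matrix (Fin n) (Fin n) ℝ) :=
  {Z | Z.PosSemidef ∧ ∀ i, Z i i ≤ 1}

open Classical in
/-- The adjacency matrix, with the convention that there are ones on the diagonal. -/
noncomputable def adj {n : ℕ} (G : SimpleGraph (Fin n)) : Matrix (Fin n) (Fin n) ℝ :=
  Matrix.of fun i j => if i = j ∨ G.Adj i j then 1 else 0

/-- The objective `⟨A - lam J, Z⟩`, with `J` the all-ones matrix. -/
noncomputable def objective {n : ℕ} (G : SimpleGraph (Fin n)) (lam : ℝ)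
    (Z : Matrix (Fin n) (Fin n) ℝ) : ℝ :=
  ∑ i, ∑ j, (adj G i j - lam) * Z i j

/-- `Z` is an optimal solution of the semidefinite program with regularization parameter `lam`. -/
def IsSDPSolution {n : ℕ} (G : SimpleGraph (Fin n)) (lam : ℝ)
    (Z : Matrix (Fin n) (Fin n) ℝ) : Prop :=
  Z ∈ feasible n ∧ IsMaxOn (objective G lam) (feasible n) Z

/-- `v` is an eigenvector of `Z` for its largest eigenvalue. -/
def IsTopEigenvector {n : ℕ} (Z : Matrix (Fin n) (Fin n) ℝ) (v : Fin n → ℝ) : Prop :=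
  ∃ μ : ℝ, Module.End.HasEigenvector (Matrix.toLin' Z) μ v ∧
    ∀ ν : ℝ, Module.End.HasEigenvalue (Matrix.toLin' Z) ν → ν ≤ μ

/-- `τ` consists of the signs of the entries of `v`; the sign of a zero entry is arbitrary. -/
def IsSignVector {n : ℕ} (v : Fin n → ℝ) (τ : Spins n) : Prop :=
  ∀ i, (0 < v i → τ i = 1) ∧ (v i < 0 → τ i = -1)

/-- `τ` is a possible output of the semidefinite program with regularization parameter `lam`,
rounded by taking the signs in a top eigenvector of an optimal solution. -/
def IsSDPOutput {n : ℕ} (G : SimpleGraph (Fin n)) (lam : ℝ) (τ : Spins n) : Prop :=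
  ∃ Z v, IsSDPSolution G lam Z ∧ IsTopEigenvector Z v ∧ IsSignVector v τ

/-! ### Polynomial time: random access programs with logarithmic cost -/

/-- Memory: finitely many arrays (those a program names), with integer cells indexed by integers. -/
abbrev Memory : Type := ℕ → ℤ → ℤ

/-- Expressions; `get x i` reads cell `i` of array `x`. -/
inductive Expr : Type
  | lit (c : ℤ) : Expr
  | get (x : ℕ) (i : Expr) : Expr
  | add (e f : Expr) : Expr
  | sub (e f : Expr) : Expr
  | mul (e f : Expr) : Expr
  | div (e f : Expr) : Expr

/-- The value of an expression (`div` is integer division, with `z / 0 = 0`). -/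
def Expr.eval (s : Memory) : Expr → ℤ
  | .lit c => c
  | .get x i => s x (i.eval s)
  | .add e f => e.eval s + f.eval s
  | .sub e f => e.eval s - f.eval s
  | .mul e f => e.eval s * f.eval s
  | .div e f => e.eval s / f.eval s

/-- The number of bits of an integer, including one for the sign. -/
def bits (z : ℤ) : ℕ := z.natAbs.size + 1

/-- The logarithmic cost of evaluating an expression: the total number of bits of the values of
all its subexpressions. -/
def Expr.cost (s : Memory) : Expr → ℕ
  | .lit c => bits c
  | .get x i => i.cost s + bits (s x (i.eval s))
  | .add e f => e.cost s + f.cost s + bits (e.eval s + f.eval s)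
  | .sub e f => e.cost s + f.cost s + bits (e.eval s - f.eval s)
  | .mul e f => e.cost s + f.cost s + bits (e.eval s * f.eval s)
  | .div e f => e.cost s + f.cost s + bits (e.eval s / f.eval s)

/-- Programs: `assign x i e` writes `e` to cell `i` of array `x`; branches and loops test
whether an expression is positive. -/
inductive Program : Type
  | skip : Program
  | assign (x : ℕ) (i e : Expr) : Program
  | seq (p q : Program) : Program
  | branch (e : Expr) (p q : Program) : Program
  | loop (e : Expr) (p : Program) : Program

/-- `Exec p s k t`: the program `p`, started in memory `s`, halts in memory `t` at total
cost `k`. -/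
inductive Exec : Program → Memory → ℕ → Memory → Prop
  | skip (s : Memory) : Exec .skip s 1 s
  | assign (x : ℕ) (i e : Expr) (s : Memory) :
      Exec (.assign x i e) s (i.cost s + e.cost s)
        (Function.update s x (Function.update (s x) (i.eval s) (e.eval s)))
  | seq {p q : Program} {s t u : Memory} {k m : ℕ} (hp : Exec p s k t) (hq : Exec q t m u) :
      Exec (.seq p q) s (k + m) u
  | branchPos {e : Expr} {p q : Program} {s t : Memory} {k : ℕ} (he : 0 < e.eval s)
      (hp : Exec p s k t) : Exec (.branch e p q) s (e.cost s + k) t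
  | branchNonpos {e : Expr} {p q : Program} {s t : Memory} {k : ℕ} (he : e.eval s ≤ 0)
      (hq : Exec q s k t) : Exec (.branch e p q) s (e.cost s + k) t
  | loopStep {e : Expr} {p : Program} {s t u : Memory} {k m : ℕ} (he : 0 < e.eval s)
      (hp : Exec p s k t) (hl : Exec (.loop e p) t m u) :
      Exec (.loop e p) s (e.cost s + k + m) u
  | loopDone {e : Expr} {p : Program} {s : Memory} (he : e.eval s ≤ 0) :
      Exec (.loop e p) s (e.cost s) s

open Classical in
/-- The input: cell `0` of array `0` holds `n`, and array `1` holds the adjacency matrix of `G`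
row by row; all other cells are zero. -/
noncomputable def inputMemory {n : ℕ} (G : SimpleGraph (Fin n)) : Memory := fun x i =>
  if x = 0 ∧ i = 0 then (n : ℤ)
  else if x = 1 ∧ ∃ u v : Fin n, G.Adj u v ∧ i = (u : ℤ) * n + (v : ℤ) then 1
  else 0

/-- The output: node `v` gets spin `+1` if cell `v` of array `2` is positive, and `-1`
otherwise. -/
def readSpins (n : ℕ) (s : Memory) : Spins n := fun v => if 0 < s 2 (v : ℤ) then 1 else -1

/-- The estimator is computed by a single program whose cost is at most a polynomial in `n` on
every graph with `n` nodes. -/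
def IsPolyTime (f : Estimator) : Prop :=
  ∃ (p : Program) (P : Polynomial ℕ), ∀ (n : ℕ) (G : SimpleGraph (Fin n)),
    ∃ (k : ℕ) (t : Memory), Exec p (inputMemory G) k t ∧ k ≤ P.eval n ∧ readSpins n t = f n G

end SemirandomSDP

/-!
The semidefinite program recovers the hidden spins because its optimum is robust in two senses.

*Monotone changes help.* The entries of a feasible matrix `Z` lie in `[-1, 1]`, so an edge added
inside a community, or deleted between the communities, increases the objective at `σ σᵀ` at least
as much as at `Z`. If `Z` is as good as `σ σᵀ` for the observed graph, it is so for the graph `H`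
drawn from the block model, before the adversary acts. This is the first step of
`correlation_of_nearOptimal`.

*The random graph is close to its mean.* The mean of the adjacency matrix of `H` is
`(a - b) / (2 n) σ σᵀ + (a + b) / (2 n) J`, up to the diagonal. With exponentially high probability
the centred adjacency matrix is at most `4 n √(a + b)` as a bilinear form on all pairs of sign
vectors (`sum_not_cutBounded_le`: exponential moments and a union bound), and Grothendieck's
inequality (`sum_mul_le_of_posSemidef`, with the constant `8`) extends this to positive semidefinite
matrices with diagonal at most `1`. The term `J` is harmless as soon as the regularization is at
least `(a + b) / (2 n)` and tends to zero, as the communities are then balanced enough. Hence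
`n² - ⟨σ, Z σ⟩` is at most a constant times `n² √(a + b) / (a - b)`.

For an optimal `Z`, whose existence is compactness, `isPartialRecovery_of_topEigenvector` rounds: the
trace of `Z` is at most `n` and its largest eigenvalue nearly `n`, so `σ` lies close to the line
spanned by a top eigenvector. This gives `holdsAAS_isSDPOutput`.

For the polynomial time algorithm only a nearly optimal solution in integers is computed, with
regularization `1 / ⌊√n⌋` in place of `log n / n`. The constraints on the diagonal are handled by a
game: in each round the objective is penalized by the surplus that the diagonal has accumulated so
far, and the response is the normalized `n ^ 60`-th power of the penalized matrix, which is almost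
optimal against every sign vector (`le_trace_pow_succ`). The squared norm of the surplus is a
potential with controlled drift (`potential_step`); as it stays nonnegative the average response is
nearly as good as `σ σᵀ`, and as it stays small the average is nearly feasible
(`exists_nearOptimal`). So the average is close to `σ σᵀ` in Frobenius norm, and a row `W i` of it
that maximizes `⟨W i, W (W i)⟩` has the right signs up to a global flip in most places
(`isPartialRecovery_rowSpins`). This needs additions, multiplications and integer divisions only,
with numbers of polynomially many bits, and is written out as a random access program whose cost is
bounded by a polynomial (`runs_sdpProgram`, `isPolyTime_sdpEstimator`).
-/

namespace SemirandomSDP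

/-! ### Averages over sign vectors -/

/-- The real number `±1` of a sign. -/
abbrev sgn (s : ℤˣ) : ℝ := ((s : ℤ) : ℝ)

theorem sgn_mul_self (s : ℤˣ) : sgn s * sgn s = 1 := by
  rcases Int.units_eq_one_or s with h | h <;> simp [sgn, h]

theorem abs_sgn (s : ℤˣ) : |sgn s| = 1 := by
  rcases Int.units_eq_one_or s with h | h <;> simp [sgn, h]

/-- The linear form `∑ k, s k * u k` with random signs `s`. -/
def signSum {d : ℕ} (u : Fin d → ℝ) (s : Spins d) : ℝ := ∑ k, sgn (s k) * u k

theorem sum_spins_succ {d : ℕ} (F : Spins (d + 1) → ℝ) :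
    ∑ s, F s = ∑ s : Spins d, (F (Fin.cons 1 s) + F (Fin.cons (-1) s)) := by
  rw [← (Fin.consEquiv fun _ : Fin (d + 1) => ℤˣ).sum_comp, Fintype.sum_prod_type,
    Finset.sum_add_distrib]
  have : (Finset.univ : Finset ℤˣ) = {1, -1} := rfl
  rw [this, Finset.sum_pair (by decide)]
  rfl

theorem signSum_cons {d : ℕ} (u : Fin (d + 1) → ℝ) (e : ℤˣ) (s : Spins d) :
    signSum u (Fin.cons e s) = sgn e * u 0 + signSum (fun k => u k.succ) s := by
  simp [signSum, Fin.sum_univ_succ]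

theorem card_spins (d : ℕ) : Fintype.card (Spins d) = 2 ^ d := by
  simp [Spins]

/-- Second moments of random sign sums are inner products. -/
theorem sum_signSum_mul {d : ℕ} (u v : Fin d → ℝ) :
    ∑ s, signSum u s * signSum v s = 2 ^ d * ∑ k, u k * v k := by
  induction d with
  | zero => simp [signSum]
  | succ d ih =>
    rw [sum_spins_succ]
    simp only [signSum_cons]
    have : ∀ s : Spins d, (sgn 1 * u 0 + signSum (fun k => u k.succ) s) *
        (sgn 1 * v 0 + signSum (fun k => v k.succ) s) +
        (sgn (-1) * u 0 + signSum (fun k => u k.succ) s) *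
        (sgn (-1) * v 0 + signSum (fun k => v k.succ) s) =
        2 * (u 0 * v 0) + 2 * (signSum (fun k => u k.succ) s * signSum (fun k => v k.succ) s) := by
      intro s; simp [sgn]; ring
    rw [Finset.sum_congr rfl fun s _ => this s, Finset.sum_add_distrib,
      ← Finset.mul_sum _ _ (2 : ℝ), ← Finset.mul_sum _ _ (2 : ℝ), ih, Fin.sum_univ_succ]
    simp; ring

/-- Fourth moments of random sign sums are at most the Gaussian ones. -/
theorem sum_signSum_pow_four_le {d : ℕ} (u : Fin d → ℝ) :
    ∑ s, signSum u s ^ 4 ≤ 2 ^ d * (3 * (∑ k, u k ^ 2) ^ 2) := by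
  induction d with
  | zero => simp [signSum]
  | succ d ih =>
    rw [sum_spins_succ]
    simp only [signSum_cons]
    set u' : Fin d → ℝ := fun k => u k.succ
    have : ∀ s : Spins d, (sgn 1 * u 0 + signSum u' s) ^ 4 + (sgn (-1) * u 0 + signSum u' s) ^ 4 =
        2 * u 0 ^ 4 + 12 * u 0 ^ 2 * (signSum u' s * signSum u' s) + 2 * signSum u' s ^ 4 := by
      intro s; simp [sgn]; ring
    rw [Finset.sum_congr rfl fun s _ => this s, Finset.sum_add_distrib, Finset.sum_add_distrib,
      ← Finset.mul_sum _ _ (12 * u 0 ^ 2), ← Finset.mul_sum _ _ (2 : ℝ),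
      ← Finset.mul_sum _ _ (2 : ℝ), sum_signSum_mul,
      Fin.sum_univ_succ]
    have h := ih u'
    have e : ∑ k, u' k * u' k = ∑ k, u' k ^ 2 := by simp [sq]
    rw [e]
    change _ ≤ 2 ^ (d + 1) * (3 * (u 0 ^ 2 + ∑ k, u' k ^ 2) ^ 2)
    set V := ∑ k, u' k ^ 2
    have : (0 : ℝ) ≤ 2 ^ d * u 0 ^ 4 := by positivity
    simp only [Finset.sum_const, Finset.card_univ, card_spins, nsmul_eq_mul]
    push_cast
    rw [pow_succ (2 : ℝ) d]
    nlinarith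

/-! ### Grothendieck's inequality -/

section Grothendieck

variable {ι : Type*} [Fintype ι]

/-- A bilinear form bounded on sign vectors is bounded on the cube of side `2 R`. -/
theorem bilin_le_of_abs_le {B : ι → ι → ℝ} {β R : ℝ}
    (hB : ∀ x y : ι → ℤˣ, ∑ i, ∑ j, B i j * sgn (x i) * sgn (y j) ≤ β)
    {x y : ι → ℝ} (hx : ∀ i, |x i| ≤ R) (hy : ∀ i, |y i| ≤ R) (hR : 0 ≤ R) :
    ∑ i, ∑ j, B i j * x i * y j ≤ R ^ 2 * β := by
  have key : ∀ (w z : ι → ℝ), (∀ i, |z i| ≤ R) →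
      ∃ s : ι → ℤˣ, ∑ i, w i * z i ≤ R * ∑ i, w i * sgn (s i) := by
    intro w z hz
    refine ⟨fun i => if 0 ≤ w i then 1 else -1, ?_⟩
    rw [Finset.mul_sum]
    refine Finset.sum_le_sum fun i _ => ?_
    have h1 := abs_le.1 (hz i)
    by_cases h : 0 ≤ w i
    · simp only [h, if_true, sgn]; push_cast; nlinarith
    · simp only [h, if_false, sgn]; push_cast; nlinarith
  obtain ⟨s, hs⟩ := key (fun i => ∑ j, B i j * y j) x hx
  obtain ⟨t, ht⟩ := key (fun j => ∑ i, B i j * sgn (s i)) y hy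
  have e1 : ∑ i, ∑ j, B i j * x i * y j = ∑ i, (∑ j, B i j * y j) * x i := by
    refine Finset.sum_congr rfl fun i _ => ?_
    rw [Finset.sum_mul]
    exact Finset.sum_congr rfl fun j _ => by ring
  have e2 : ∑ i, (∑ j, B i j * y j) * sgn (s i) = ∑ j, (∑ i, B i j * sgn (s i)) * y j := by
    simp only [Finset.sum_mul]
    rw [Finset.sum_comm]
    exact Finset.sum_congr rfl fun j _ => Finset.sum_congr rfl fun i _ => by ring
  have e3 : ∑ j, (∑ i, B i j * sgn (s i)) * sgn (t j) =
      ∑ i, ∑ j, B i j * sgn (s i) * sgn (t j) := by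
    simp only [Finset.sum_mul]
    rw [Finset.sum_comm]
  rw [e1]
  calc _ ≤ _ := hs
    _ ≤ R * (R * ∑ j, (∑ i, B i j * sgn (s i)) * sgn (t j)) := by
        rw [e2]; exact mul_le_mul_of_nonneg_left ht hR
    _ ≤ R * (R * β) := by
        rw [e3]; gcongr; exact hB s t
    _ = _ := by ring

/-- The values of the vector relaxation `∑ i j, B i j * ⟪u i, v j⟫` over all families of vectors
in the unit balls of finite-dimensional Euclidean spaces. -/
def vectorValues (B : ι → ι → ℝ) : Set ℝ :=
  {c | ∃ (d : ℕ) (u v : ι → Fin d → ℝ), (∀ i, ∑ k, u i k ^ 2 ≤ 1) ∧ (∀ i, ∑ k, v i k ^ 2 ≤ 1) ∧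
    c = ∑ i, ∑ j, B i j * ∑ k, u i k * v j k}

theorem zero_mem_vectorValues (B : ι → ι → ℝ) : 0 ∈ vectorValues B :=
  ⟨0, fun _ _ => 0, fun _ _ => 0, by simp, by simp, by simp⟩

theorem bddAbove_vectorValues (B : ι → ι → ℝ) : BddAbove (vectorValues B) := by
  refine ⟨∑ i, ∑ j, |B i j|, ?_⟩
  rintro _ ⟨d, u, v, hu, hv, rfl⟩
  refine Finset.sum_le_sum fun i _ => Finset.sum_le_sum fun j _ => ?_
  refine (le_abs_self _).trans ?_
  rw [abs_mul]
  refine mul_le_of_le_one_right (abs_nonneg _) ?_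
  rw [← sq_le_one_iff_abs_le_one]
  refine (Finset.sum_mul_sq_le_sq_mul_sq _ _ _).trans ?_
  exact mul_le_one₀ (hu i) (Finset.sum_nonneg fun _ _ => sq_nonneg _) (hv j)

/-- The vector relaxation, rescaled, for vectors indexed by an arbitrary finite type. -/
theorem vector_le_sSup {κ : Type*} [Fintype κ] (B : ι → ι → ℝ) {u v : ι → κ → ℝ} {a b c : ℝ}
    (ha : 0 < a) (hb : 0 < b) (hc : 0 < c) (hu : ∀ i, ∑ k, u i k ^ 2 ≤ c * a ^ 2)
    (hv : ∀ i, ∑ k, v i k ^ 2 ≤ c * b ^ 2) :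
    ∑ i, ∑ j, B i j * ∑ k, u i k * v j k ≤ c * (a * b) * sSup (vectorValues B) := by
  have hmem : (∑ i, ∑ j, B i j * ∑ k, u i k * v j k) / (c * (a * b)) ∈ vectorValues B := by
    have hs : 0 < √c := Real.sqrt_pos.2 hc
    have hss : √c * √c = c := Real.mul_self_sqrt hc.le
    let e := (Fintype.equivFin κ).symm
    refine ⟨Fintype.card κ, fun i k => u i (e k) / (√c * a),
      fun i k => v i (e k) / (√c * b), ?_, ?_, ?_⟩
    · intro i
      rw [e.sum_comp fun k => (u i k / (√c * a)) ^ 2]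
      simp only [div_pow]
      rw [← Finset.sum_div, div_le_one (by positivity), mul_pow, Real.sq_sqrt hc.le]
      exact hu i
    · intro i
      rw [e.sum_comp fun k => (v i k / (√c * b)) ^ 2]
      simp only [div_pow]
      rw [← Finset.sum_div, div_le_one (by positivity), mul_pow, Real.sq_sqrt hc.le]
      exact hv i
    · simp only [Finset.sum_div]
      refine Finset.sum_congr rfl fun i _ => Finset.sum_congr rfl fun j _ => ?_
      rw [e.sum_comp fun k => u i k / (√c * a) * (v j k / (√c * b)), mul_div_assoc,
        Finset.sum_div]
      congr 1
      refine Finset.sum_congr rfl fun k _ => ?_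
      rw [div_mul_div_comm]
      congr 1
      linear_combination (-a * b) * hss
  have := le_csSup (bddAbove_vectorValues B) hmem
  rw [div_le_iff₀ (by positivity)] at this
  linarith

/-- Truncation of a real number to `[-2, 2]`. -/
def clamp (x : ℝ) : ℝ := max (-2) (min x 2)

theorem abs_clamp_le (x : ℝ) : |clamp x| ≤ 2 := by
  rw [abs_le]; exact ⟨le_max_left _ _, max_le (by norm_num) (min_le_right _ _)⟩

theorem clamp_sq_le (x : ℝ) : clamp x ^ 2 ≤ x ^ 2 := by
  unfold clamp
  rcases le_total x 2 with h | h <;> rcases le_total (-2) x with h' | h' <;>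
    simp [h, h'] <;> nlinarith

theorem sub_clamp_sq_le (x : ℝ) : (x - clamp x) ^ 2 ≤ x ^ 4 / 64 := by
  have key : ∀ y : ℝ, |y| ≤ x ^ 2 / 8 → y ^ 2 ≤ x ^ 4 / 64 := by
    intro y hy
    have := sq_abs y
    have := abs_nonneg y
    nlinarith
  apply key
  unfold clamp
  rw [abs_le]
  rcases le_total x 2 with h | h
  · rcases le_total (-2) x with h' | h'
    · simp [h, h']; positivity
    · simp only [h, h', min_eq_left, max_eq_left]
      constructor <;> nlinarith [sq_nonneg (x + 4)]
  · rw [min_eq_right h, max_eq_right (by norm_num : (-2 : ℝ) ≤ 2)]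
    constructor <;> nlinarith [sq_nonneg (x - 4)]

/-- Grothendieck's inequality with the constant `8`. Each inner product is written as the average
of a product of two random sign sums. Truncating these at `2` leaves errors that are again vector
relaxations, of vectors of norm at most `1 / 4`; hence the supremum `K` of the relaxation satisfies
`K ≤ 4 β + K / 2`. -/
theorem sSup_vectorValues_le {B : ι → ι → ℝ} {β : ℝ}
    (hB : ∀ x y : ι → ℤˣ, ∑ i, ∑ j, B i j * sgn (x i) * sgn (y j) ≤ β) :
    sSup (vectorValues B) ≤ 8 * β := by
  set K := sSup (vectorValues B) with hK
  suffices h : K ≤ 4 * β + K / 2 by linarith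
  refine csSup_le ⟨0, zero_mem_vectorValues B⟩ ?_
  rintro _ ⟨d, u, v, hu, hv, rfl⟩
  have h2 : (0 : ℝ) < 2 ^ d := by positivity
  have sqX : ∀ (w : ι → Fin d → ℝ), (∀ i, ∑ k, w i k ^ 2 ≤ 1) → ∀ i,
      ∑ s, signSum (w i) s ^ 2 ≤ 2 ^ d * 1 ^ 2 := by
    intro w hw i
    have := sum_signSum_mul (w i) (w i)
    simp only [← sq] at this
    rw [this]
    have := hw i
    gcongr
    linarith
  have sqC : ∀ (w : ι → Fin d → ℝ), (∀ i, ∑ k, w i k ^ 2 ≤ 1) → ∀ i,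
      ∑ s, clamp (signSum (w i) s) ^ 2 ≤ 2 ^ d * 1 ^ 2 := fun w hw i =>
    (Finset.sum_le_sum fun s _ => clamp_sq_le _).trans (sqX w hw i)
  have sqT : ∀ (w : ι → Fin d → ℝ), (∀ i, ∑ k, w i k ^ 2 ≤ 1) → ∀ i,
      ∑ s, (signSum (w i) s - clamp (signSum (w i) s)) ^ 2 ≤ 2 ^ d * (1 / 4) ^ 2 := by
    intro w hw i
    refine (Finset.sum_le_sum fun s _ => sub_clamp_sq_le _).trans ?_
    rw [← Finset.sum_div]
    have h4 := sum_signSum_pow_four_le (w i)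
    have h5 : (∑ k, w i k ^ 2) ^ 2 ≤ 1 :=
      pow_le_one₀ (Finset.sum_nonneg fun _ _ => sq_nonneg _) (hw i)
    nlinarith
  have a1 : ∑ i, ∑ j, B i j * ∑ s, clamp (signSum (u i) s) * clamp (signSum (v j) s) ≤
      2 ^ d * (4 * β) := by
    have : ∑ i, ∑ j, B i j * ∑ s, clamp (signSum (u i) s) * clamp (signSum (v j) s) =
        ∑ s, ∑ i, ∑ j, B i j * clamp (signSum (u i) s) * clamp (signSum (v j) s) := by
      simp only [Finset.mul_sum, mul_assoc]
      rw [Finset.sum_congr rfl fun i _ => Finset.sum_comm, Finset.sum_comm]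
    rw [this]
    refine (Finset.sum_le_sum fun s _ => bilin_le_of_abs_le hB (fun i => abs_clamp_le _)
      (fun i => abs_clamp_le _) (by norm_num)).trans ?_
    simp
    norm_num
  have a2 := vector_le_sSup B (by norm_num : (0 : ℝ) < 1 / 4) one_pos h2 (sqT u hu) (sqC v hv)
  have a3 := vector_le_sSup B one_pos (by norm_num : (0 : ℝ) < 1 / 4) h2 (sqX u hu) (sqT v hv)
  have split : 2 ^ d * ∑ i, ∑ j, B i j * ∑ k, u i k * v j k =
      (∑ i, ∑ j, B i j * ∑ s, clamp (signSum (u i) s) * clamp (signSum (v j) s)) +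
      (∑ i, ∑ j, B i j * ∑ s, (signSum (u i) s - clamp (signSum (u i) s)) *
        clamp (signSum (v j) s)) +
      (∑ i, ∑ j, B i j * ∑ s, signSum (u i) s *
        (signSum (v j) s - clamp (signSum (v j) s))) := by
    simp only [Finset.mul_sum _ _ (2 ^ d : ℝ), ← Finset.sum_add_distrib]
    refine Finset.sum_congr rfl fun i _ => Finset.sum_congr rfl fun j _ => ?_
    rw [mul_left_comm, ← sum_signSum_mul, ← mul_add, ← mul_add,
      ← Finset.sum_add_distrib, ← Finset.sum_add_distrib]
    congr 1
    exact Finset.sum_congr rfl fun s _ => by ring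
  have : 2 ^ d * ∑ i, ∑ j, B i j * ∑ k, u i k * v j k ≤ 2 ^ d * (4 * β + K / 2) := by
    rw [split]; linarith
  exact le_of_mul_le_mul_left this h2

open scoped MatrixOrder in
/-- A positive semidefinite matrix with diagonal at most `1` is a Gram matrix of vectors in the
unit ball, so Grothendieck's inequality bounds its pairing with `B`. -/
theorem sum_mul_le_of_posSemidef {B : ι → ι → ℝ} {β : ℝ}
    (hB : ∀ x y : ι → ℤˣ, ∑ i, ∑ j, B i j * sgn (x i) * sgn (y j) ≤ β)
    {Z : Matrix ι ι ℝ} (hZ : Z.PosSemidef) (hd : ∀ i, Z i i ≤ 1) :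
    ∑ i, ∑ j, B i j * Z i j ≤ 8 * β := by
  classical
  obtain ⟨C, hC⟩ := (CStarAlgebra.nonneg_iff_eq_star_mul_self (a := Z)).1 hZ.nonneg
  have hent : ∀ i j, Z i j = ∑ k, C k i * C k j := by
    intro i j
    rw [hC]; simp [Matrix.mul_apply, Matrix.star_eq_conjTranspose]
  have h1 : ∀ i, ∑ k, C k i ^ 2 ≤ 1 * 1 ^ 2 := fun i => by
    have := hd i
    rw [hent] at this
    simpa [sq] using this
  have := vector_le_sSup B (u := fun i k => C k i) (v := fun i k => C k i)
    one_pos one_pos one_pos h1 h1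
  simp only [← hent] at this
  have := sSup_vectorValues_le hB
  linarith

end Grothendieck

/-! ### The block model is close to its mean in cut norm -/

open Classical in
/-- Expanding a product over the potential edges into a sum over graphs. -/
theorem sum_graph_prod {R : Type*} [CommSemiring R] {n : ℕ} (f g : Sym2 (Fin n) → R) :
    ∑ G : SimpleGraph (Fin n), ∏ e ∈ Finset.univ.filter (fun e : Sym2 (Fin n) => ¬ e.IsDiag),
      (if e ∈ G.edgeSet then f e else g e) =
    ∏ e ∈ Finset.univ.filter (fun e : Sym2 (Fin n) => ¬ e.IsDiag), (f e + g e) := by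
  set D := Finset.univ.filter (fun e : Sym2 (Fin n) => ¬ e.IsDiag) with hD
  rw [Finset.prod_add]
  refine Finset.sum_bij' (fun G _ => D.filter (fun e => e ∈ G.edgeSet))
    (fun s _ => SimpleGraph.fromEdgeSet (s : Set (Sym2 (Fin n)))) ?_ ?_ ?_ ?_ ?_
  · intro G _
    simp
  · intro s _
    simp
  · intro G _
    apply SimpleGraph.edgeSet_injective
    ext e
    have := fun h : e ∈ G.edgeSet => G.not_isDiag_of_mem_edgeSet h
    simp [hD]
    tauto
  · intro s hs
    ext e
    have h2 : e ∈ s → e ∈ D := fun h => Finset.mem_powerset.1 hs h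
    simp [hD] at h2 ⊢
    tauto
  · intro G _
    rw [← Finset.prod_filter_mul_prod_filter_not D (fun e => e ∈ G.edgeSet)]
    congr 1
    · exact Finset.prod_congr rfl fun e he => by simp [(Finset.mem_filter.1 he).2]
    · rw [← Finset.filter_not]
      exact Finset.prod_congr rfl fun e he => by simp [(Finset.mem_filter.1 he).2]

/-- The exponential moment of a centred Bernoulli variable. -/
theorem bernoulli_mgf_le {p s : ℝ} (hp : 0 ≤ p) (hs : |s| ≤ 1) :
    p * Real.exp (s * (1 - p)) + (1 - p) * Real.exp (-(s * p)) ≤ Real.exp (p * s ^ 2) := by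
  have h1 : Real.exp s ≤ 1 + s + s ^ 2 := by
    have := (abs_le.1 (Real.abs_exp_sub_one_sub_id_le hs)).2
    linarith
  have h2 : p * Real.exp (s * (1 - p)) + (1 - p) * Real.exp (-(s * p)) =
      Real.exp (-(s * p)) * (1 + p * (Real.exp s - 1)) := by
    rw [show s * (1 - p) = -(s * p) + s by ring, Real.exp_add]
    ring
  rw [h2]
  calc _ ≤ Real.exp (-(s * p)) * Real.exp (p * (s + s ^ 2)) := by
        refine mul_le_mul_of_nonneg_left ?_ (Real.exp_pos _).le
        have := Real.add_one_le_exp (p * (s + s ^ 2))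
        nlinarith
    _ = _ := by rw [← Real.exp_add]; congr 1; ring

open Classical in
/-- The exponential moment of a weighted sum of centred independent edge indicators. -/
theorem graph_mgf_le {n : ℕ} (p c : Sym2 (Fin n) → ℝ) (hp : ∀ e, 0 ≤ p e) (hp1 : ∀ e, p e ≤ 1)
    (hc : ∀ e, |c e| ≤ 1) :
    ∑ G : SimpleGraph (Fin n),
      (∏ e ∈ Finset.univ.filter (fun e : Sym2 (Fin n) => ¬ e.IsDiag),
        if e ∈ G.edgeSet then p e else 1 - p e) *
      Real.exp (∑ e ∈ Finset.univ.filter (fun e : Sym2 (Fin n) => ¬ e.IsDiag),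
        c e * ((if e ∈ G.edgeSet then 1 else 0) - p e)) ≤
    Real.exp (∑ e ∈ Finset.univ.filter (fun e : Sym2 (Fin n) => ¬ e.IsDiag), p e * c e ^ 2) := by
  rw [Real.exp_sum]
  calc _ = ∑ G : SimpleGraph (Fin n),
        ∏ e ∈ Finset.univ.filter (fun e : Sym2 (Fin n) => ¬ e.IsDiag),
          if e ∈ G.edgeSet then p e * Real.exp (c e * (1 - p e))
          else (1 - p e) * Real.exp (-(c e * p e)) := by
        refine Finset.sum_congr rfl fun G _ => ?_
        rw [Real.exp_sum, ← Finset.prod_mul_distrib]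
        refine Finset.prod_congr rfl fun e _ => ?_
        split_ifs <;> simp
    _ = _ := sum_graph_prod _ _
    _ ≤ _ := by
        refine Finset.prod_le_prod (fun e _ => ?_) fun e _ => bernoulli_mgf_le (hp e) (hc e)
        have := hp e
        have := hp1 e
        have : 0 ≤ 1 - p e := by linarith
        positivity

open Classical in
/-- A sum over ordered pairs of distinct nodes as a sum over potential edges. -/
theorem sum_pairs_eq_sum_edges {n : ℕ} (F : Fin n → Fin n → ℝ) (g : Sym2 (Fin n) → ℝ)
    (hF : ∀ i, F i i = 0) (hg : ∀ i j, i ≠ j → g s(i, j) = F i j + F j i) :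
    ∑ i, ∑ j, F i j =
      ∑ e ∈ Finset.univ.filter (fun e : Sym2 (Fin n) => ¬ e.IsDiag), g e := by
  have h := Finset.sum_sym2_filter_not_isDiag (Finset.univ : Finset (Fin n)) g
  rw [Finset.sym2_univ] at h
  have e1 : ∑ e ∈ Finset.univ.filter (fun e : Sym2 (Fin n) => ¬ e.IsDiag), g e =
      ∑ q ∈ Finset.univ.filter (fun q : Fin n × Fin n => q.1 < q.2), g s(q.1, q.2) := by
    convert h using 2
    ext q
    simp only [Finset.mem_filter, Finset.mem_univ, true_and, Finset.mem_offDiag]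
    exact ⟨fun h => ⟨h.ne, h⟩, fun h => h.2⟩
  rw [e1, ← Fintype.sum_prod_type']
  have e2 : ∑ q ∈ Finset.univ.filter (fun q : Fin n × Fin n => q.1 < q.2), g s(q.1, q.2) =
      ∑ q ∈ Finset.univ.filter (fun q : Fin n × Fin n => q.1 < q.2), F q.1 q.2 +
      ∑ q ∈ Finset.univ.filter (fun q : Fin n × Fin n => q.1 < q.2), F q.2 q.1 := by
    rw [← Finset.sum_add_distrib]
    exact Finset.sum_congr rfl fun q hq => hg _ _ (Finset.mem_filter.1 hq).2.ne
  have e3 : ∑ q ∈ Finset.univ.filter (fun q : Fin n × Fin n => q.1 < q.2), F q.2 q.1 =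
      ∑ q ∈ Finset.univ.filter (fun q : Fin n × Fin n => ¬ q.1 < q.2), F q.1 q.2 := by
    rw [Finset.sum_filter, Finset.sum_filter, ← (Equiv.prodComm (Fin n) (Fin n)).sum_comp]
    refine Finset.sum_congr rfl fun q _ => ?_
    rcases lt_trichotomy q.1 q.2 with h | h | h
    · simp [h, h.not_gt]
    · simp [h, hF]
    · simp [h, h.not_gt]
  rw [e2, e3, Finset.sum_filter_add_sum_filter_not]

/-- The probability of an edge between `i ≠ j`, given the spins. -/
noncomputable def pairProb (a b : ℝ) {n : ℕ} (σ : Spins n) (i j : Fin n) : ℝ :=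
  (if σ i = σ j then a else b) / n

open Classical in
/-- The centred adjacency matrix, with zero diagonal. -/
noncomputable def centered (a b : ℝ) {n : ℕ} (σ : Spins n) (H : SimpleGraph (Fin n))
    (i j : Fin n) : ℝ :=
  if i = j then 0 else (if H.Adj i j then 1 else 0) - pairProb a b σ i j

/-- The centred adjacency matrix is small as a bilinear form on sign vectors. The constant `4` is
large enough for a union bound over all `4 ^ n` pairs of sign vectors. -/
def IsCutBounded (a b : ℝ) {n : ℕ} (σ : Spins n) (H : SimpleGraph (Fin n)) : Prop :=
  ∀ x y : Fin n → ℤˣ, ∑ i, ∑ j, centered a b σ H i j * sgn (x i) * sgn (y j) ≤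
    4 * n * √(a + b)

open Classical in
/-- The edge probability as a real number, without the cutoff at `1`; the two agree when
`a ≤ n`. -/
noncomputable def edgeProbReal (a b : ℝ) {n : ℕ} (σ : Spins n) (e : Sym2 (Fin n)) : ℝ :=
  (if ∀ u ∈ e, ∀ v ∈ e, σ u = σ v then a else b) / n

theorem edgeProbReal_mk (a b : ℝ) {n : ℕ} (σ : Spins n) (i j : Fin n) :
    edgeProbReal a b σ s(i, j) = pairProb a b σ i j := by
  unfold edgeProbReal pairProb
  congr 1
  by_cases h : σ i = σ j
  · simp [h]
  · simp [h]

section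

variable {a b : ℝ} {n : ℕ}

theorem edgeProbReal_nonneg (hb : 0 ≤ b) (hab : b < a) (σ : Spins n) (e : Sym2 (Fin n)) :
    0 ≤ edgeProbReal a b σ e := by
  unfold edgeProbReal
  refine div_nonneg ?_ (Nat.cast_nonneg _)
  split_ifs <;> linarith

theorem edgeProbReal_le (hn : 0 < n) (hab : b < a) (σ : Spins n) (e : Sym2 (Fin n)) :
    edgeProbReal a b σ e ≤ a / n := by
  unfold edgeProbReal
  have : (0 : ℝ) < n := by exact_mod_cast hn
  gcongr
  split_ifs <;> linarith

theorem edgeProbReal_le_one (hn : 0 < n) (hab : b < a) (han : a ≤ n) (σ : Spins n)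
    (e : Sym2 (Fin n)) : edgeProbReal a b σ e ≤ 1 := by
  refine (edgeProbReal_le hn hab σ e).trans ?_
  rw [div_le_one (by exact_mod_cast hn)]
  exact han

open Classical in
/-- The weight of a graph as a product of real numbers. -/
theorem graphWeight_eq (hn : 0 < n) (hb : 0 ≤ b) (hab : b < a) (han : a ≤ n) (σ : Spins n)
    (G : SimpleGraph (Fin n)) :
    graphWeight a b σ G = ENNReal.ofReal
      (∏ e ∈ Finset.univ.filter (fun e : Sym2 (Fin n) => ¬ e.IsDiag),
        if e ∈ G.edgeSet then edgeProbReal a b σ e else 1 - edgeProbReal a b σ e) := by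
  have h0 := edgeProbReal_nonneg hb hab σ
  have h1 := edgeProbReal_le_one hn hab han σ
  have hE : ∀ e, edgeProb a b σ e = ENNReal.ofReal (edgeProbReal a b σ e) := by
    intro e
    refine min_eq_right ?_
    rw [ENNReal.ofReal_le_one]
    exact h1 e
  rw [ENNReal.ofReal_prod_of_nonneg]
  · refine Finset.prod_congr rfl fun e _ => ?_
    rw [hE]
    split_ifs
    · rfl
    · rw [ENNReal.ofReal_sub _ (h0 e), ENNReal.ofReal_one]
  · intro e _
    split_ifs
    · exact h0 e
    · linarith [h1 e]

open Classical in
theorem sum_centered_eq (σ : Spins n) (H : SimpleGraph (Fin n)) (x y : Fin n → ℤˣ)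
    (c : Sym2 (Fin n) → ℝ)
    (hc : ∀ i j, c s(i, j) = sgn (x i) * sgn (y j) + sgn (x j) * sgn (y i)) :
    ∑ i, ∑ j, centered a b σ H i j * sgn (x i) * sgn (y j) =
      ∑ e ∈ Finset.univ.filter (fun e : Sym2 (Fin n) => ¬ e.IsDiag),
        c e * ((if e ∈ H.edgeSet then 1 else 0) - edgeProbReal a b σ e) := by
  refine sum_pairs_eq_sum_edges _ _ (fun i => by simp [centered]) fun i j hij => ?_
  have e1 : pairProb a b σ j i = pairProb a b σ i j := by simp only [pairProb, eq_comm]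
  rw [hc, edgeProbReal_mk]
  simp only [centered, hij, hij.symm, if_false, SimpleGraph.mem_edgeSet, e1, H.adj_comm j i]
  ring

/-- The expected number of edges is at most `n a / 2`. -/
theorem sum_edgeProbReal_le (hn : 0 < n) (hb : 0 ≤ b) (hab : b < a) (σ : Spins n) :
    ∑ e ∈ Finset.univ.filter (fun e : Sym2 (Fin n) => ¬ e.IsDiag), edgeProbReal a b σ e ≤
      n * a / 2 := by
  classical
  have hn' : (0 : ℝ) < n := by exact_mod_cast hn
  have : ∑ e ∈ Finset.univ.filter (fun e : Sym2 (Fin n) => ¬ e.IsDiag), edgeProbReal a b σ e =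
      ∑ i : Fin n, ∑ j : Fin n, (if i = j then 0 else pairProb a b σ i j / 2) := by
    symm
    convert sum_pairs_eq_sum_edges _ _ (fun i => ?_) fun i j hij => ?_ using 1
    · simp
    · have e1 : pairProb a b σ j i = pairProb a b σ i j := by simp only [pairProb, eq_comm]
      rw [edgeProbReal_mk]
      simp [hij, hij.symm, e1]
  rw [this]
  calc _ ≤ ∑ i : Fin n, ∑ j : Fin n, a / n / 2 := by
        refine Finset.sum_le_sum fun i _ => Finset.sum_le_sum fun j _ => ?_
        split_ifs
        · have : 0 < a := by linarith
          positivity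
        · have := edgeProbReal_le hn hab σ s(i, j)
          rw [edgeProbReal_mk] at this
          linarith
    _ = _ := by simp; field_simp

open Classical in
/-- The block model fails to be cut bounded with exponentially small probability: a union bound
over the `4 ^ n` pairs of sign vectors. -/
theorem sum_not_cutBounded_le (hn : 0 < n) (hb : 0 ≤ b) (hab : b < a) (ha : 4 ≤ a) (han : a ≤ n)
    (σ : Spins n) :
    ∑ H : SimpleGraph (Fin n), (if IsCutBounded a b σ H then 0 else graphWeight a b σ H) ≤
      ENNReal.ofReal ((4 * Real.exp (-2)) ^ n) := by
  have h0 := edgeProbReal_nonneg hb hab σ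
  have h1 := edgeProbReal_le_one hn hab han σ
  set p := edgeProbReal a b σ with hp
  set D := Finset.univ.filter (fun e : Sym2 (Fin n) => ¬ e.IsDiag) with hD
  set w : SimpleGraph (Fin n) → ℝ := fun H =>
    ∏ e ∈ D, if e ∈ H.edgeSet then p e else 1 - p e with hw
  have hw0 : ∀ H, 0 ≤ w H := fun H => Finset.prod_nonneg fun e _ => by
    split_ifs
    · exact h0 e
    · linarith [h1 e]
  have hpos : 0 < a + b := by linarith
  have hr : 2 ≤ √(a + b) := by
    rw [Real.le_sqrt (by norm_num) hpos.le]; linarith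
  have hrpos : 0 < √(a + b) := by linarith
  have hrr : √(a + b) ^ 2 = a + b := Real.sq_sqrt hpos.le
  let S : (Fin n → ℤˣ) × (Fin n → ℤˣ) → SimpleGraph (Fin n) → ℝ := fun xy H =>
    ∑ i, ∑ j, centered a b σ H i j * sgn (xy.1 i) * sgn (xy.2 j)
  -- the exponential moment at `1 / √(a + b)`
  have mgf : ∀ xy, ∑ H, w H * Real.exp (S xy H / √(a + b)) ≤ Real.exp (2 * n) := by
    intro xy
    let c : Sym2 (Fin n) → ℝ := Sym2.lift
      ⟨fun i j => sgn (xy.1 i) * sgn (xy.2 j) + sgn (xy.1 j) * sgn (xy.2 i),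
        fun i j => by ring⟩
    have hc2 : ∀ e, |c e| ≤ 2 := by
      intro e
      induction e with
      | _ i j =>
        change |sgn (xy.1 i) * sgn (xy.2 j) + sgn (xy.1 j) * sgn (xy.2 i)| ≤ 2
        refine (abs_add_le _ _).trans ?_
        rw [abs_mul, abs_mul]
        simp only [abs_sgn]
        norm_num
    have hc1 : ∀ e, |c e / √(a + b)| ≤ 1 := by
      intro e
      rw [abs_div, abs_of_pos hrpos, div_le_one hrpos]
      exact (hc2 e).trans hr
    have := graph_mgf_le p (fun e => c e / √(a + b)) h0 h1 hc1
    calc _ = _ := by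
          refine Finset.sum_congr rfl fun H _ => ?_
          congr 2
          rw [show S xy H = _ from sum_centered_eq σ H xy.1 xy.2 c fun i j => rfl,
            Finset.sum_div]
          exact Finset.sum_congr rfl fun e _ => by ring
      _ ≤ _ := this
      _ ≤ _ := by
          refine Real.exp_le_exp.2 ?_
          calc _ ≤ ∑ e ∈ D, p e * (4 / (a + b)) := by
                refine Finset.sum_le_sum fun e _ => mul_le_mul_of_nonneg_left ?_ (h0 e)
                rw [div_pow, hrr]
                gcongr
                have := sq_abs (c e)
                have := hc2 e
                have := abs_nonneg (c e)
                nlinarith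
            _ = (∑ e ∈ D, p e) * (4 / (a + b)) := by rw [Finset.sum_mul]
            _ ≤ n * a / 2 * (4 / (a + b)) := by
                refine mul_le_mul_of_nonneg_right (sum_edgeProbReal_le hn hb hab σ) (by positivity)
            _ ≤ 2 * n := by
                rw [mul_div_assoc', div_le_iff₀ hpos]
                have : (0 : ℝ) ≤ n := Nat.cast_nonneg _
                nlinarith
  calc _ ≤ ∑ H : SimpleGraph (Fin n), ENNReal.ofReal
          (∑ xy, w H * Real.exp (S xy H / √(a + b)) * Real.exp (-(4 * n))) := by
        refine Finset.sum_le_sum fun H _ => ?_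
        split_ifs with hH
        · exact zero_le
        · rw [graphWeight_eq hn hb hab han]
          refine ENNReal.ofReal_le_ofReal ?_
          simp only [IsCutBounded, not_forall, not_le] at hH
          obtain ⟨x, y, hxy⟩ := hH
          have : w H ≤ w H * Real.exp (S (x, y) H / √(a + b)) * Real.exp (-(4 * n)) := by
            rw [mul_assoc, ← Real.exp_add]
            refine le_mul_of_one_le_right (hw0 H) (Real.one_le_exp ?_)
            have : 4 * n ≤ S (x, y) H / √(a + b) := by
              rw [le_div_iff₀ hrpos]; exact hxy.le
            linarith
          refine this.trans ?_
          exact Finset.single_le_sum (f := fun xy => w H * Real.exp (S xy H / √(a + b)) *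
            Real.exp (-(4 * n))) (fun xy _ => by have := hw0 H; positivity)
            (Finset.mem_univ (x, y))
    _ = ENNReal.ofReal (∑ xy, (∑ H, w H * Real.exp (S xy H / √(a + b))) *
          Real.exp (-(4 * n))) := by
        rw [← ENNReal.ofReal_sum_of_nonneg, Finset.sum_comm]
        · simp only [Finset.sum_mul]
        · intro H _
          have := hw0 H
          exact Finset.sum_nonneg fun _ _ => by positivity
    _ ≤ ENNReal.ofReal (∑ _xy : (Fin n → ℤˣ) × (Fin n → ℤˣ),
          Real.exp (2 * n) * Real.exp (-(4 * n))) := by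
        refine ENNReal.ofReal_le_ofReal (Finset.sum_le_sum fun xy _ => ?_)
        exact mul_le_mul_of_nonneg_right (mgf xy) (Real.exp_pos _).le
    _ = _ := by
        congr 1
        rw [← Real.exp_add]
        have : Real.exp (2 * n + -(4 * n)) = Real.exp (-2) ^ n := by
          rw [← Real.exp_nat_mul]; congr 1; ring
        rw [this]
        simp only [Finset.sum_const, Finset.card_univ, Fintype.card_prod, card_spins, nsmul_eq_mul]
        push_cast
        rw [mul_pow, ← mul_pow]
        norm_num

end

/-! ### The good event -/

/-- The communities are nearly balanced, at the scale set by `lam`. -/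
def IsBalanced (lam : ℝ) {n : ℕ} (σ : Spins n) : Prop := lam * (∑ i, sgn (σ i)) ^ 2 ≤ n

open Classical in
/-- Markov's inequality for the squared total spin. -/
theorem card_not_balanced_le {lam : ℝ} (hl : 0 ≤ lam) {n : ℕ} (hn : 0 < n) :
    ((Finset.univ.filter fun σ : Spins n => ¬ IsBalanced lam σ).card : ℝ) ≤ lam * 2 ^ n := by
  have hn' : (0 : ℝ) < n := by exact_mod_cast hn
  have h := sum_signSum_mul (fun _ : Fin n => (1 : ℝ)) fun _ => 1
  simp only [signSum, mul_one, ← sq] at h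
  have h2 : ((Finset.univ.filter fun σ : Spins n => ¬ IsBalanced lam σ).card : ℝ) * n ≤
      ∑ σ : Spins n, lam * (∑ i, sgn (σ i)) ^ 2 := by
    rw [← nsmul_eq_mul, ← Finset.sum_const]
    refine (Finset.sum_le_sum fun σ hσ => ?_).trans
      (Finset.sum_le_sum_of_subset_of_nonneg (Finset.filter_subset _ _) fun σ _ _ => by positivity)
    have := (Finset.mem_filter.1 hσ).2
    simp only [IsBalanced, not_le] at this
    exact this.le
  rw [← Finset.mul_sum, h] at h2
  simp at h2
  nlinarith

/-- To hold asymptotically almost surely against every monotone adversary it is enough to hold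
for every monotone change of a cut bounded graph with balanced spins. -/
theorem holdsAAS_of_good {a b : ℝ} (hb : 0 ≤ b) (hab : b < a) (ha : 4 ≤ a)
    {E : ∀ n : ℕ, Spins n → SimpleGraph (Fin n) → Prop} {lam : ℕ → ℝ}
    (hl : ∀ n, 0 ≤ lam n) (hl0 : Tendsto lam atTop (𝓝 0))
    (hE : ∀ᶠ n in atTop, ∀ (σ : Spins n) (H G : SimpleGraph (Fin n)), IsBalanced (lam n) σ →
      IsCutBounded a b σ H → IsMonotoneChange σ H G → E n σ G) :
    HoldsAAS a b E := by
  classical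
  intro adv
  have hbad : ∀ᶠ n in atTop, (semirandomModel a b (adv n)).toOuterMeasure {x | ¬ E n x.1 x.2} ≤
      ENNReal.ofReal (lam n + (4 * Real.exp (-2)) ^ n) := by
    filter_upwards [hE, eventually_gt_atTop 0, eventually_ge_atTop ⌈a⌉₊] with n hn hn0 hna
    have han : a ≤ n := (Nat.le_ceil a).trans (by exact_mod_cast hna)
    rw [semirandomModel, PMF.toOuterMeasure_bind_apply, tsum_fintype]
    have hp0 : 0 ≤ (4 * Real.exp (-2)) ^ n := by positivity
    have inner : ∀ σ : Spins n, ((blockModel a b σ).bind fun H =>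
        ((adv n).move σ H).map fun G => (σ, G)).toOuterMeasure {x | ¬ E n x.1 x.2} ≤
        (if IsBalanced (lam n) σ then 0 else 1) + ENNReal.ofReal ((4 * Real.exp (-2)) ^ n) := by
      intro σ
      by_cases hσ : IsBalanced (lam n) σ
      · rw [if_pos hσ, zero_add]
        refine le_trans ?_ (sum_not_cutBounded_le hn0 hb hab ha han σ)
        rw [PMF.toOuterMeasure_bind_apply, tsum_fintype]
        refine Finset.sum_le_sum fun H _ => ?_
        have hw : (blockModel a b σ) H = graphWeight a b σ H := PMF.ofFintype_apply _ _
        rw [hw]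
        split_ifs with hH
        · rw [PMF.toOuterMeasure_map_apply, (PMF.toOuterMeasure_apply_eq_zero_iff _ _).2, mul_zero]
          rw [Set.disjoint_left]
          intro G hG hG2
          exact hG2 (hn σ H G hσ hH ((adv n).monotone σ H G hG))
        · refine mul_le_of_le_one_right' ?_
          exact (PMF.toOuterMeasure_mono _ (Set.subset_univ _)).trans
            (le_of_eq ((PMF.toOuterMeasure_apply_eq_one_iff _ _).2 (Set.subset_univ _)))
      · rw [if_neg hσ]
        refine le_trans ?_ le_self_add
        exact (PMF.toOuterMeasure_mono _ (Set.subset_univ _)).trans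
            (le_of_eq ((PMF.toOuterMeasure_apply_eq_one_iff _ _).2 (Set.subset_univ _)))
    calc _ ≤ ∑ σ : Spins n, (PMF.uniformOfFintype (Spins n)) σ *
          ((if IsBalanced (lam n) σ then 0 else 1) +
            ENNReal.ofReal ((4 * Real.exp (-2)) ^ n)) :=
          Finset.sum_le_sum fun σ _ => by gcongr; exact inner σ
      _ = ENNReal.ofReal ((2 ^ n)⁻¹ *
          ∑ σ : Spins n, ((if IsBalanced (lam n) σ then 0 else 1) + (4 * Real.exp (-2)) ^ n)) := by
          rw [ENNReal.ofReal_mul (by positivity), ENNReal.ofReal_sum_of_nonneg, Finset.mul_sum]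
          · refine Finset.sum_congr rfl fun σ _ => ?_
            rw [PMF.uniformOfFintype_apply, ENNReal.ofReal_add _ hp0]
            · congr 1
              · rw [ENNReal.ofReal_inv_of_pos (by positivity)]
                simp
              · congr 1
                split_ifs <;> simp
            · split_ifs <;> simp
          · intro σ _
            refine add_nonneg ?_ hp0
            split_ifs <;> simp
      _ ≤ _ := by
          refine ENNReal.ofReal_le_ofReal ?_
          have h1 : ∑ σ : Spins n, (if IsBalanced (lam n) σ then (0 : ℝ) else 1) ≤
              lam n * 2 ^ n := by
            refine le_trans (le_of_eq ?_) (card_not_balanced_le (hl n) hn0)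
            rw [Finset.card_filter]
            push_cast
            exact Finset.sum_congr rfl fun σ _ => by split_ifs <;> simp_all
          rw [Finset.sum_add_distrib, Finset.sum_const, Finset.card_univ, card_spins,
            nsmul_eq_mul]
          push_cast
          have h2 : (0 : ℝ) < 2 ^ n := by positivity
          rw [inv_mul_le_iff₀ h2]
          linarith
  have hlim : Tendsto (fun n => ENNReal.ofReal (lam n + (4 * Real.exp (-2)) ^ n)) atTop (𝓝 0) := by
    rw [← ENNReal.ofReal_zero]
    refine ENNReal.tendsto_ofReal ?_
    rw [← add_zero (0 : ℝ)]
    refine hl0.add (tendsto_pow_atTop_nhds_zero_of_lt_one (by positivity) ?_)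
    have h1 : (5 : ℝ) ≤ Real.exp 2 := by
      have := Real.quadratic_le_exp_of_nonneg (x := 2) (by norm_num)
      linarith
    rw [Real.exp_neg, ← div_eq_mul_inv, div_lt_one (Real.exp_pos _)]
    linarith
  have hlow : ∀ n, 1 - (semirandomModel a b (adv n)).toOuterMeasure {x | ¬ E n x.1 x.2} ≤
      (semirandomModel a b (adv n)).toOuterMeasure {x | E n x.1 x.2} := by
    intro n
    rw [tsub_le_iff_right]
    refine le_trans (le_of_eq ?_) (MeasureTheory.measure_union_le _ _)
    symm
    rw [PMF.toOuterMeasure_apply_eq_one_iff]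
    intro x _
    by_cases h : E n x.1 x.2 <;> simp [h]
  refine tendsto_of_tendsto_of_tendsto_of_le_of_le' (g := fun n =>
    1 - ENNReal.ofReal (lam n + (4 * Real.exp (-2)) ^ n)) (h := fun _ => 1) ?_
    tendsto_const_nhds ?_ ?_
  · have := ENNReal.Tendsto.sub (tendsto_const_nhds (x := (1 : ℝ≥0∞))) hlim
      (Or.inl ENNReal.one_ne_top)
    simpa using this
  · filter_upwards [hbad] with n hn
    exact (tsub_le_tsub_left hn 1).trans (hlow n)
  · refine Eventually.of_forall fun n => ?_
    exact (PMF.toOuterMeasure_mono _ (Set.subset_univ _)).trans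
      (le_of_eq ((PMF.toOuterMeasure_apply_eq_one_iff _ _).2 (Set.subset_univ _)))

/-! ### Positive semidefinite matrices -/

section PosSemidef

variable {n : ℕ} {Z : Matrix (Fin n) (Fin n) ℝ}

open scoped MatrixOrder in
theorem exists_gram (hZ : Z.PosSemidef) :
    ∃ C : Matrix (Fin n) (Fin n) ℝ, ∀ i j, Z i j = ∑ k, C k i * C k j := by
  obtain ⟨C, hC⟩ := (CStarAlgebra.nonneg_iff_eq_star_mul_self (a := Z)).1 hZ.nonneg
  refine ⟨C, fun i j => ?_⟩
  rw [hC]; simp [Matrix.mul_apply, Matrix.star_eq_conjTranspose]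

theorem two_mul_abs_le_of_posSemidef (hZ : Z.PosSemidef) (i j : Fin n) :
    2 * |Z i j| ≤ Z i i + Z j j := by
  obtain ⟨C, hC⟩ := exists_gram hZ
  simp only [hC]
  rw [← Finset.sum_add_distrib]
  calc _ ≤ 2 * ∑ k, |C k i * C k j| := by
        gcongr; exact Finset.abs_sum_le_sum_abs _ _
    _ ≤ _ := by
        rw [Finset.mul_sum]
        refine Finset.sum_le_sum fun k _ => ?_
        rcases abs_cases (C k i * C k j) with h | h <;> rw [h.1] <;>
          nlinarith [sq_nonneg (C k i - C k j), sq_nonneg (C k i + C k j)]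

theorem abs_le_one_of_posSemidef (hZ : Z.PosSemidef) (hd : ∀ i, Z i i ≤ 1) (i j : Fin n) :
    |Z i j| ≤ 1 := by
  have := two_mul_abs_le_of_posSemidef hZ i j
  linarith [hd i, hd j]

theorem quad_nonneg (hZ : Z.PosSemidef) (x : Fin n → ℝ) : 0 ≤ ∑ i, ∑ j, x i * Z i j * x j := by
  have := hZ.dotProduct_mulVec_nonneg x
  simpa [dotProduct, Matrix.mulVec, Finset.mul_sum, mul_assoc] using this

/-- The quadratic form of a positive semidefinite matrix is at most its trace. -/
theorem quad_le_trace (hZ : Z.PosSemidef) (x : Fin n → ℝ) :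
    ∑ i, ∑ j, x i * Z i j * x j ≤ (∑ i, Z i i) * ∑ i, x i ^ 2 := by
  obtain ⟨C, hC⟩ := exists_gram hZ
  have e : ∑ i, ∑ j, x i * Z i j * x j = ∑ k, (∑ i, C k i * x i) ^ 2 := by
    simp only [hC, sq, Finset.mul_sum, Finset.sum_mul]
    rw [Finset.sum_congr rfl fun i _ => Finset.sum_comm, Finset.sum_comm]
    exact Finset.sum_congr rfl fun k _ => Finset.sum_congr rfl fun i _ =>
      Finset.sum_congr rfl fun j _ => by ring
  rw [e]
  simp only [hC]
  rw [Finset.sum_comm, Finset.sum_mul]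
  refine Finset.sum_le_sum fun k _ => ?_
  refine (Finset.sum_mul_sq_le_sq_mul_sq _ _ _).trans (le_of_eq ?_)
  simp [sq]

theorem posSemidef_of_quad_nonneg (hs : ∀ i j, Z i j = Z j i)
    (h : ∀ x : Fin n → ℝ, 0 ≤ ∑ i, ∑ j, x i * Z i j * x j) : Z.PosSemidef := by
  refine Matrix.PosSemidef.of_dotProduct_mulVec_nonneg ?_ fun x => ?_
  · ext i j
    simpa using hs j i
  · have := h x
    simpa [dotProduct, Matrix.mulVec, Finset.mul_sum, mul_assoc] using this

end PosSemidef

/-! ### Near-optimal solutions correlate with the spins -/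

open Classical in
/-- The objective of the semidefinite program for the adjacency matrix with zero diagonal. -/
noncomputable def offDiagObjective {n : ℕ} (G : SimpleGraph (Fin n)) (lam : ℝ)
    (Z : Fin n → Fin n → ℝ) : ℝ :=
  ∑ i, ∑ j, ((if G.Adj i j then 1 else 0) - lam) * Z i j

theorem sgn_mul_sgn_of_ne {s t : ℤˣ} (h : s ≠ t) : sgn s * sgn t = -1 := by
  rcases Int.units_eq_one_or s with h1 | h1 <;>
  rcases Int.units_eq_one_or t with h2 | h2 <;> simp_all [sgn]

theorem pairProb_eq (a b : ℝ) {n : ℕ} (σ : Spins n) (i j : Fin n) :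
    pairProb a b σ i j = (a + b) / (2 * n) + (a - b) / (2 * n) * (sgn (σ i) * sgn (σ j)) := by
  unfold pairProb
  by_cases h : σ i = σ j
  · rw [if_pos h, h, sgn_mul_self]; ring
  · rw [if_neg h, sgn_mul_sgn_of_ne h]; ring

/-- The matrix of the hidden communities is feasible. A monotone change increases its objective at
least as much as that of any other feasible matrix, so near-optimality for the observed graph `G`
passes to the block model graph `H`. There the mean of the adjacency matrix is
`(a - b) / (2 n) σ σᵀ + (a + b) / (2 n) J`, and the deviation from the mean is controlled by
Grothendieck's inequality. -/
theorem correlation_of_nearOptimal {a b lam e : ℝ} {n : ℕ} {σ : Spins n}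
    {H G : SimpleGraph (Fin n)} {Z : Matrix (Fin n) (Fin n) ℝ} (hn : 0 < n) (hb : 0 ≤ b)
    (hab : b < a) (hcut : IsCutBounded a b σ H) (hmono : IsMonotoneChange σ H G)
    (hbal : IsBalanced lam σ) (hlam : (a + b) / (2 * n) ≤ lam) (hZ : Z.PosSemidef)
    (hd : ∀ i, Z i i ≤ 1)
    (hopt : offDiagObjective G lam (fun i j => sgn (σ i) * sgn (σ j)) - e ≤
      offDiagObjective G lam Z) :
    (a - b) / (2 * n) * (n ^ 2 - ∑ i, ∑ j, sgn (σ i) * Z i j * sgn (σ j)) ≤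
      36 * n * √(a + b) + n + a + e := by
  classical
  have hn' : (0 : ℝ) < n := by exact_mod_cast hn
  set c := (a + b) / (2 * n) with hc
  set d := (a - b) / (2 * n) with hdd
  have hZ1 := abs_le_one_of_posSemidef hZ hd
  -- near-optimality for the block model graph
  have step1 : offDiagObjective H lam (fun i j => sgn (σ i) * sgn (σ j)) - e ≤
      offDiagObjective H lam Z := by
    have : offDiagObjective G lam Z - offDiagObjective H lam Z ≤
        offDiagObjective G lam (fun i j => sgn (σ i) * sgn (σ j)) -
        offDiagObjective H lam (fun i j => sgn (σ i) * sgn (σ j)) := by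
      simp only [offDiagObjective, ← Finset.sum_sub_distrib]
      refine Finset.sum_le_sum fun i _ => Finset.sum_le_sum fun j _ => ?_
      have h1 := hmono i j
      have h2 := abs_le.1 (hZ1 i j)
      by_cases hs : σ i = σ j
      · have e1 : sgn (σ i) * sgn (σ j) = 1 := by rw [hs, sgn_mul_self]
        rw [e1]
        have := h1.1 hs
        by_cases hG : G.Adj i j <;> by_cases hH : H.Adj i j <;> simp [hG, hH] <;>
          first | linarith | exact absurd (this hH) hG
      · have e1 : sgn (σ i) * sgn (σ j) = -1 := sgn_mul_sgn_of_ne hs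
        rw [e1]
        have := h1.2 hs
        by_cases hG : G.Adj i j <;> by_cases hH : H.Adj i j <;> simp [hG, hH] <;>
          first | linarith | exact absurd (this hG) hH
    linarith
  -- splitting off the mean
  have split : ∀ X : Fin n → Fin n → ℝ, offDiagObjective H lam X =
      (∑ i, ∑ j, centered a b σ H i j * X i j) + (c - lam) * (∑ i, ∑ j, X i j) +
      d * (∑ i, ∑ j, sgn (σ i) * X i j * sgn (σ j)) - a / n * ∑ i, X i i := by
    intro X
    have hdiag : ∑ i, X i i = ∑ i, ∑ j, if i = j then X i j else 0 := by simp
    rw [hdiag]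
    simp only [offDiagObjective, Finset.mul_sum, ← Finset.sum_add_distrib,
      ← Finset.sum_sub_distrib]
    refine Finset.sum_congr rfl fun i _ => Finset.sum_congr rfl fun j _ => ?_
    by_cases h : i = j
    · subst h
      have : c + d = a / n := by rw [hc, hdd]; ring
      simp only [centered, if_true, SimpleGraph.irrefl, if_false]
      rw [← this]
      linear_combination (-d * X i i) * sgn_mul_self (σ i)
    · simp only [centered, h, if_false, pairProb_eq]
      rw [← hc, ← hdd]
      ring
  have s1 := split Z
  have s2 := split fun i j => sgn (σ i) * sgn (σ j)
  have g1 : ∑ i, ∑ j, centered a b σ H i j * Z i j ≤ 8 * (4 * n * √(a + b)) :=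
    sum_mul_le_of_posSemidef hcut hZ hd
  have g2 : -(∑ i, ∑ j, centered a b σ H i j * (sgn (σ i) * sgn (σ j))) ≤ 4 * n * √(a + b) := by
    refine le_trans (le_of_eq ?_) (hcut (fun i => -σ i) σ)
    simp only [← Finset.sum_neg_distrib]
    refine Finset.sum_congr rfl fun i _ => Finset.sum_congr rfl fun j _ => ?_
    simp [sgn, mul_assoc]
  have g3 : 0 ≤ ∑ i, ∑ j, Z i j := by
    simpa using quad_nonneg hZ fun _ => 1
  have g4 : 0 ≤ ∑ i, Z i i := Finset.sum_nonneg fun i _ => hZ.diag_nonneg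
  have g5 : ∑ i, ∑ j, sgn (σ i) * sgn (σ j) = (∑ i, sgn (σ i)) ^ 2 := by
    rw [sq, Finset.sum_mul_sum]
  have g6 : ∑ i : Fin n, ∑ j : Fin n, sgn (σ i) * (sgn (σ i) * sgn (σ j)) * sgn (σ j) =
      (n : ℝ) ^ 2 := by
    have : ∀ i j, sgn (σ i) * (sgn (σ i) * sgn (σ j)) * sgn (σ j) = 1 := by
      intro i j
      rw [← mul_assoc, sgn_mul_self, one_mul, sgn_mul_self]
    simp [this, sq]
  have g7 : ∑ i, sgn (σ i) * sgn (σ i) = n := by simp [sgn_mul_self]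
  rw [g5, g6, g7] at s2
  have g8 : a / n * n = a := by field_simp
  have hbal' : lam * (∑ i, sgn (σ i)) ^ 2 ≤ n := hbal
  have hc0 : 0 ≤ c := by rw [hc]; apply div_nonneg <;> linarith
  have ha0 : 0 ≤ a / n := by apply div_nonneg <;> linarith
  have m1 := mul_nonneg (sub_nonneg.2 hlam) g3
  have m2 := mul_nonneg ha0 g4
  have m3 := mul_nonneg hc0 (sq_nonneg (∑ i, sgn (σ i)))
  rw [g8] at s2
  linarith

/-! ### Rounding by a top eigenvector -/

theorem hasEigenvalue_iff_mem_spectrum {n : ℕ} {Z : Matrix (Fin n) (Fin n) ℝ} {μ : ℝ} :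
    Module.End.HasEigenvalue (Matrix.toLin' Z) μ ↔ μ ∈ spectrum ℝ Z := by
  rw [Module.End.hasEigenvalue_iff_mem_spectrum, Matrix.spectrum_toLin']

theorem exists_isTopEigenvector {n : ℕ} (hn : 1 ≤ n) {Z : Matrix (Fin n) (Fin n) ℝ}
    (hZ : Z.IsHermitian) : ∃ v, IsTopEigenvector Z v := by
  have : Nonempty (Fin n) := ⟨⟨0, hn⟩⟩
  obtain ⟨i, hi⟩ := Finite.exists_max hZ.eigenvalues
  have hmem : ∀ ν, Module.End.HasEigenvalue (Matrix.toLin' Z) ν ↔ ∃ j, hZ.eigenvalues j = ν := by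
    intro ν
    rw [hasEigenvalue_iff_mem_spectrum, hZ.spectrum_real_eq_range_eigenvalues, Set.mem_range]
  obtain ⟨v, hv⟩ := ((hmem _).2 ⟨i, rfl⟩).exists_hasEigenvector
  refine ⟨v, _, hv, fun ν hν => ?_⟩
  obtain ⟨j, rfl⟩ := (hmem ν).1 hν
  exact hi j

/-- The largest eigenvalue bounds the quadratic form. -/
theorem quad_le_of_top {n : ℕ} {Z : Matrix (Fin n) (Fin n) ℝ} (hZ : Z.IsHermitian) {μ : ℝ}
    (hμ : ∀ ν : ℝ, Module.End.HasEigenvalue (Matrix.toLin' Z) ν → ν ≤ μ) (x : Fin n → ℝ) :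
    ∑ i, ∑ j, x i * Z i j * x j ≤ μ * ∑ i, x i ^ 2 := by
  have hps : (algebraMap ℝ (Matrix (Fin n) (Fin n) ℝ) μ - Z).PosSemidef := by
    rw [Matrix.posSemidef_iff_isHermitian_and_spectrum_nonneg]
    constructor
    · refine Matrix.IsHermitian.sub ?_ hZ
      ext i j
      simp [Matrix.algebraMap_matrix_apply, eq_comm]
    · rw [← spectrum.singleton_sub_eq]
      rintro _ ⟨_, rfl, ν, hν, rfl⟩
      have := hμ ν (hasEigenvalue_iff_mem_spectrum.2 hν)
      simpa using this
  have := quad_nonneg hps x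
  have e : ∑ i, ∑ j, x i * (algebraMap ℝ (Matrix (Fin n) (Fin n) ℝ) μ - Z) i j * x j =
      μ * ∑ i, x i ^ 2 - ∑ i, ∑ j, x i * Z i j * x j := by
    simp [Matrix.algebraMap_matrix_apply, mul_sub, sub_mul, Finset.sum_sub_distrib,
      Finset.mul_sum]
    exact Finset.sum_congr rfl fun i _ => by ring
  linarith

/-- One of a vector and its negative matches at least half of the spins. -/
theorem isPartialRecovery_of_le_half {n : ℕ} {η : ℝ} (hη : η ≤ 1 / 2) (τ σ : Spins n) :
    IsPartialRecovery η τ σ := by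
  by_contra h
  simp only [IsPartialRecovery, not_or, not_le] at h
  have hc : (Finset.univ : Finset (Fin n)) ⊆ (Finset.univ.filter fun v => τ v = σ v) ∪
      (Finset.univ.filter fun v => -τ v = σ v) := by
    intro v _
    rcases Int.units_eq_one_or (σ v) with h1 | h1 <;>
    rcases Int.units_eq_one_or (τ v) with h2 | h2 <;> simp [h1, h2]
  have h3 := (Finset.card_le_card hc).trans (Finset.card_union_le _ _)
  rw [Finset.card_univ, Fintype.card_fin] at h3
  have h4 : (n : ℝ) ≤ ((Finset.univ.filter fun v => τ v = σ v).card : ℝ) +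
      ((Finset.univ.filter fun v => -τ v = σ v).card : ℝ) := by exact_mod_cast h3
  have : (0 : ℝ) ≤ n := Nat.cast_nonneg n
  nlinarith [h.1, h.2]

/-- Spins agree wherever a nearby vector has their sign, so the squared distance bounds the number
of errors. -/
theorem le_card_agree {n : ℕ} {ρ σ : Spins n} {x : Fin n → ℝ}
    (hx : ∀ i, ρ i ≠ σ i → sgn (σ i) * x i ≤ 0) :
    (n : ℝ) - ∑ i, (sgn (σ i) - x i) ^ 2 ≤
      ((Finset.univ.filter fun v => ρ v = σ v).card : ℝ) := by
  have h1 : ((Finset.univ.filter fun v => ¬ ρ v = σ v).card : ℝ) ≤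
      ∑ i, (sgn (σ i) - x i) ^ 2 := by
    rw [Finset.card_filter]
    push_cast
    refine Finset.sum_le_sum fun i _ => ?_
    split_ifs with h
    · positivity
    · have := hx i h
      have := sgn_mul_self (σ i)
      nlinarith [sq_nonneg (x i)]
  have h2 := Finset.card_filter_add_card_filter_not (s := (Finset.univ : Finset (Fin n)))
    (fun v => ρ v = σ v)
  rw [Finset.card_univ, Fintype.card_fin] at h2
  have h3 : ((Finset.univ.filter fun v => ρ v = σ v).card : ℝ) +
    ((Finset.univ.filter fun v => ¬ ρ v = σ v).card : ℝ) = n := by exact_mod_cast h2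
  linarith

/-- The signs of a top eigenvector recover the spins. With `Z` of trace at most `n`, the largest
eigenvalue `μ` leaves at most `n - μ` for the complement of the eigenvector, so `σ` has to lie
close to the line of the eigenvector. -/
theorem isPartialRecovery_of_topEigenvector {n : ℕ} (hn : 0 < n) {η : ℝ} {σ τ : Spins n}
    {Z : Matrix (Fin n) (Fin n) ℝ} (hZ : Z.PosSemidef) (hd : ∀ i, Z i i ≤ 1)
    (hq : η * n ^ 2 ≤ ∑ i, ∑ j, sgn (σ i) * Z i j * sgn (σ j)) {v : Fin n → ℝ}
    (hv : IsTopEigenvector Z v) (hτ : IsSignVector v τ) : IsPartialRecovery η τ σ := by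
  rcases le_or_gt η (1 / 2) with hη | hη
  · exact isPartialRecovery_of_le_half hη τ σ
  have hn' : (0 : ℝ) < n := by exact_mod_cast hn
  obtain ⟨μ, hev, htop⟩ := hv
  have hZv : ∀ i, ∑ j, Z i j * v j = μ * v i := by
    intro i
    have := congrFun hev.apply_eq_smul i
    simpa [Matrix.mulVec, dotProduct] using this
  have hsym : ∀ i j, Z i j = Z j i := fun i j => by
    have := congrFun (congrFun hZ.1 i) j
    simpa using this.symm
  set N := ∑ i, v i ^ 2 with hN
  have hNpos : 0 < N := by
    obtain ⟨i, hi⟩ := Function.ne_iff.1 hev.2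
    refine Finset.sum_pos' (fun _ _ => sq_nonneg _) ⟨i, Finset.mem_univ _, ?_⟩
    have : v i ≠ 0 := hi
    positivity
  set s := ∑ i, sgn (σ i) * v i with hs
  have hσσ : ∑ i, sgn (σ i) ^ 2 = n := by simp [sq, sgn_mul_self]
  -- the form on vectors, and the form with the eigenvector split off
  have hvZ : ∀ x : Fin n → ℝ, ∑ i, ∑ j, x i * Z i j * v j = μ * ∑ i, x i * v i := by
    intro x
    rw [Finset.mul_sum]
    refine Finset.sum_congr rfl fun i _ => ?_
    rw [show μ * (x i * v i) = x i * (μ * v i) by ring, ← hZv i, Finset.mul_sum]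
    exact Finset.sum_congr rfl fun j _ => by ring
  have hZx : ∀ x : Fin n → ℝ, ∑ i, ∑ j, v i * Z i j * x j = μ * ∑ i, x i * v i := by
    intro x
    rw [← hvZ, Finset.sum_comm]
    exact Finset.sum_congr rfl fun j _ => Finset.sum_congr rfl fun i _ => by rw [hsym i j]; ring
  have hvv : ∑ i, v i * v i = N := by simp [hN, sq]
  have shift : ∀ (x : Fin n → ℝ) (c : ℝ),
      ∑ i, ∑ j, (x i - c * v i) * Z i j * (x j - c * v j) =
      (∑ i, ∑ j, x i * Z i j * x j) - 2 * c * (μ * ∑ i, x i * v i) + c ^ 2 * (μ * N) := by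
    intro x c
    have : ∑ i, ∑ j, (x i - c * v i) * Z i j * (x j - c * v j) =
      (∑ i, ∑ j, x i * Z i j * x j) - c * (∑ i, ∑ j, x i * Z i j * v j) -
      c * (∑ i, ∑ j, v i * Z i j * x j) + c ^ 2 * (∑ i, ∑ j, v i * Z i j * v j) := by
      simp only [Finset.mul_sum, ← Finset.sum_sub_distrib, ← Finset.sum_add_distrib]
      exact Finset.sum_congr rfl fun i _ => Finset.sum_congr rfl fun j _ => by ring
    rw [this, hvZ, hZx, hvZ, hvv]; ring
  -- the deflated matrix is positive semidefinite, of trace at most `n - μ`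
  let Z' : Matrix (Fin n) (Fin n) ℝ := Matrix.of fun i j => Z i j - μ / N * (v i * v j)
  have hquad' : ∀ x : Fin n → ℝ, ∑ i, ∑ j, x i * Z' i j * x j =
      (∑ i, ∑ j, x i * Z i j * x j) - μ / N * (∑ i, x i * v i) ^ 2 := by
    intro x
    rw [sq, Finset.sum_mul_sum]
    simp only [Z', Matrix.of_apply, Finset.mul_sum, ← Finset.sum_sub_distrib]
    exact Finset.sum_congr rfl fun i _ => Finset.sum_congr rfl fun j _ => by ring
  have hZ' : Z'.PosSemidef := by
    refine posSemidef_of_quad_nonneg (fun i j => ?_) fun x => ?_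
    · simp only [Z', Matrix.of_apply]; rw [hsym i j, mul_comm (v i)]
    · have h1 := quad_nonneg hZ fun i => x i - (∑ k, x k * v k) / N * v i
      rw [shift] at h1
      rw [hquad']
      refine h1.trans (le_of_eq ?_)
      field_simp
      ring
  have htr : ∑ i, Z' i i ≤ n - μ := by
    simp only [Z', Matrix.of_apply, Finset.sum_sub_distrib, ← Finset.mul_sum, hvv]
    rw [div_mul_cancel₀ _ hNpos.ne']
    have : ∑ i, Z i i ≤ ∑ _i : Fin n, (1 : ℝ) := Finset.sum_le_sum fun i _ => hd i
    simp at this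
    linarith
  set q := ∑ i, ∑ j, sgn (σ i) * Z i j * sgn (σ j) with hqdef
  set A := s ^ 2 / N with hA
  have hw : ∑ i, (sgn (σ i) - s / N * v i) ^ 2 = n - A := by
    have : ∑ i, (sgn (σ i) - s / N * v i) ^ 2 =
        (∑ i, sgn (σ i) ^ 2) - 2 * (s / N) * s + (s / N) ^ 2 * N := by
      rw [hs, hN]
      simp only [Finset.mul_sum, ← Finset.sum_sub_distrib, ← Finset.sum_add_distrib]
      exact Finset.sum_congr rfl fun i _ => by ring
    rw [this, hσσ, hA]
    field_simp
    ring
  have hA0 : 0 ≤ A := by positivity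
  have hμn : q ≤ μ * n := by
    rw [← hσσ]
    exact quad_le_of_top hZ.1 htop _
  have hμ1 : μ ≤ n := by
    have : 0 ≤ ∑ i, Z' i i := Finset.sum_nonneg fun i _ => hZ'.diag_nonneg
    linarith
  have hμ2 : η * n ≤ μ := by
    have : η * n * n ≤ μ * n := by nlinarith
    exact le_of_mul_le_mul_right this hn'
  have hAn : 0 ≤ n - A := by rw [← hw]; exact Finset.sum_nonneg fun _ _ => sq_nonneg _
  have hmain : q ≤ μ * A + (n - μ) * (n - A) := by
    have h1 := quad_le_trace hZ' fun i => sgn (σ i) - s / N * v i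
    rw [hquad', shift, hw] at h1
    have h2 : ∑ i, (sgn (σ i) - s / N * v i) * v i = 0 := by
      have : ∑ i, (sgn (σ i) - s / N * v i) * v i = s - s / N * N := by
        rw [hs, ← hvv, Finset.mul_sum, ← Finset.sum_sub_distrib]
        exact Finset.sum_congr rfl fun i _ => by ring
      rw [this]; field_simp; ring
    rw [h2] at h1
    have h3 : (∑ i, Z' i i) * (n - A) ≤ (n - μ) * (n - A) :=
      mul_le_mul_of_nonneg_right htr hAn
    have h4 : 2 * (s / N) * (μ * ∑ i, sgn (σ i) * v i) - (s / N) ^ 2 * (μ * N) = μ * A := by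
      rw [← hs, hA]; field_simp; ring
    linarith
  have hkey : η * n ≤ A := by
    by_contra hlt
    push Not at hlt
    have : 0 < 2 * μ - n := by nlinarith
    have h5 : (2 * μ - n) * A ≤ (2 * μ - n) * (η * n) := by
      exact mul_le_mul_of_nonneg_left hlt.le this.le
    have h6 : (2 * μ - n) * A < (2 * μ - n) * (η * n) := by
      exact mul_lt_mul_of_pos_left hlt this
    have h7 : μ * (2 * η - 1) ≤ n * (2 * η - 1) :=
      mul_le_mul_of_nonneg_right hμ1 (by linarith)
    nlinarith
  have sign_le : ∀ i, (τ i = σ i → 0 ≤ sgn (σ i) * v i) ∧ (τ i ≠ σ i → sgn (σ i) * v i ≤ 0) := by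
    intro i
    have := hτ i
    rcases Int.units_eq_one_or (σ i) with h1 | h1 <;>
    rcases Int.units_eq_one_or (τ i) with h2 | h2 <;> simp [h1, h2, sgn] <;> by_contra h3 <;>
    simp_all
  rcases le_total 0 s with h0 | h0
  · left
    refine le_trans ?_ (le_card_agree (x := fun i => s / N * v i) fun i hi => ?_)
    · rw [hw]; linarith
    · have := (sign_le i).2 hi
      have h8 : 0 ≤ s / N := by positivity
      nlinarith
  · right
    refine le_trans ?_ (le_card_agree (ρ := fun i => -τ i) (x := fun i => s / N * v i)
      fun i hi => ?_)
    · rw [hw]; linarith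
    · have h9 : τ i = σ i := by
        rcases Int.units_eq_one_or (σ i) with h1 | h1 <;>
        rcases Int.units_eq_one_or (τ i) with h2 | h2 <;> simp_all
      have := (sign_le i).1 h9
      have h8 : s / N ≤ 0 := div_nonpos_of_nonpos_of_nonneg h0 hNpos.le
      nlinarith

/-! ### The semidefinite program -/

theorem isCompact_feasible (n : ℕ) : IsCompact (feasible n) := by
  have hcl : IsClosed (feasible n) := by
    have : feasible n = (⋂ i, ⋂ j, {Z : Matrix (Fin n) (Fin n) ℝ | Z i j = Z j i}) ∩
        (⋂ x : Fin n → ℝ, {Z | 0 ≤ ∑ i, ∑ j, x i * Z i j * x j}) ∩ ⋂ i, {Z | Z i i ≤ 1} := by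
      ext Z
      simp only [feasible, Set.mem_ofPred_eq, Set.mem_inter_iff, Set.mem_iInter]
      refine and_congr_left fun _ => ⟨fun h => ⟨fun i j => ?_, quad_nonneg h⟩,
        fun h => posSemidef_of_quad_nonneg h.1 h.2⟩
      have := congrFun (congrFun h.1 i) j
      simpa using this.symm
    rw [this]
    refine (IsClosed.inter ?_ ?_).inter ?_
    · exact isClosed_iInter fun i => isClosed_iInter fun j =>
        isClosed_eq (by fun_prop) (by fun_prop)
    · exact isClosed_iInter fun x => isClosed_le (by fun_prop) (by fun_prop)
    · exact isClosed_iInter fun i => isClosed_le (by fun_prop) (by fun_prop)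
  refine (isCompact_univ_pi fun _ : Fin n => isCompact_univ_pi fun _ : Fin n =>
    isCompact_Icc (a := (-1 : ℝ)) (b := 1)).of_isClosed_subset hcl ?_
  intro Z hZ
  simp only [Set.mem_univ_pi]
  exact fun i j => abs_le.1 (abs_le_one_of_posSemidef hZ.1 hZ.2 i j)

theorem exists_isSDPSolution {n : ℕ} (G : SimpleGraph (Fin n)) (lam : ℝ) :
    ∃ Z, IsSDPSolution G lam Z := by
  refine (isCompact_feasible n).exists_isMaxOn ⟨0, Matrix.PosSemidef.zero, by simp⟩ ?_
  unfold objective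
  fun_prop

theorem exists_isSDPOutput {n : ℕ} (hn : 1 ≤ n) (G : SimpleGraph (Fin n)) (lam : ℝ) :
    ∃ τ, IsSDPOutput G lam τ := by
  obtain ⟨Z, hZ⟩ := exists_isSDPSolution G lam
  obtain ⟨v, hv⟩ := exists_isTopEigenvector hn hZ.1.1.1
  refine ⟨fun i => if 0 < v i then 1 else -1, Z, v, hZ, hv, fun i => ⟨fun h => by simp [h],
    fun h => by simp [h.le]⟩⟩

/-- The rank one matrix of the hidden communities. -/
def spinMatrix {n : ℕ} (σ : Spins n) : Matrix (Fin n) (Fin n) ℝ :=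
  Matrix.of fun i j => sgn (σ i) * sgn (σ j)

theorem spinMatrix_mem_feasible {n : ℕ} (σ : Spins n) : spinMatrix σ ∈ feasible n := by
  refine ⟨posSemidef_of_quad_nonneg (fun i j => mul_comm _ _) fun x => ?_, fun i => ?_⟩
  · have : ∑ i, ∑ j, x i * spinMatrix σ i j * x j = (∑ i, x i * sgn (σ i)) ^ 2 := by
      rw [sq, Finset.sum_mul_sum]
      exact Finset.sum_congr rfl fun i _ => Finset.sum_congr rfl fun j _ => by
        simp only [spinMatrix, Matrix.of_apply]; ring
    rw [this]; positivity
  · simp [spinMatrix, sgn_mul_self]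

theorem objective_eq {n : ℕ} (G : SimpleGraph (Fin n)) (lam : ℝ) (Z : Matrix (Fin n) (Fin n) ℝ) :
    objective G lam Z = offDiagObjective G lam Z + ∑ i, Z i i := by
  have hdiag : ∑ i, Z i i = ∑ i, ∑ j, if i = j then Z i j else 0 := by simp
  rw [hdiag]
  simp only [objective, offDiagObjective, ← Finset.sum_add_distrib]
  refine Finset.sum_congr rfl fun i _ => Finset.sum_congr rfl fun j _ => ?_
  by_cases h : i = j
  · subst h; simp [adj]; ring
  · by_cases hG : G.Adj i j <;> simp [adj, h, hG]

/-- An optimal solution is at least as good as the matrix of the communities, off the diagonal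
as well, where the latter has the largest trace possible. -/
theorem offDiagObjective_le_of_isSDPSolution {n : ℕ} {G : SimpleGraph (Fin n)} {lam : ℝ}
    {Z : Matrix (Fin n) (Fin n) ℝ} (hZ : IsSDPSolution G lam Z) (σ : Spins n) :
    offDiagObjective G lam (fun i j => sgn (σ i) * sgn (σ j)) ≤ offDiagObjective G lam Z := by
  have h : objective G lam (spinMatrix σ) ≤ objective G lam Z :=
    hZ.2 (spinMatrix_mem_feasible σ)
  rw [objective_eq, objective_eq] at h
  have h1 : ∑ i, spinMatrix σ i i = n := by simp [spinMatrix, sgn_mul_self]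
  have h2 : ∑ i, Z i i ≤ ∑ _i : Fin n, (1 : ℝ) := Finset.sum_le_sum fun i _ => hZ.1.2 i
  simp at h2
  have h3 : offDiagObjective G lam (spinMatrix σ) =
    offDiagObjective G lam (fun i j => sgn (σ i) * sgn (σ j)) := rfl
  linarith

theorem tendsto_log_div_nat : Tendsto (fun n : ℕ => Real.log n / n) atTop (𝓝 0) := by
  have := (Real.isLittleO_log_id_atTop).tendsto_div_nhds_zero
  exact this.comp tendsto_natCast_atTop_atTop

theorem holdsAAS_isSDPOutput {a b η : ℝ} (hb : 0 ≤ b) (hab : b < a) (ha : 20 < a) (hη : η < 1)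
    (h : 10 ^ 4 * ((1 - η) ^ 2)⁻¹ * (a + b) ≤ (a - b) ^ 2) :
    HoldsAAS a b fun n σ G =>
      ∀ τ, IsSDPOutput G (Real.log n / n) τ → IsPartialRecovery η τ σ := by
  have hr : 0 < 1 - η := by linarith
  have hd : 0 < a - b := by linarith
  have hs : 0 < a + b := by linarith
  have h2 : 2 ≤ √(a + b) := by rw [Real.le_sqrt (by norm_num) hs.le]; linarith
  have hgap : 100 * √(a + b) ≤ (1 - η) * (a - b) := by
    refine le_of_sq_le_sq ?_ (by positivity)
    rw [mul_pow, Real.sq_sqrt hs.le, mul_pow]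
    have h3 : 10 ^ 4 * (a + b) = (1 - η) ^ 2 * (10 ^ 4 * ((1 - η) ^ 2)⁻¹ * (a + b)) := by
      field_simp
    calc (100 : ℝ) ^ 2 * (a + b) = 10 ^ 4 * (a + b) := by norm_num
      _ ≤ _ := by rw [h3]; gcongr
  refine holdsAAS_of_good hb hab (by linarith) (lam := fun n : ℕ => Real.log n / n)
    (fun n => div_nonneg (Real.log_natCast_nonneg n) (Nat.cast_nonneg n)) tendsto_log_div_nat ?_
  have hlog : ∀ᶠ n : ℕ in atTop, (a + b) / 2 ≤ Real.log n :=
    (Real.tendsto_log_atTop.comp tendsto_natCast_atTop_atTop).eventually_ge_atTop _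
  filter_upwards [hlog, eventually_gt_atTop 0, eventually_ge_atTop ⌈a⌉₊] with n hn hn0 hna
  intro σ H G hbal hcut hmono τ hτ
  obtain ⟨Z, v, hZ, hv, hvτ⟩ := hτ
  have hn' : (0 : ℝ) < n := by exact_mod_cast hn0
  have han : a ≤ n := (Nat.le_ceil a).trans (by exact_mod_cast hna)
  have hlam : (a + b) / (2 * n) ≤ Real.log n / n := by
    rw [← div_div]; gcongr
  have key := correlation_of_nearOptimal (e := 0) hn0 hb hab hcut hmono hbal hlam hZ.1.1 hZ.1.2
    (by simpa using offDiagObjective_le_of_isSDPSolution hZ σ)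
  refine isPartialRecovery_of_topEigenvector hn0 hZ.1.1 hZ.1.2 ?_ hv hvτ
  set q := ∑ i, ∑ j, sgn (σ i) * Z i j * sgn (σ j)
  rw [div_mul_eq_mul_div, div_le_iff₀ (by positivity)] at key
  by_contra hlt
  push Not at hlt
  have h4 : (a - b) * ((1 - η) * n ^ 2) < (a - b) * (n ^ 2 - q) :=
    mul_lt_mul_of_pos_left (by linarith) hd
  have h5 : 100 * √(a + b) * n ^ 2 ≤ (1 - η) * (a - b) * n ^ 2 := by gcongr
  have h6 : a * n ≤ n ^ 2 := by nlinarith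
  have h7 : 2 * (n : ℝ) ^ 2 ≤ √(a + b) * n ^ 2 := by gcongr
  nlinarith

/-! ### Costs of random access programs -/

/-- All memory cells are at most `V` in absolute value. -/
def MemLE (V : ℕ) (s : Memory) : Prop := ∀ x i, (s x i).natAbs ≤ V

/-- Writing `v` to cell `i` of array `x`. -/
def store (s : Memory) (x : ℕ) (i v : ℤ) : Memory :=
  Function.update s x (Function.update (s x) i v)

theorem store_of_ne {s : Memory} {x y : ℕ} {i v : ℤ} (h : y ≠ x) : store s x i v y = s y :=
  Function.update_of_ne h _ _

theorem store_apply {s : Memory} {x : ℕ} {i v j : ℤ} :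
    store s x i v x j = if j = i then v else s x j := by
  simp [store, Function.update_apply]

theorem MemLE.store {V : ℕ} {s : Memory} (h : MemLE V s) {x : ℕ} {i v : ℤ} (hv : v.natAbs ≤ V) :
    MemLE V (store s x i v) := by
  intro y j
  by_cases hy : y = x
  · subst hy
    rw [store_apply]
    split_ifs
    · exact hv
    · exact h _ _
  · rw [store_of_ne hy]; exact h _ _

/-- The number of nodes of an expression. -/
def Expr.size : Expr → ℕ
  | .lit _ => 1
  | .get _ i => i.size + 1
  | .add e f => e.size + f.size + 1
  | .sub e f => e.size + f.size + 1
  | .mul e f => e.size + f.size + 1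
  | .div e f => e.size + f.size + 1

/-- The largest absolute value of a literal in an expression. -/
def Expr.maxLit : Expr → ℕ
  | .lit c => c.natAbs
  | .get _ i => i.maxLit
  | .add e f => max e.maxLit f.maxLit
  | .sub e f => max e.maxLit f.maxLit
  | .mul e f => max e.maxLit f.maxLit
  | .div e f => max e.maxLit f.maxLit

/-- An expression with few nodes and small literals. -/
def Expr.Small (e : Expr) : Prop := e.maxLit ≤ 2 ∧ e.size ≤ 1000

instance (e : Expr) : Decidable e.Small := inferInstanceAs (Decidable (_ ∧ _))

theorem bits_le_of_natAbs_le {z : ℤ} {V : ℕ} (h : z.natAbs ≤ V) : bits z ≤ V.size + 1 := by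
  unfold bits
  have := Nat.size_le_size h
  omega

theorem bits_le_of_natAbs_le_add {x y z : ℤ} (h : z.natAbs ≤ x.natAbs + y.natAbs) :
    bits z ≤ bits x + bits y := by
  unfold bits
  have : z.natAbs.size ≤ x.natAbs.size + y.natAbs.size + 1 := by
    rw [Nat.size_le]
    have h1 := Nat.lt_size_self x.natAbs
    have h2 := Nat.lt_size_self y.natAbs
    have h3 : 2 ^ x.natAbs.size ≤ 2 ^ (x.natAbs.size + y.natAbs.size) :=
      Nat.pow_le_pow_right (by norm_num) (by omega)
    have h4 : 2 ^ y.natAbs.size ≤ 2 ^ (x.natAbs.size + y.natAbs.size) :=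
      Nat.pow_le_pow_right (by norm_num) (by omega)
    rw [pow_succ]
    omega
  omega

theorem bits_mul_le (x y : ℤ) : bits (x * y) ≤ bits x + bits y := by
  unfold bits
  have : (x * y).natAbs.size ≤ x.natAbs.size + y.natAbs.size := by
    rw [Nat.size_le, Int.natAbs_mul, pow_add]
    have h1 := Nat.lt_size_self x.natAbs
    have h2 := Nat.lt_size_self y.natAbs
    exact Nat.mul_lt_mul'' h1 h2
  omega

theorem bits_div_le (x y : ℤ) : bits (x / y) ≤ bits x + bits y := by
  have := bits_le_of_natAbs_le_add (x := x) (y := y) (z := x / y)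
    ((Int.natAbs_ediv_le_natAbs x y).trans (by omega))
  exact this

theorem Expr.bits_eval_le {V : ℕ} {s : Memory} (hs : MemLE V s) (e : Expr) (he : e.maxLit ≤ V) :
    bits (e.eval s) ≤ e.size * (V.size + 1) := by
  induction e with
  | lit c => simpa [Expr.eval, Expr.size] using bits_le_of_natAbs_le he
  | get x i _ =>
    have := bits_le_of_natAbs_le (hs x (i.eval s))
    simp only [Expr.eval, Expr.size]
    nlinarith
  | add e f he1 hf1 =>
    have h1 := he1 ((le_max_left _ _).trans he)
    have h2 := hf1 ((le_max_right _ _).trans he)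
    have := bits_le_of_natAbs_le_add (Int.natAbs_add_le (e.eval s) (f.eval s))
    simp only [Expr.eval, Expr.size]
    nlinarith
  | sub e f he1 hf1 =>
    have h1 := he1 ((le_max_left _ _).trans he)
    have h2 := hf1 ((le_max_right _ _).trans he)
    have := bits_le_of_natAbs_le_add (Int.natAbs_sub_le (e.eval s) (f.eval s))
    simp only [Expr.eval, Expr.size]
    nlinarith
  | mul e f he1 hf1 =>
    have h1 := he1 ((le_max_left _ _).trans he)
    have h2 := hf1 ((le_max_right _ _).trans he)
    have := bits_mul_le (e.eval s) (f.eval s)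
    simp only [Expr.eval, Expr.size]
    nlinarith
  | div e f he1 hf1 =>
    have h1 := he1 ((le_max_left _ _).trans he)
    have h2 := hf1 ((le_max_right _ _).trans he)
    have := bits_div_le (e.eval s) (f.eval s)
    simp only [Expr.eval, Expr.size]
    nlinarith

/-- The logarithmic cost of an expression is quadratic in its size, in units of the word length. -/
theorem Expr.cost_le {V : ℕ} {s : Memory} (hs : MemLE V s) (e : Expr) (he : e.maxLit ≤ V) :
    e.cost s ≤ e.size * e.size * (V.size + 1) := by
  have hb := Expr.bits_eval_le hs e he
  have arith : ∀ m k B : ℕ, m * m * B + k * k * B + (m + k + 1) * B ≤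
      (m + k + 1) * (m + k + 1) * B := by
    intro m k B
    rw [← add_mul, ← add_mul]
    exact Nat.mul_le_mul_right _ (by nlinarith)
  induction e with
  | lit c => simpa [Expr.cost, Expr.eval, Expr.size] using hb
  | get x i hi =>
    have h1 := hi he (Expr.bits_eval_le hs i he)
    simp only [Expr.eval, Expr.size, Expr.cost] at hb ⊢
    have := arith i.size 0 (V.size + 1)
    simp only [add_zero, zero_mul] at this
    omega
  | add e f he1 hf1 =>
    have h1 := (le_max_left _ _).trans he
    have h2 := (le_max_right _ _).trans he
    have h3 := he1 h1 (Expr.bits_eval_le hs e h1)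
    have h4 := hf1 h2 (Expr.bits_eval_le hs f h2)
    simp only [Expr.eval, Expr.size, Expr.cost] at hb ⊢
    have := arith e.size f.size (V.size + 1)
    omega
  | sub e f he1 hf1 =>
    have h1 := (le_max_left _ _).trans he
    have h2 := (le_max_right _ _).trans he
    have h3 := he1 h1 (Expr.bits_eval_le hs e h1)
    have h4 := hf1 h2 (Expr.bits_eval_le hs f h2)
    simp only [Expr.eval, Expr.size, Expr.cost] at hb ⊢
    have := arith e.size f.size (V.size + 1)
    omega
  | mul e f he1 hf1 =>
    have h1 := (le_max_left _ _).trans he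
    have h2 := (le_max_right _ _).trans he
    have h3 := he1 h1 (Expr.bits_eval_le hs e h1)
    have h4 := hf1 h2 (Expr.bits_eval_le hs f h2)
    simp only [Expr.eval, Expr.size, Expr.cost] at hb ⊢
    have := arith e.size f.size (V.size + 1)
    omega
  | div e f he1 hf1 =>
    have h1 := (le_max_left _ _).trans he
    have h2 := (le_max_right _ _).trans he
    have h3 := he1 h1 (Expr.bits_eval_le hs e h1)
    have h4 := hf1 h2 (Expr.bits_eval_le hs f h2)
    simp only [Expr.eval, Expr.size, Expr.cost] at hb ⊢
    have := arith e.size f.size (V.size + 1)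
    omega

/-- A bound for the cost of one elementary step while all cells are at most `V`. -/
def unitCost (V : ℕ) : ℕ := 2 * 1000000 * (V.size + 1)

theorem Expr.Small.cost_le {V : ℕ} {s : Memory} {e : Expr} (he : e.Small) (hV : 2 ≤ V)
    (hs : MemLE V s) : 2 * e.cost s ≤ unitCost V := by
  have h1 := Expr.cost_le hs e (he.1.trans hV)
  have h2 : e.size * e.size ≤ 1000000 := by nlinarith [he.2]
  unfold unitCost
  nlinarith [Nat.mul_le_mul_right (V.size + 1) h2]

/-- The program `p` takes memory `s` to memory `t` at a cost of at most `m` units. -/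
def Runs (V : ℕ) (p : Program) (s : Memory) (m : ℕ) (t : Memory) : Prop :=
  ∃ k, Exec p s k t ∧ k ≤ m * unitCost V

section Runs

variable {V : ℕ} {s t u : Memory} {p q : Program} {m m' : ℕ}

theorem Runs.mono (h : Runs V p s m t) (hm : m ≤ m') : Runs V p s m' t := by
  obtain ⟨k, hk, hk2⟩ := h
  exact ⟨k, hk, hk2.trans (Nat.mul_le_mul_right _ hm)⟩

theorem runs_assign (hV : 2 ≤ V) (hs : MemLE V s) {x : ℕ} {i e : Expr} (hi : i.Small)
    (he : e.Small) : Runs V (.assign x i e) s 1 (store s x (i.eval s) (e.eval s)) := by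
  refine ⟨_, Exec.assign x i e s, ?_⟩
  have := hi.cost_le hV hs
  have := he.cost_le hV hs
  omega

theorem Runs.seq (h1 : Runs V p s m t) (h2 : Runs V q t m' u) :
    Runs V (.seq p q) s (m + m') u := by
  obtain ⟨k, hk, hk2⟩ := h1
  obtain ⟨l, hl, hl2⟩ := h2
  refine ⟨_, Exec.seq hk hl, ?_⟩
  rw [add_mul]; omega

theorem runs_branch_pos (hV : 2 ≤ V) (hs : MemLE V s) {e : Expr} (he : e.Small)
    (h0 : 0 < e.eval s) (h : Runs V p s m t) : Runs V (.branch e p q) s (m + 1) t := by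
  obtain ⟨k, hk, hk2⟩ := h
  refine ⟨_, Exec.branchPos h0 hk, ?_⟩
  have := he.cost_le hV hs
  rw [add_mul]; omega

theorem runs_branch_nonpos (hV : 2 ≤ V) (hs : MemLE V s) {e : Expr} (he : e.Small)
    (h0 : e.eval s ≤ 0) (h : Runs V q s m t) : Runs V (.branch e p q) s (m + 1) t := by
  obtain ⟨k, hk, hk2⟩ := h
  refine ⟨_, Exec.branchNonpos h0 hk, ?_⟩
  have := he.cost_le hV hs
  rw [add_mul]; omega

theorem runs_skip (V : ℕ) (s : Memory) : Runs V .skip s 1 s := by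
  refine ⟨_, Exec.skip s, ?_⟩
  unfold unitCost; omega

/-- A loop with an invariant `I i` before its `i`-th turn that makes `N` turns. -/
theorem runs_loop (hV : 2 ≤ V) {e : Expr} (he : e.Small) {N : ℕ} {I : ℕ → Memory → Prop}
    (hI : ∀ i s, I i s → MemLE V s) (hpos : ∀ i < N, ∀ s, I i s → 0 < e.eval s)
    (hend : ∀ s, I N s → e.eval s ≤ 0)
    (hbody : ∀ i < N, ∀ s, I i s → ∃ t, Runs V p s m t ∧ I (i + 1) t) (h0 : I 0 s) :
    ∃ t, Runs V (.loop e p) s (N * (m + 1) + 1) t ∧ I N t := by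
  suffices h : ∀ d i, i + d = N → ∀ s, I i s →
      ∃ t, Runs V (.loop e p) s (d * (m + 1) + 1) t ∧ I N t from
    h N 0 (by omega) s h0
  intro d
  induction d with
  | zero =>
    intro i hi s hs
    have hiN : i = N := by omega
    subst hiN
    refine ⟨s, ⟨_, Exec.loopDone (hend s hs), ?_⟩, hs⟩
    have := he.cost_le hV (hI _ _ hs)
    omega
  | succ d ih =>
    intro i hi s hs
    obtain ⟨t, ⟨k, hk, hk2⟩, ht⟩ := hbody i (by omega) s hs
    obtain ⟨u, ⟨l, hl, hl2⟩, hu⟩ := ih (i + 1) (by omega) t ht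
    refine ⟨u, ⟨_, Exec.loopStep (hpos i (by omega) s hs) hk hl, ?_⟩, hu⟩
    have := he.cost_le hV (hI _ _ hs)
    calc e.cost s + k + l ≤ unitCost V + m * unitCost V + (d * (m + 1) + 1) * unitCost V := by
          omega
      _ = _ := by ring

end Runs

/-- Reading the scalar variable stored in cell `0` of array `x`. -/
abbrev Expr.var (x : ℕ) : Expr := .get x (.lit 0)

/-- The loop over `x = 0, 1, …, bound - 1`. -/
def forLoop (x : ℕ) (bound : Expr) (p : Program) : Program :=
  .seq (.assign x (.lit 0) (.lit 0))
    (.loop (.sub bound (.var x)) (.seq p (.assign x (.lit 0) (.add (.var x) (.lit 1)))))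

theorem runs_forLoop {V x m N : ℕ} {bound : Expr} {p : Program} {s : Memory}
    {I : ℕ → Memory → Prop} (hV : 2 ≤ V) (hb : (Expr.sub bound (.var x)).Small)
    (hs : MemLE V s) (hI : ∀ i s, I i s → MemLE V s ∧ bound.eval s = N)
    (h0 : I 0 (store s x 0 0))
    (hbody : ∀ i < N, ∀ s, I i s → s x 0 = i → ∃ t, Runs V p s m t ∧ MemLE V t ∧ t x 0 = i ∧
      I (i + 1) (store t x 0 ((i + 1 : ℕ) : ℤ))) :
    ∃ t, Runs V (forLoop x bound p) s (N * (m + 2) + 2) t ∧ I N t := by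
  have h1 := runs_assign (x := x) (i := .lit 0) (e := .lit 0) hV hs (by decide) (by decide)
  obtain ⟨t, ht, htI⟩ := runs_loop (m := m + 1) hV hb (N := N)
    (I := fun i s => I i s ∧ s x 0 = i)
    (p := .seq p (.assign x (.lit 0) (.add (.var x) (.lit 1))))
    (fun i s h => (hI i s h.1).1)
    (fun i hi s h => by
      simp only [Expr.eval, (hI i s h.1).2, h.2]; omega)
    (fun s h => by simp only [Expr.eval, (hI N s h.1).2, h.2]; omega)
    (fun i hi s h => by
      obtain ⟨t, ht, htV, htx, htI⟩ := hbody i hi s h.1 h.2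
      refine ⟨_, ht.seq (runs_assign hV htV (by decide)
        (by simp [Expr.Small, Expr.maxLit, Expr.size])), ?_, ?_⟩
      · simp only [Expr.eval, htx]; exact_mod_cast htI
      · simp only [Expr.eval, htx, store_apply]; simp)
    (s := store s x 0 0) ⟨h0, by simp [store_apply]⟩
  exact ⟨t, (h1.seq ht).mono (by ring_nf; omega), htI.1⟩

/-! ### Matrix programs -/

/-- The memories `s` and `t` agree outside the arrays in `A`. -/
def Frame (A : Finset ℕ) (s t : Memory) : Prop := ∀ y ∉ A, t y = s y

theorem Frame.refl (A : Finset ℕ) (s : Memory) : Frame A s s := fun _ _ => rfl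

theorem Frame.trans {A : Finset ℕ} {s t u : Memory} (h : Frame A s t) (h' : Frame A t u) :
    Frame A s u := fun y hy => (h' y hy).trans (h y hy)

theorem Frame.mono {A B : Finset ℕ} {s t : Memory} (h : Frame A s t) (hAB : A ⊆ B) :
    Frame B s t := fun y hy => h y fun hA => hy (hAB hA)

theorem Frame.store {A : Finset ℕ} {s t : Memory} (h : Frame A s t) {x : ℕ} {i v : ℤ}
    (hx : x ∈ A) : Frame A s (store t x i v) := fun y hy => by
  rw [store_of_ne fun e : y = x => hy (e ▸ hx)]; exact h y hy

/-- Array `x` holds the matrix `M`, row by row. -/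
def Holds {n : ℕ} (s : Memory) (x : ℕ) (M : Matrix (Fin n) (Fin n) ℤ) : Prop :=
  ∀ i j : Fin n, s x ((i : ℤ) * n + j) = M i j

/-- The cell in row `x` and column `y`. -/
def Expr.cell (x y : ℕ) : Expr := .add (.mul (.var x) (.var 0)) (.var y)

/-- Assign `e` to all cells of the matrix in array `x`; in `e` the row and the column are the
variables `10` and `11`. -/
def forCells (x : ℕ) (e : Expr) : Program :=
  forLoop 10 (.var 0) (forLoop 11 (.var 0) (.assign x (.cell 10 11) e))

theorem cell_inj {n : ℕ} {i j i' j' : Fin n} (h : (i : ℕ) * n + j = (i' : ℕ) * n + j') :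
    i = i' ∧ j = j' := by
  have hn : 0 < n := i.pos
  have e1 : (i : ℕ) = i' := by
    have := congrArg (· / n) h
    simpa [Nat.mul_comm _ n, Nat.mul_add_div hn, Nat.div_eq_of_lt] using this
  refine ⟨Fin.ext e1, Fin.ext ?_⟩
  rw [e1] at h; omega

theorem runs_forCells {V n x : ℕ} {e : Expr} {s : Memory} (hV : 2 ≤ V) (hnV : n ≤ V)
    (hx : x ∉ ({0, 10, 11} : Finset ℕ)) (he : e.Small) (hs : MemLE V s) (hn : s 0 0 = n)
    (F : Matrix (Fin n) (Fin n) ℤ) (hF : ∀ i j, (F i j).natAbs ≤ V)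
    (hev : ∀ (i j : Fin n) (s' : Memory), Frame {x, 10, 11} s s' → s' 10 0 = (i : ℕ) →
      s' 11 0 = (j : ℕ) → s' x ((i : ℤ) * n + j) = s x ((i : ℤ) * n + j) → e.eval s' = F i j) :
    ∃ t, Runs V (forCells x e) s (n * (n * 3 + 4) + 2) t ∧ MemLE V t ∧
      Frame {x, 10, 11} s t ∧ Holds t x F := by
  classical
  simp only [Finset.mem_insert, Finset.mem_singleton, not_or] at hx
  obtain ⟨hx0, hx10, hx11⟩ := hx
  -- the first `k` cells in the row by row order have been assigned
  let D : ℕ → Memory → Prop := fun k s' => MemLE V s' ∧ Frame {x, 10, 11} s s' ∧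
    ∀ i j : Fin n, s' x ((i : ℤ) * n + j) =
      if (i : ℕ) * n + j < k then F i j else s x ((i : ℤ) * n + j)
  have hD0 : ∀ {k s'}, D k s' → s' 0 0 = n := fun h => by
    rw [h.2.1 0 (by simp [Ne.symm hx0]), hn]
  have hD10 : ∀ {k s'} {v : ℤ}, D k s' → v.natAbs ≤ V → D k (store s' 10 0 v) := fun h hv => by
    refine ⟨h.1.store hv, h.2.1.store (by simp), fun i j => ?_⟩
    rw [store_of_ne hx10]; exact h.2.2 i j
  have hD11 : ∀ {k s'} {v : ℤ}, D k s' → v.natAbs ≤ V → D k (store s' 11 0 v) := fun h hv => by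
    refine ⟨h.1.store hv, h.2.1.store (by simp), fun i j => ?_⟩
    rw [store_of_ne hx11]; exact h.2.2 i j
  have hstart : D 0 s := ⟨hs, Frame.refl _ _, fun i j => by simp⟩
  obtain ⟨t, ht, htI⟩ := runs_forLoop (m := n * 3 + 2) (x := 10) (bound := .var 0) hV
    (by decide) hs (I := fun i s' => D (i * n) s')
    (p := forLoop 11 (.var 0) (.assign x (.cell 10 11) e))
    (fun i s' h => ⟨h.1, by simp only [Expr.eval]; exact hD0 h⟩)
    (by rw [zero_mul]; exact hD10 hstart (by simp))
    (fun i hi s' h h10 => by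
      obtain ⟨t, ht, htI⟩ := runs_forLoop (m := 1) (x := 11) (bound := .var 0) hV
        (by decide) h.1 (I := fun j s' => D (i * n + j) s' ∧ s' 10 0 = i)
        (p := .assign x (.cell 10 11) e)
        (fun j s' h => ⟨h.1.1, by simp only [Expr.eval]; exact hD0 h.1⟩)
        ⟨hD11 h (by simp), by rw [store_of_ne (by norm_num)]; exact h10⟩
        (fun j hj s' h h11 => by
          have hcell : (Expr.cell 10 11).eval s' = (i : ℤ) * n + j := by
            simp only [Expr.cell, Expr.eval, hD0 h.1, h.2, h11]
          have hval : e.eval s' = F ⟨i, hi⟩ ⟨j, hj⟩ := by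
            refine hev ⟨i, hi⟩ ⟨j, hj⟩ s' h.1.2.1 h.2 h11 ?_
            rw [h.1.2.2 ⟨i, hi⟩ ⟨j, hj⟩, if_neg (lt_irrefl _)]
          refine ⟨_, runs_assign hV h.1.1 (by decide) he, ?_, ?_, ?_, ?_⟩
          · rw [hval]; exact h.1.1.store (hF _ _)
          · rw [store_of_ne (Ne.symm hx11)]; exact h11
          · refine hD11 ⟨?_, h.1.2.1.store (by simp), fun i' j' => ?_⟩ (by omega)
            · rw [hval]; exact h.1.1.store (hF _ _)
            · rw [hcell, hval, store_apply, h.1.2.2 i' j']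
              by_cases heq : (i' : ℕ) * n + j' = i * n + j
              · obtain ⟨e1, e2⟩ := cell_inj (i := i') (j := j') (i' := ⟨i, hi⟩) (j' := ⟨j, hj⟩) heq
                subst e1 e2
                rw [if_pos rfl, if_pos (by simp)]
              · rw [if_neg (fun h' => heq (by exact_mod_cast h'))]
                by_cases hlt : (i' : ℕ) * n + j' < i * n + j
                · rw [if_pos hlt, if_pos (by omega)]
                · rw [if_neg hlt, if_neg (by omega)]
          · rw [store_of_ne (by norm_num), store_of_ne (Ne.symm hx10)]; exact h.2)
      refine ⟨t, ht.mono (by omega), htI.1.1, htI.2, ?_⟩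
      rw [show (i + 1) * n = i * n + n by ring]
      exact hD10 htI.1 (by omega))
  refine ⟨t, ht.mono (by ring_nf; omega), htI.1, htI.2.1, fun i j => ?_⟩
  rw [htI.2.2 i j, if_pos]
  have h1 := i.2
  have h2 := j.2
  nlinarith

/-! ### Powers of positive semidefinite matrices -/

theorem trace_pow_eq_sum_eigenvalues {n : ℕ} {S : Matrix (Fin n) (Fin n) ℝ} (hS : S.IsHermitian)
    (k : ℕ) : (S ^ k).trace = ∑ i, hS.eigenvalues i ^ k := by
  conv_lhs => rw [hS.spectral_theorem, ← map_pow, Unitary.conjStarAlgAut_apply,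
    Matrix.trace_mul_cycle]
  simp [Matrix.diagonal_pow, Matrix.trace_diagonal]

/-- Young's inequality in the form needed for comparing consecutive powers. -/
theorem pow_mul_sub_le {u θ : ℝ} (hu : 0 ≤ u) (hθ : 0 ≤ θ) (q : ℕ) :
    u ^ q * (θ - u) ≤ θ ^ (q + 1) / (q + 1) := by
  have hq : (0 : ℝ) < q + 1 := by positivity
  rw [le_div_iff₀ hq]
  rcases hu.eq_or_lt with rfl | hu
  · rcases q with _ | q
    · simp
    · simp; positivity
  · have h := one_add_mul_le_pow (a := θ / u - 1) (by have : 0 ≤ θ / u := by positivity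
                                                      linarith) (q + 1)
    rw [show 1 + (θ / u - 1) = θ / u by ring, div_pow, le_div_iff₀ (by positivity)] at h
    have e : (1 + ((q + 1 : ℕ) : ℝ) * (θ / u - 1)) * u ^ (q + 1) =
        u ^ (q + 1) + (q + 1) * (u ^ q * (θ - u)) := by
      push_cast
      rw [pow_succ]
      field_simp
    rw [e] at h
    have : 0 < u ^ (q + 1) := by positivity
    linarith

section Power

variable {n : ℕ} {S : Matrix (Fin n) (Fin n) ℝ}

theorem eigenvalues_pow_le_trace (hS : S.PosSemidef) (hn : 0 < n) {x : Fin n → ℝ} {θ : ℝ}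
    (hx : ∑ i, x i ^ 2 = n) (hθ : ∑ i, ∑ j, x i * S i j * x j = θ * n) (hθ0 : 0 ≤ θ) (q : ℕ) :
    θ ^ q ≤ (S ^ q).trace := by
  have : Nonempty (Fin n) := ⟨⟨0, hn⟩⟩
  obtain ⟨i, hi⟩ := Finite.exists_max hS.1.eigenvalues
  have h1 : θ ≤ hS.1.eigenvalues i := by
    have := quad_le_of_top hS.1 (μ := hS.1.eigenvalues i) (fun ν hν => by
      rw [hasEigenvalue_iff_mem_spectrum, hS.1.spectrum_real_eq_range_eigenvalues] at hν
      obtain ⟨j, rfl⟩ := hν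
      exact hi j) x
    rw [hx, hθ] at this
    exact le_of_mul_le_mul_right this (by exact_mod_cast hn)
  rw [trace_pow_eq_sum_eigenvalues hS.1]
  refine (pow_le_pow_left₀ hθ0 h1 q).trans ?_
  exact Finset.single_le_sum (f := fun i => hS.1.eigenvalues i ^ q)
    (fun j _ => pow_nonneg (hS.eigenvalues_nonneg j) q) (Finset.mem_univ i)

/-- The normalized power of a positive semidefinite matrix is nearly a best response: its pairing
with the matrix is almost as large as that of any rank one matrix of the same trace. -/
theorem le_trace_pow_succ (hS : S.PosSemidef) (hn : 0 < n) {x : Fin n → ℝ} {θ : ℝ}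
    (hx : ∑ i, x i ^ 2 = n) (hθ : ∑ i, ∑ j, x i * S i j * x j = θ * n) (hθ0 : 0 ≤ θ) (q : ℕ) :
    (θ - n * θ / (q + 1)) * (S ^ q).trace ≤ (S ^ (q + 1)).trace := by
  have h1 := eigenvalues_pow_le_trace hS hn hx hθ hθ0 q
  have h2 : θ * (S ^ q).trace - (S ^ (q + 1)).trace ≤ n * (θ ^ (q + 1) / (q + 1)) := by
    rw [trace_pow_eq_sum_eigenvalues hS.1, trace_pow_eq_sum_eigenvalues hS.1, Finset.mul_sum,
      ← Finset.sum_sub_distrib]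
    calc _ ≤ ∑ _i : Fin n, θ ^ (q + 1) / (q + 1) := by
          refine Finset.sum_le_sum fun i _ => ?_
          have := pow_mul_sub_le (hS.eigenvalues_nonneg i) hθ0 q
          rw [pow_succ (hS.1.eigenvalues i)]
          linarith
      _ = _ := by simp
  have h3 : n * (θ ^ (q + 1) / (q + 1)) ≤ n * θ / (q + 1) * (S ^ q).trace := by
    have e : n * (θ ^ (q + 1) / (q + 1)) = n * θ / (q + 1) * θ ^ q := by
      rw [pow_succ]; ring
    rw [e]
    gcongr
  linarith

end Power

theorem abs_quad_le {n : ℕ} {M : Fin n → Fin n → ℝ} {K : ℝ} (hM : ∀ i j, |M i j| ≤ K)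
    (x : Fin n → ℝ) : |∑ i, ∑ j, x i * M i j * x j| ≤ K * n * ∑ i, x i ^ 2 := by
  calc _ ≤ ∑ i, ∑ j, |x i * M i j * x j| :=
        (Finset.abs_sum_le_sum_abs _ _).trans
          (Finset.sum_le_sum fun i _ => Finset.abs_sum_le_sum_abs _ _)
    _ ≤ ∑ i, ∑ j, (K / 2 * x i ^ 2 + K / 2 * x j ^ 2) := by
        refine Finset.sum_le_sum fun i _ => Finset.sum_le_sum fun j _ => ?_
        rw [abs_mul, abs_mul, mul_right_comm]
        have h1 := hM i j
        have h2 := abs_nonneg (M i j)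
        have h3 : |x i| * |x j| ≤ (x i ^ 2 + x j ^ 2) / 2 := by
          have := sq_nonneg (|x i| - |x j|)
          have := sq_abs (x i)
          have := sq_abs (x j)
          nlinarith
        have h4 : 0 ≤ |x i| * |x j| := by positivity
        calc _ ≤ |x i| * |x j| * K := by gcongr
          _ ≤ (x i ^ 2 + x j ^ 2) / 2 * K := by
              have : 0 ≤ K := h2.trans h1
              gcongr
          _ = _ := by ring
    _ = _ := by
        simp only [Finset.sum_add_distrib, ← Finset.mul_sum, Finset.sum_const, Finset.card_univ,
          Fintype.card_fin, nsmul_eq_mul]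
        ring

/-! ### The iterative algorithm for the semidefinite program -/

section Iteration

variable {n : ℕ}

/-- The penalized objective at time `t`: the objective matrix, scaled by `n ^ 30`, with each diagonal
entry lowered by the surplus `R i i - t * n ^ 26` that has accumulated there. For `t ≤ n ^ 20` the
surplus is at most `2 * n ^ 47`, and the shift by `4 * n ^ 47` makes the matrix positive definite. -/
def penalized (M : Matrix (Fin n) (Fin n) ℤ) (t : ℕ) (R : Matrix (Fin n) (Fin n) ℤ) :
    Matrix (Fin n) (Fin n) ℤ :=
  Matrix.of fun i j => n ^ 30 * M i j +
    if i = j then 4 * (n : ℤ) ^ 47 + t * n ^ 26 - R i i else 0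

/-- A high power of the penalized objective: a soft version of the projection to its top
eigenvector. The relative error in the Rayleigh quotient is about `n / n ^ 60`, which makes up for
entries of size `n ^ 47`. -/
def response (M : Matrix (Fin n) (Fin n) ℤ) (t : ℕ) (R : Matrix (Fin n) (Fin n) ℤ) :
    Matrix (Fin n) (Fin n) ℤ := penalized M t R ^ (n ^ 60)

/-- Accumulate the response, normalized to trace `n`, scaled by `n ^ 26` and rounded down. -/
def accumulate (M : Matrix (Fin n) (Fin n) ℤ) (t : ℕ) (R : Matrix (Fin n) (Fin n) ℤ) :
    Matrix (Fin n) (Fin n) ℤ :=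
  Matrix.of fun i j => R i j + n * n ^ 26 * response M t R i j / (response M t R).trace

/-- The sum of the first `t` responses. -/
def iterate (M : Matrix (Fin n) (Fin n) ℤ) : ℕ → Matrix (Fin n) (Fin n) ℤ
  | 0 => 0
  | t + 1 => accumulate M t (iterate M t)

/-- The inclusion of integer matrices into real ones. -/
abbrev toReal (M : Matrix (Fin n) (Fin n) ℤ) : Matrix (Fin n) (Fin n) ℝ :=
  (Int.castRingHom ℝ).mapMatrix M

theorem toReal_apply (M : Matrix (Fin n) (Fin n) ℤ) (i j : Fin n) : toReal M i j = M i j := rfl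

theorem toReal_trace (M : Matrix (Fin n) (Fin n) ℤ) : (toReal M).trace = (M.trace : ℤ) := by
  simp [Matrix.trace]

/-- The standing assumptions on the objective matrix. -/
structure IsObjective (M : Matrix (Fin n) (Fin n) ℤ) : Prop where
  symm : ∀ i j, M i j = M j i
  bound : ∀ i j, |(M i j : ℝ)| ≤ n

variable {M R : Matrix (Fin n) (Fin n) ℤ} {t : ℕ}

/-- The quadratic form of the penalized objective. -/
theorem quad_penalized (M R : Matrix (Fin n) (Fin n) ℤ) (t : ℕ) (x : Fin n → ℝ) :
    ∑ i, ∑ j, x i * toReal (penalized M t R) i j * x j =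
      n ^ 30 * (∑ i, ∑ j, x i * M i j * x j) +
        ∑ i, (4 * (n : ℝ) ^ 47 - (R i i - t * n ^ 26)) * x i ^ 2 := by
  have hdiag : ∑ i, (4 * (n : ℝ) ^ 47 - (R i i - t * n ^ 26)) * x i ^ 2 =
      ∑ i, ∑ j, if i = j then (4 * (n : ℝ) ^ 47 - (R i i - t * n ^ 26)) * x i * x j else 0 := by
    simp [sq, mul_assoc]
  rw [hdiag, Finset.mul_sum, ← Finset.sum_add_distrib]
  refine Finset.sum_congr rfl fun i _ => ?_
  rw [Finset.mul_sum, ← Finset.sum_add_distrib]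
  refine Finset.sum_congr rfl fun j _ => ?_
  rw [toReal_apply]
  simp only [penalized, Matrix.of_apply]
  split_ifs <;> push_cast <;> ring

theorem one_le_cast (i : Fin n) : (1 : ℝ) ≤ n := by exact_mod_cast i.pos

/-- The accumulated matrix grows by at most `n ^ 27` per step. -/
def IsAccumulated (t : ℕ) (R : Matrix (Fin n) (Fin n) ℤ) : Prop :=
  ∀ i j, |(R i j : ℝ)| ≤ t * n ^ 27

theorem IsAccumulated.abs_surplus_le (hR : IsAccumulated t R) (ht : t ≤ n ^ 20) (i : Fin n) :
    |(R i i : ℝ) - t * n ^ 26| ≤ 2 * n ^ 47 := by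
  have hn := one_le_cast i
  have h1 := hR i i
  have ht' : (t : ℝ) ≤ n ^ 20 := by exact_mod_cast ht
  have h2 : (t : ℝ) * n ^ 27 ≤ n ^ 47 := by
    calc _ ≤ (n : ℝ) ^ 20 * n ^ 27 := by gcongr
      _ = _ := by ring
  have h3 : (t : ℝ) * n ^ 26 ≤ t * n ^ 27 := by
    gcongr
    norm_num
  have h4 : (0 : ℝ) ≤ t * n ^ 26 := by positivity
  rw [abs_le] at h1 ⊢
  constructor <;> linarith

theorem IsObjective.le_quad_penalized (hM : IsObjective M) (hR : IsAccumulated t R) (ht : t ≤ n ^ 20)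
    (x : Fin n → ℝ) :
    n ^ 47 * ∑ i, x i ^ 2 ≤ ∑ i, ∑ j, x i * toReal (penalized M t R) i j * x j := by
  rw [quad_penalized]
  have h1 := abs_le.1 (abs_quad_le hM.bound x)
  have h2 : ∑ i, 2 * (n : ℝ) ^ 47 * x i ^ 2 ≤
      ∑ i, (4 * (n : ℝ) ^ 47 - (R i i - t * n ^ 26)) * x i ^ 2 := by
    refine Finset.sum_le_sum fun i _ => ?_
    have := abs_le.1 (hR.abs_surplus_le ht i)
    gcongr
    linarith
  rw [← Finset.mul_sum] at h2
  have h3 : (n : ℝ) ^ 30 * (n * n * ∑ i, x i ^ 2) ≤ n ^ 47 * ∑ i, x i ^ 2 := by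
    rcases Nat.eq_zero_or_pos n with rfl | hn
    · simp
    · have hn1 : (1 : ℝ) ≤ n := by exact_mod_cast hn
      have : (n : ℝ) ^ 32 ≤ n ^ 47 := pow_le_pow_right₀ hn1 (by norm_num)
      have hx : 0 ≤ ∑ i, x i ^ 2 := Finset.sum_nonneg fun _ _ => sq_nonneg _
      calc _ = (n : ℝ) ^ 32 * ∑ i, x i ^ 2 := by ring
        _ ≤ _ := by gcongr
  have h4 : (0 : ℝ) ≤ n ^ 30 := by positivity
  have h5 := mul_le_mul_of_nonneg_left h1.1 h4
  linarith

theorem IsObjective.penalized_posSemidef (hM : IsObjective M) (hR : IsAccumulated t R)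
    (ht : t ≤ n ^ 20) : (toReal (penalized M t R)).PosSemidef := by
  refine posSemidef_of_quad_nonneg (fun i j => ?_) fun x => ?_
  · rw [toReal_apply, toReal_apply]
    simp only [penalized, Matrix.of_apply, hM.symm i j]
    by_cases h : i = j
    · subst h; rfl
    · rw [if_neg h, if_neg (Ne.symm h)]
  · refine le_trans ?_ (hM.le_quad_penalized hR ht x)
    have : 0 ≤ ∑ i, x i ^ 2 := Finset.sum_nonneg fun _ _ => sq_nonneg _
    positivity

theorem abs_penalized_le (hM : IsObjective M) (hR : IsAccumulated t R) (ht : t ≤ n ^ 20)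
    (i j : Fin n) : |(penalized M t R i j : ℝ)| ≤ 7 * n ^ 47 := by
  have hn := one_le_cast i
  have h1 := abs_le.1 (hM.bound i j)
  have h2 := abs_le.1 (hR.abs_surplus_le ht i)
  have h3 : (n : ℝ) ^ 30 * n ≤ n ^ 47 := by
    rw [← pow_succ]; exact pow_le_pow_right₀ hn (by norm_num)
  have h4 : (0 : ℝ) ≤ n ^ 30 := by positivity
  have h5 : (0 : ℝ) ≤ n ^ 47 := by positivity
  have h6 := mul_le_mul_of_nonneg_left h1.1 h4
  have h7 := mul_le_mul_of_nonneg_left h1.2 h4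
  simp only [penalized, Matrix.of_apply]
  rw [abs_le]
  split_ifs <;> push_cast <;> constructor <;> linarith

theorem toReal_response (M R : Matrix (Fin n) (Fin n) ℤ) (t : ℕ) :
    toReal (response M t R) = toReal (penalized M t R) ^ (n ^ 60) := map_pow _ _ _

theorem response_posSemidef (hM : IsObjective M) (hR : IsAccumulated t R) (ht : t ≤ n ^ 20) :
    (toReal (response M t R)).PosSemidef := by
  rw [toReal_response]
  exact (hM.penalized_posSemidef hR ht).pow _

theorem abs_le_trace {Z : Matrix (Fin n) (Fin n) ℝ} (hZ : Z.PosSemidef) (i j : Fin n) :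
    |Z i j| ≤ Z.trace := by
  have h1 := two_mul_abs_le_of_posSemidef hZ i j
  have h2 : ∀ k, Z k k ≤ Z.trace := fun k =>
    Finset.single_le_sum (f := fun k => Z k k) (fun k _ => hZ.diag_nonneg) (Finset.mem_univ k)
  linarith [h2 i, h2 j]

theorem abs_ediv_le {a b K : ℤ} (hb : 0 ≤ b) (hab : |a| ≤ K * b) (hK : 0 ≤ K) : |a / b| ≤ K := by
  rcases hb.eq_or_lt with rfl | hb
  · simpa using hK
  · rw [abs_le] at hab ⊢
    constructor
    · rw [Int.le_ediv_iff_mul_le hb]; linarith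
    · refine Int.ediv_le_of_le_mul hb ?_; linarith

theorem abs_response_div_le (hM : IsObjective M) (hR : IsAccumulated t R) (ht : t ≤ n ^ 20)
    (i j : Fin n) :
    |n * n ^ 26 * response M t R i j / (response M t R).trace| ≤ (n : ℤ) ^ 27 := by
  have hP := response_posSemidef hM hR ht
  have h1 := abs_le_trace hP i j
  have h2 := hP.trace_nonneg
  rw [toReal_trace] at h1 h2
  rw [toReal_apply] at h1
  have h1' : |response M t R i j| ≤ (response M t R).trace := by exact_mod_cast h1
  refine abs_ediv_le (by exact_mod_cast h2) ?_ (by positivity)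
  rw [abs_mul, abs_of_nonneg (by positivity : (0 : ℤ) ≤ n * n ^ 26),
    show (n : ℤ) ^ 27 = n * n ^ 26 by ring]
  gcongr

theorem isAccumulated_accumulate (hM : IsObjective M) (hR : IsAccumulated t R) (ht : t ≤ n ^ 20) :
    IsAccumulated (t + 1) (accumulate M t R) := by
  intro i j
  have h1 : |((n * n ^ 26 * response M t R i j / (response M t R).trace : ℤ) : ℝ)| ≤
      (n : ℝ) ^ 27 := by exact_mod_cast abs_response_div_le hM hR ht i j
  have h2 := hR i j
  simp only [accumulate, Matrix.of_apply]
  rw [Int.cast_add]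
  refine (abs_add_le _ _).trans ?_
  push_cast at h1 ⊢
  linarith

theorem isAccumulated_iterate (hM : IsObjective M) (ht : t ≤ n ^ 20) :
    IsAccumulated t (iterate M t) := by
  induction t with
  | zero => intro i j; simp [iterate]
  | succ t ih => exact isAccumulated_accumulate hM (ih (by omega)) (by omega)

end Iteration

/-! ### Drift of the potential -/

section Drift

variable {n : ℕ} {M R : Matrix (Fin n) (Fin n) ℤ} {t : ℕ}

/-- The response, normalized to trace `n`. -/
noncomputable def normResponse (M : Matrix (Fin n) (Fin n) ℤ) (t : ℕ)
    (R : Matrix (Fin n) (Fin n) ℤ) : Matrix (Fin n) (Fin n) ℝ :=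
  (n / (response M t R).trace : ℝ) • toReal (response M t R)

/-- The pairing of the objective matrix with a real matrix. -/
noncomputable def pairing (M : Matrix (Fin n) (Fin n) ℤ) (Z : Matrix (Fin n) (Fin n) ℝ) : ℝ :=
  ∑ i, ∑ j, M i j * Z i j

theorem abs_pairing_le (hM : IsObjective M) {Z : Matrix (Fin n) (Fin n) ℝ} {K : ℝ}
    (hZ : ∀ i j, |Z i j| ≤ K) : |pairing M Z| ≤ n ^ 3 * K := by
  calc _ ≤ ∑ i, ∑ j, |(M i j : ℝ) * Z i j| :=
        (Finset.abs_sum_le_sum_abs _ _).trans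
          (Finset.sum_le_sum fun i _ => Finset.abs_sum_le_sum_abs _ _)
    _ ≤ ∑ _i : Fin n, ∑ _j : Fin n, n * K := by
        refine Finset.sum_le_sum fun i _ => Finset.sum_le_sum fun j _ => ?_
        rw [abs_mul]
        have := hM.bound i j
        have := hZ i j
        gcongr
    _ = _ := by simp; ring

theorem sum_sgn_sq (σ : Spins n) : ∑ i, sgn (σ i) ^ 2 = n := by simp [sq, sgn_mul_self]

/-- The Rayleigh quotient of the spins for the penalized objective. -/
noncomputable def rayleigh (M : Matrix (Fin n) (Fin n) ℤ) (t : ℕ) (R : Matrix (Fin n) (Fin n) ℤ)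
    (σ : Spins n) : ℝ :=
  (∑ i, ∑ j, sgn (σ i) * toReal (penalized M t R) i j * sgn (σ j)) / n

theorem rayleigh_mul (hn : 0 < n) (σ : Spins n) :
    ∑ i, ∑ j, sgn (σ i) * toReal (penalized M t R) i j * sgn (σ j) = rayleigh M t R σ * n := by
  have : (n : ℝ) ≠ 0 := by exact_mod_cast hn.ne'
  rw [rayleigh]; field_simp

theorem le_rayleigh (hn : 0 < n) (hM : IsObjective M) (hR : IsAccumulated t R) (ht : t ≤ n ^ 20)
    (σ : Spins n) : (n : ℝ) ^ 47 ≤ rayleigh M t R σ := by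
  have := hM.le_quad_penalized hR ht fun i => sgn (σ i)
  rw [sum_sgn_sq, rayleigh_mul hn] at this
  exact le_of_mul_le_mul_right this (by exact_mod_cast hn)

theorem trace_response_pos (hn : 0 < n) (hM : IsObjective M) (hR : IsAccumulated t R)
    (ht : t ≤ n ^ 20) : (0 : ℝ) < (response M t R).trace := by
  have h1 := le_rayleigh hn hM hR ht fun _ => 1
  have h2 : (0 : ℝ) < n ^ 47 := by positivity
  have h3 := eigenvalues_pow_le_trace (hM.penalized_posSemidef hR ht) hn (sum_sgn_sq fun _ => 1)
    (rayleigh_mul hn fun _ => 1) (h2.le.trans h1) (n ^ 60)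
  rw [← toReal_response, toReal_trace] at h3
  refine lt_of_lt_of_le ?_ h3
  have : 0 < rayleigh M t R fun _ => 1 := h2.trans_le h1
  positivity

theorem normResponse_posSemidef (hM : IsObjective M) (hR : IsAccumulated t R) (ht : t ≤ n ^ 20) :
    (normResponse M t R).PosSemidef := by
  have hP := response_posSemidef hM hR ht
  have := hP.trace_nonneg
  rw [toReal_trace] at this
  exact hP.smul (div_nonneg (Nat.cast_nonneg n) this)

theorem trace_normResponse (hn : 0 < n) (hM : IsObjective M) (hR : IsAccumulated t R)
    (ht : t ≤ n ^ 20) : (normResponse M t R).trace = n := by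
  have := trace_response_pos hn hM hR ht
  rw [normResponse, Matrix.trace_smul, toReal_trace, smul_eq_mul]
  field_simp

/-- The response is nearly optimal for the penalized objective, written out in terms of the
surplus on the diagonal. -/
theorem surplus_mul_le (hn : 2 ≤ n) (hM : IsObjective M) (hR : IsAccumulated t R)
    (ht : t ≤ n ^ 20) (σ : Spins n) :
    ∑ i, (R i i - t * n ^ 26 : ℝ) * (normResponse M t R i i - 1) ≤
      n ^ 30 * (pairing M (normResponse M t R) - pairing M (spinMatrix σ)) + 1 := by
  have hn0 : 0 < n := by omega
  have hnR : (2 : ℝ) ≤ n := by exact_mod_cast hn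
  have hn' : (0 : ℝ) < n := by linarith
  have hS := hM.penalized_posSemidef hR ht
  have hP := response_posSemidef hM hR ht
  set S := toReal (penalized M t R) with hSdef
  set θ := rayleigh M t R σ with hθ
  have h0 : (0 : ℝ) ≤ θ := (by positivity : (0 : ℝ) ≤ (n : ℝ) ^ 47).trans
    (le_rayleigh hn0 hM hR ht σ)
  have htr := trace_response_pos hn0 hM hR ht
  set τ : ℝ := ((response M t R).trace : ℝ) with hτ
  -- the error of the power method
  have herr : n * (n * θ / ((n ^ 60 : ℕ) + 1)) ≤ (1 : ℝ) := by
    have h1 := (abs_le.1 (abs_quad_le (abs_penalized_le hM hR ht) fun i => sgn (σ i))).2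
    rw [sum_sgn_sq] at h1
    have h2 : θ * n ≤ 7 * n ^ 47 * n * n := by
      rw [← rayleigh_mul hn0 σ]; exact h1
    have h3 : (7 : ℝ) ≤ n ^ 10 := by
      calc (7 : ℝ) ≤ 2 ^ 10 := by norm_num
        _ ≤ _ := by gcongr
    rw [mul_div_assoc', div_le_one (by positivity)]
    push_cast
    calc (n : ℝ) * (n * θ) = n * (θ * n) := by ring
      _ ≤ n * (7 * n ^ 47 * n * n) := by gcongr
      _ = 7 * n ^ 50 := by ring
      _ ≤ n ^ 10 * n ^ 50 := by gcongr
      _ = n ^ 60 := by ring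
      _ ≤ _ := by linarith
  have hpow := le_trace_pow_succ hS hn0 (sum_sgn_sq σ) (rayleigh_mul hn0 σ) h0 (n ^ 60)
  rw [pow_succ' S, ← toReal_response, toReal_trace, ← hτ] at hpow
  -- the pairing of the penalized objective with the response
  have htrace : (S * toReal (response M t R)).trace * (n / τ) =
      n ^ 30 * pairing M (normResponse M t R) +
        ∑ i, (4 * (n : ℝ) ^ 47 - (R i i - t * n ^ 26)) * normResponse M t R i i := by
    have hdiag : ∑ i, (4 * (n : ℝ) ^ 47 - (R i i - t * n ^ 26)) * normResponse M t R i i =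
        ∑ i, ∑ j, if i = j then
          (4 * (n : ℝ) ^ 47 - (R i i - t * n ^ 26)) * normResponse M t R i j else 0 := by simp
    rw [hdiag]
    simp only [Matrix.trace, Matrix.diag_apply, Matrix.mul_apply, pairing, Finset.mul_sum,
      Finset.sum_mul, ← Finset.sum_add_distrib]
    refine Finset.sum_congr rfl fun i _ => Finset.sum_congr rfl fun j _ => ?_
    have hsym : toReal (response M t R) j i = toReal (response M t R) i j := by
      have := congrFun (congrFun hP.1 i) j
      simpa using this
    rw [hsym, hSdef, toReal_apply (penalized M t R)]
    simp only [normResponse, Matrix.smul_apply, smul_eq_mul, penalized, Matrix.of_apply, ← hτ]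
    split_ifs <;> push_cast <;> ring
  have hquad : θ * n = n ^ 30 * pairing M (spinMatrix σ) +
      ∑ i, (4 * (n : ℝ) ^ 47 - (R i i - t * n ^ 26)) := by
    rw [← rayleigh_mul hn0, quad_penalized]
    congr 1
    · congr 1
      refine Finset.sum_congr rfl fun i _ => Finset.sum_congr rfl fun j _ => ?_
      simp only [spinMatrix, Matrix.of_apply]; ring
    · refine Finset.sum_congr rfl fun i _ => ?_
      rw [sq, sgn_mul_self, mul_one]
  have hmain : θ * n - 1 ≤ (S * toReal (response M t R)).trace * (n / τ) := by
    calc θ * n - 1 ≤ (θ - n * θ / ((n ^ 60 : ℕ) + 1)) * τ * (n / τ) := by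
          rw [mul_assoc, mul_div_cancel₀ _ htr.ne']
          linarith
      _ ≤ _ := by
          refine mul_le_mul_of_nonneg_right hpow (by positivity)
  have htrZ : ∑ i, normResponse M t R i i = n := trace_normResponse hn0 hM hR ht
  have e1 : ∑ i, (4 * (n : ℝ) ^ 47 - (R i i - t * n ^ 26)) * normResponse M t R i i =
      4 * (n : ℝ) ^ 47 * ∑ i, normResponse M t R i i -
        ∑ i, (R i i - t * n ^ 26 : ℝ) * normResponse M t R i i := by
    rw [Finset.mul_sum, ← Finset.sum_sub_distrib]
    exact Finset.sum_congr rfl fun i _ => by ring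
  have e2 : ∑ i, (4 * (n : ℝ) ^ 47 - (R i i - t * n ^ 26)) =
      4 * (n : ℝ) ^ 47 * n - ∑ i, (R i i - t * n ^ 26 : ℝ) := by
    rw [Finset.sum_sub_distrib]; simp; ring
  have e3 : ∑ i, (R i i - t * n ^ 26 : ℝ) * (normResponse M t R i i - 1) =
      ∑ i, (R i i - t * n ^ 26 : ℝ) * normResponse M t R i i -
        ∑ i, (R i i - t * n ^ 26 : ℝ) := by
    rw [← Finset.sum_sub_distrib]
    exact Finset.sum_congr rfl fun i _ => by ring
  rw [htrace, hquad, e1, e2, htrZ] at hmain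
  rw [e3]
  linarith

/-- The accumulated matrix follows the scaled responses up to rounding. -/
theorem rounding_bounds (hn : 0 < n) (hM : IsObjective M) (hR : IsAccumulated t R)
    (ht : t ≤ n ^ 20) (i j : Fin n) :
    (accumulate M t R i j : ℝ) ≤ R i j + n ^ 26 * normResponse M t R i j ∧
      R i j + n ^ 26 * normResponse M t R i j ≤ accumulate M t R i j + 1 := by
  have htr := trace_response_pos hn hM hR ht
  have htr' : 0 < (response M t R).trace := by exact_mod_cast htr
  set τ := (response M t R).trace with hτ
  set a : ℤ := n * n ^ 26 * response M t R i j with ha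
  have e : n ^ 26 * normResponse M t R i j = (a : ℝ) / τ := by
    rw [ha]
    simp only [normResponse, Matrix.smul_apply, smul_eq_mul, toReal_apply, ← hτ]
    push_cast
    ring
  have h1 : ((a / τ : ℤ) : ℝ) * τ ≤ a := by exact_mod_cast Int.ediv_mul_le a htr'.ne'
  have h2 : (a : ℝ) ≤ (((a / τ : ℤ) : ℝ) + 1) * τ := by
    exact_mod_cast (Int.lt_ediv_add_one_mul_self a htr').le
  rw [e]
  simp only [accumulate, Matrix.of_apply, ← hτ, ← ha]
  rw [Int.cast_add]
  constructor
  · have := (le_div_iff₀ htr).2 h1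
    linarith
  · have := (div_le_iff₀ htr).2 h2
    linarith

/-- The potential, the squared norm of the surplus on the diagonal, changes in each step by little
more than a multiple of the gain of the response over the spins. -/
theorem potential_step (hn : 2 ≤ n) (hM : IsObjective M) (hR : IsAccumulated t R)
    (ht : t ≤ n ^ 20) (σ : Spins n) :
    ∑ i, (accumulate M t R i i - (t + 1) * n ^ 26 : ℝ) ^ 2 ≤
      ∑ i, (R i i - t * n ^ 26 : ℝ) ^ 2 +
        2 * n ^ 56 * (pairing M (normResponse M t R) - pairing M (spinMatrix σ)) + 3 * n ^ 55 := by
  have hn0 : 0 < n := by omega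
  have hnR : (2 : ℝ) ≤ n := by exact_mod_cast hn
  have hn1 : (1 : ℝ) ≤ n := by linarith
  have hZ := normResponse_posSemidef hM hR ht
  have htr := trace_normResponse hn0 hM hR ht
  set D := pairing M (normResponse M t R) - pairing M (spinMatrix σ) with hD
  have hstep := surplus_mul_le hn hM hR ht σ
  rw [← hD] at hstep
  have hE1 : (1 : ℝ) ≤ n ^ 26 := one_le_pow₀ hn1
  have key : ∀ i, (accumulate M t R i i - (t + 1) * n ^ 26 : ℝ) ^ 2 ≤
      (R i i - t * n ^ 26 : ℝ) ^ 2 +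
      2 * n ^ 26 * ((R i i - t * n ^ 26 : ℝ) * (normResponse M t R i i - 1)) +
      (4 * n ^ 47 + n ^ 54) := by
    intro i
    have hz0 : 0 ≤ normResponse M t R i i := hZ.diag_nonneg
    have hz1 : normResponse M t R i i ≤ n := by
      have := abs_le_trace hZ i i
      rw [htr] at this
      exact (le_abs_self _).trans this
    obtain ⟨r1, r2⟩ := rounding_bounds hn0 hM hR ht i i
    have hy := abs_le.1 (hR.abs_surplus_le ht i)
    set y : ℝ := R i i - t * n ^ 26 with hydef
    set z := normResponse M t R i i
    set w : ℝ := accumulate M t R i i - R i i - n ^ 26 with hw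
    have e1 : (accumulate M t R i i - (t + 1) * n ^ 26 : ℝ) = y + w := by
      rw [hydef, hw]; ring
    have hw1 : w ≤ n ^ 26 * (z - 1) := by rw [hw]; linarith
    have hw2 : n ^ 26 * (z - 1) - 1 ≤ w := by rw [hw]; linarith
    have hw3 : |w| ≤ n ^ 27 := by
      rw [abs_le]
      have h1 : (n : ℝ) ^ 26 * z ≤ n ^ 26 * n := by gcongr
      have h2 : (0 : ℝ) ≤ n ^ 26 * z := by positivity
      have h3 : (n : ℝ) ^ 26 * 2 ≤ n ^ 26 * n := by gcongr
      have h4 : (n : ℝ) ^ 27 = n ^ 26 * n := by ring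
      rw [h4]
      constructor <;> linarith
    have hw4 : w ^ 2 ≤ n ^ 54 := by
      rw [← sq_abs]
      calc |w| ^ 2 ≤ ((n : ℝ) ^ 27) ^ 2 := by gcongr
        _ = _ := by ring
    have hyw : y * w ≤ n ^ 26 * (y * (z - 1)) + 2 * n ^ 47 := by
      have h5 : y * (w - n ^ 26 * (z - 1)) ≤ 2 * n ^ 47 := by
        have h6 : -1 ≤ w - n ^ 26 * (z - 1) := by linarith
        have h7 : w - n ^ 26 * (z - 1) ≤ 0 := by linarith
        have h8 : (0 : ℝ) ≤ n ^ 47 := by positivity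
        nlinarith
      linarith
    rw [e1]
    nlinarith
  have h1 := Finset.sum_le_sum fun i (_ : i ∈ Finset.univ) => key i
  rw [Finset.sum_add_distrib, Finset.sum_add_distrib, ← Finset.mul_sum, Finset.sum_const,
    Finset.card_univ, Fintype.card_fin, nsmul_eq_mul] at h1
  refine h1.trans ?_
  have h2 := mul_le_mul_of_nonneg_left hstep (by positivity : (0 : ℝ) ≤ 2 * n ^ 26)
  have h3 : (n : ℝ) * (4 * n ^ 47 + n ^ 54) ≤ 2 * n ^ 55 := by
    have : (4 : ℝ) * n ^ 48 ≤ n ^ 7 * n ^ 48 := by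
      gcongr
      calc (4 : ℝ) ≤ 2 ^ 7 := by norm_num
        _ ≤ _ := by gcongr
    have e1 : (n : ℝ) ^ 7 * n ^ 48 = n ^ 55 := by ring
    have e2 : (n : ℝ) * (4 * n ^ 47 + n ^ 54) = 4 * n ^ 48 + n ^ 55 := by ring
    linarith
  have h4 : (2 : ℝ) * n ^ 26 ≤ (n : ℝ) ^ 55 := by
    calc (2 : ℝ) * n ^ 26 ≤ n * n ^ 26 := by gcongr
      _ = (n : ℝ) ^ 27 := by ring
      _ ≤ (n : ℝ) ^ 55 := pow_le_pow_right₀ hn1 (by norm_num)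
  have h5 : (2 : ℝ) * n ^ 26 * (n ^ 30 * D + 1) = 2 * n ^ 56 * D + 2 * n ^ 26 := by ring
  linarith

/-- The output of the iteration, rescaled, is close to a nearly feasible matrix whose objective is
at least, up to a constant, that of every assignment of spins. Nonnegativity of the final potential
gives the objective, and an upper bound for it gives the feasibility. -/
theorem exists_nearOptimal (hn : 2 ≤ n) (hM : IsObjective M) (σ : Spins n) :
    ∃ Z : Matrix (Fin n) (Fin n) ℝ, Z.PosSemidef ∧ (∀ i, |Z i i - 1| ≤ 1 / n ^ 3) ∧
      (∀ i j, |iterate M (n ^ 20) i j / (n : ℝ) ^ 46 - Z i j| ≤ 1 / n) ∧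
      pairing M (spinMatrix σ) - 1 ≤ pairing M Z := by
  have hn0 : 0 < n := by omega
  have hnR : (2 : ℝ) ≤ n := by exact_mod_cast hn
  have hn' : (0 : ℝ) < n := by linarith
  have hn1 : (1 : ℝ) ≤ n := by linarith
  set X : ℕ → Matrix (Fin n) (Fin n) ℝ := fun s => normResponse M s (iterate M s) with hX
  set D : ℕ → ℝ := fun s => pairing M (X s) - pairing M (spinMatrix σ) with hD
  have hacc : ∀ t, t ≤ n ^ 20 → IsAccumulated t (iterate M t) := fun t ht =>
    isAccumulated_iterate hM ht
  have hpot : ∀ t, t ≤ n ^ 20 → ∑ i, (iterate M t i i - t * n ^ 26 : ℝ) ^ 2 ≤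
      2 * n ^ 56 * (∑ s ∈ Finset.range t, D s) + t * (3 * n ^ 55) := by
    intro t ht
    induction t with
    | zero => simp [iterate]
    | succ t ih =>
      have h1 := ih (by omega)
      have h2 := potential_step hn hM (hacc t (by omega)) (by omega) σ
      rw [Finset.sum_range_succ]
      simp only [iterate]
      push_cast
      simp only [hD, hX] at h1 ⊢
      linarith
  have hround : ∀ t, t ≤ n ^ 20 → ∀ i j,
      (iterate M t i j : ℝ) ≤ n ^ 26 * ∑ s ∈ Finset.range t, X s i j ∧
      n ^ 26 * ∑ s ∈ Finset.range t, X s i j ≤ iterate M t i j + t := by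
    intro t ht i j
    induction t with
    | zero => simp [iterate]
    | succ t ih =>
      have h1 := ih (by omega)
      have h2 := rounding_bounds hn0 hM (hacc t (by omega)) (by omega) i j
      rw [Finset.sum_range_succ]
      simp only [iterate]
      push_cast
      simp only [hX] at h1 ⊢
      constructor <;> linarith
  have hTpos : (0 : ℝ) < n ^ 20 := by positivity
  set Z : Matrix (Fin n) (Fin n) ℝ :=
    (1 / n ^ 20 : ℝ) • ∑ s ∈ Finset.range (n ^ 20), X s with hZdef
  have hZij : ∀ i j, Z i j = (∑ s ∈ Finset.range (n ^ 20), X s i j) / n ^ 20 := by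
    intro i j
    rw [hZdef]
    simp only [Matrix.smul_apply, Matrix.sum_apply, smul_eq_mul]
    ring
  have hPot := hpot _ le_rfl
  push_cast at hPot
  set Φ := ∑ i, (iterate M (n ^ 20) i i - (n : ℝ) ^ 20 * n ^ 26 : ℝ) ^ 2 with hΦ
  have hpair : pairing M Z - pairing M (spinMatrix σ) =
      (∑ s ∈ Finset.range (n ^ 20), D s) / n ^ 20 := by
    have e : pairing M Z = (∑ s ∈ Finset.range (n ^ 20), pairing M (X s)) / n ^ 20 := by
      simp only [pairing, hZij, Finset.sum_div]
      rw [Finset.sum_comm]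
      simp only [mul_div_assoc', Finset.mul_sum]
      rw [Finset.sum_comm, Finset.sum_congr rfl fun i _ => Finset.sum_comm, Finset.sum_comm]
    rw [e, hD, Finset.sum_sub_distrib]
    simp only [Finset.sum_const, Finset.card_range, nsmul_eq_mul]
    push_cast
    field_simp
  have hXpsd : ∀ s ∈ Finset.range (n ^ 20), (X s).PosSemidef := fun s hs =>
    normResponse_posSemidef hM (hacc s (Finset.mem_range.1 hs).le) (Finset.mem_range.1 hs).le
  refine ⟨Z, ?_, ?_, ?_, ?_⟩
  · exact (Matrix.posSemidef_sum _ hXpsd).smul (by positivity)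
  · intro i
    have hDle : ∑ s ∈ Finset.range (n ^ 20), D s ≤ n ^ 20 * (2 * n ^ 4) := by
      have : ∀ s ∈ Finset.range (n ^ 20), D s ≤ 2 * n ^ 4 := by
        intro s hs
        have hs' := (Finset.mem_range.1 hs).le
        have h1 := (abs_le.1 (abs_pairing_le hM fun i j =>
          (abs_le_trace (hXpsd s hs) i j).trans
            (trace_normResponse hn0 hM (hacc s hs') hs').le)).2
        have h2 := (abs_le.1 (abs_pairing_le hM (Z := spinMatrix σ) (K := 1) fun i j => by
          simp [spinMatrix, abs_mul, abs_sgn])).1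
        have h3 : (n : ℝ) ^ 3 ≤ n ^ 4 := pow_le_pow_right₀ hn1 (by norm_num)
        simp only [hD]
        linarith
      have := Finset.sum_le_sum this
      simpa using this
    have hΦle : Φ ≤ 5 * n ^ 80 := by
      have h1 := mul_le_mul_of_nonneg_left hDle (by positivity : (0 : ℝ) ≤ 2 * n ^ 56)
      have h2 : (3 : ℝ) * n ^ 75 ≤ n ^ 5 * n ^ 75 := by
        gcongr
        calc (3 : ℝ) ≤ 2 ^ 5 := by norm_num
          _ ≤ _ := by gcongr
      have e1 : (2 : ℝ) * n ^ 56 * (n ^ 20 * (2 * n ^ 4)) = 4 * n ^ 80 := by ring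
      have e2 : (n : ℝ) ^ 20 * (3 * n ^ 55) = 3 * n ^ 75 := by ring
      have e3 : (n : ℝ) ^ 5 * n ^ 75 = n ^ 80 := by ring
      linarith
    have hyi : (iterate M (n ^ 20) i i - (n : ℝ) ^ 20 * n ^ 26 : ℝ) ^ 2 ≤ 5 * n ^ 80 :=
      (Finset.single_le_sum (f := fun i => (iterate M (n ^ 20) i i - (n : ℝ) ^ 20 * n ^ 26 : ℝ) ^ 2)
        (fun _ _ => sq_nonneg _) (Finset.mem_univ i)).trans hΦle
    have hy : |(iterate M (n ^ 20) i i - (n : ℝ) ^ 20 * n ^ 26 : ℝ)| ≤ 3 * n ^ 40 := by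
      refine abs_le_of_sq_le_sq ?_ (by positivity)
      have e : (3 * (n : ℝ) ^ 40) ^ 2 = 9 * n ^ 80 := by ring
      rw [e]
      have : (0 : ℝ) ≤ n ^ 80 := by positivity
      linarith
    obtain ⟨r1, r2⟩ := hround _ le_rfl i i
    push_cast at r2
    have hZ2 : ∑ s ∈ Finset.range (n ^ 20), X s i i = n ^ 20 * Z i i := by
      rw [hZij]; field_simp
    rw [hZ2] at r1 r2
    rw [abs_le] at hy
    have h1 : |(n : ℝ) ^ 46 * (Z i i - 1)| ≤ 4 * (n : ℝ) ^ 40 := by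
      have : (n : ℝ) ^ 20 ≤ n ^ 40 := pow_le_pow_right₀ hn1 (by norm_num)
      have e1 : (n : ℝ) ^ 46 * (Z i i - 1) = n ^ 26 * (n ^ 20 * Z i i) - n ^ 20 * n ^ 26 := by ring
      rw [e1, abs_le]
      constructor <;> linarith
    rw [abs_mul, abs_of_pos (by positivity)] at h1
    rw [le_div_iff₀ (by positivity)]
    have h2 : (4 : ℝ) ≤ n ^ 3 := by
      calc (4 : ℝ) ≤ 2 ^ 3 := by norm_num
        _ ≤ _ := by gcongr
    have h3 : (n : ℝ) ^ 43 * (|Z i i - 1| * n ^ 3) ≤ n ^ 43 * 1 := by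
      calc _ = (n : ℝ) ^ 46 * |Z i i - 1| := by ring
        _ ≤ 4 * n ^ 40 := h1
        _ ≤ n ^ 3 * n ^ 40 := by gcongr
        _ = _ := by ring
    exact le_of_mul_le_mul_left h3 (by positivity)
  · intro i j
    obtain ⟨r1, r2⟩ := hround _ le_rfl i j
    push_cast at r2
    have hZ2 : ∑ s ∈ Finset.range (n ^ 20), X s i j = n ^ 20 * Z i j := by
      rw [hZij]; field_simp
    rw [hZ2] at r1 r2
    have h1 : (n : ℝ) ^ 20 ≤ n ^ 45 := pow_le_pow_right₀ hn1 (by norm_num)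
    have e1 : (n : ℝ) ^ 26 * (n ^ 20 * Z i j) = n ^ 46 * Z i j := by ring
    have e2 : (n : ℝ) ^ 45 = 1 / n * n ^ 46 := by field_simp
    rw [e1] at r1 r2
    have h46 : (0 : ℝ) < n ^ 46 := by positivity
    rw [div_sub' h46.ne', abs_div, abs_of_pos h46, div_le_iff₀ h46, ← e2, abs_le]
    constructor <;> linarith
  · have h1 : 0 ≤ Φ := Finset.sum_nonneg fun _ _ => sq_nonneg _
    have h2 : -1 ≤ pairing M Z - pairing M (spinMatrix σ) := by
      rw [hpair, le_div_iff₀ hTpos]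
      have h3 : 0 ≤ 2 * (n : ℝ) ^ 55 * (n * (∑ s ∈ Finset.range (n ^ 20), D s) + 2 * n ^ 20) := by
        have : 0 ≤ (n : ℝ) ^ 20 * n ^ 55 := by positivity
        have e : 2 * (n : ℝ) ^ 55 * (n * (∑ s ∈ Finset.range (n ^ 20), D s) + 2 * n ^ 20) =
          2 * n ^ 56 * (∑ s ∈ Finset.range (n ^ 20), D s) + n ^ 20 * (4 * n ^ 55) := by ring
        rw [e]
        linarith
      have h4 := nonneg_of_mul_nonneg_right h3 (by positivity)
      have h5 : (2 : ℝ) * n ^ 20 ≤ n * n ^ 20 := by gcongr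
      have h6 : 0 ≤ (n : ℝ) * ((∑ s ∈ Finset.range (n ^ 20), D s) + n ^ 20) := by linarith
      have h7 := nonneg_of_mul_nonneg_right h6 hn'
      linarith
    linarith

end Drift

/-! ### Rounding by a row -/

section Rows

variable {n : ℕ}

/-- The value of row `i` of `W` for the quadratic form of `W`. -/
def rowScore {R : Type*} [Semiring R] (W : Matrix (Fin n) (Fin n) R) (i : Fin n) : R :=
  ∑ j, ∑ k, W i j * W j k * W i k

/-- The spins given by the signs of row `i`. -/
noncomputable def rowSpins (W : Matrix (Fin n) (Fin n) ℝ) (i : Fin n) : Spins n :=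
  fun j => if 0 < W i j then 1 else -1

theorem abs_frobenius_quad_le {D : Matrix (Fin n) (Fin n) ℝ} {x : Fin n → ℝ} {d s : ℝ}
    (hd : 0 ≤ d) (hD : ∑ i, ∑ j, D i j ^ 2 ≤ d ^ 2) (hx : ∑ i, x i ^ 2 ≤ s) :
    |∑ j, ∑ k, x j * D j k * x k| ≤ d * s := by
  have hs : 0 ≤ s := (Finset.sum_nonneg fun _ _ => sq_nonneg _).trans hx
  refine abs_le_of_sq_le_sq ?_ (by positivity)
  have h1 := Finset.sum_mul_sq_le_sq_mul_sq (Finset.univ : Finset (Fin n × Fin n))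
    (fun p => D p.1 p.2) fun p => x p.1 * x p.2
  rw [Fintype.sum_prod_type, Fintype.sum_prod_type, Fintype.sum_prod_type] at h1
  have e1 : ∑ j, ∑ k, x j * D j k * x k = ∑ j, ∑ k, D j k * (x j * x k) :=
    Finset.sum_congr rfl fun j _ => Finset.sum_congr rfl fun k _ => by ring
  have e2 : ∑ j, ∑ k, (x j * x k) ^ 2 = (∑ i, x i ^ 2) ^ 2 := by
    rw [sq (∑ i, x i ^ 2), Finset.sum_mul_sum]
    exact Finset.sum_congr rfl fun j _ => Finset.sum_congr rfl fun k _ => by ring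
  rw [e1]
  refine h1.trans ?_
  simp only at e2 ⊢
  rw [e2, mul_pow]
  have : 0 ≤ ∑ i, x i ^ 2 := Finset.sum_nonneg fun _ _ => sq_nonneg _
  gcongr

/-- The signs of a row agree with the spins at least as much as the row correlates with them. -/
theorem le_card_rowSpins {W : Matrix (Fin n) (Fin n) ℝ} (i : Fin n) (σ : Spins n) {K : ℝ}
    (hW : ∀ j, |W i j| ≤ K) :
    ∑ j, W i j * sgn (σ j) ≤ K * ((Finset.univ.filter fun j => rowSpins W i j = σ j).card : ℝ) ∧
    -∑ j, W i j * sgn (σ j) ≤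
      K * ((Finset.univ.filter fun j => -rowSpins W i j = σ j).card : ℝ) := by
  simp only [Finset.card_filter]
  push_cast
  rw [Finset.mul_sum, Finset.mul_sum, ← Finset.sum_neg_distrib]
  constructor <;> refine Finset.sum_le_sum fun j _ => ?_ <;>
  · have h1 := abs_le.1 (hW j)
    rcases Int.units_eq_one_or (σ j) with h | h <;>
    by_cases h0 : 0 < W i j <;> simp [rowSpins, h, h0, sgn] <;> linarith

/-- A row of largest score recovers the spins if the matrix is close to the spin matrix: the score
is nearly the squared correlation of the row with the spins, and some row has a large one. -/
theorem isPartialRecovery_rowSpins {W : Matrix (Fin n) (Fin n) ℝ} (hn : 0 < n) {σ : Spins n}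
    (hW : ∀ i j, |W i j| ≤ 1.01)
    (hD : ∑ i, ∑ j, (W i j - spinMatrix σ i j) ^ 2 ≤ 0.005 * n ^ 2) {i : Fin n}
    (hi : (∃ j, 0 < rowScore W j) → ∀ j, rowScore W j ≤ rowScore W i) :
    IsPartialRecovery 0.6 (rowSpins W i) σ := by
  have hn' : (0 : ℝ) < n := by exact_mod_cast hn
  set D : Matrix (Fin n) (Fin n) ℝ := Matrix.of fun i j => W i j - spinMatrix σ i j with hDdef
  set h : Fin n → ℝ := fun i => ∑ j, W i j * sgn (σ j) with hh
  have hD2 : ∑ i, ∑ j, D i j ^ 2 ≤ (0.071 * n) ^ 2 := by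
    refine hD.trans ?_
    nlinarith
  have hrow : ∀ i, ∑ j, W i j ^ 2 ≤ 1.0201 * n := by
    intro i
    calc _ ≤ ∑ _j : Fin n, (1.0201 : ℝ) := by
          refine Finset.sum_le_sum fun j _ => ?_
          rw [← sq_abs]
          have := hW i j
          have := abs_nonneg (W i j)
          nlinarith
      _ = _ := by simp; ring
  have hscore : ∀ i, |rowScore W i - h i ^ 2| ≤ 0.0725 * n ^ 2 := by
    intro i
    have e : rowScore W i - h i ^ 2 = ∑ j, ∑ k, W i j * D j k * W i k := by
      rw [hh, sq, Finset.sum_mul_sum, rowScore]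
      simp only [← Finset.sum_sub_distrib]
      refine Finset.sum_congr rfl fun j _ => Finset.sum_congr rfl fun k _ => ?_
      simp only [hDdef, spinMatrix, Matrix.of_apply]; ring
    rw [e]
    refine (abs_frobenius_quad_le (by positivity) hD2 (hrow i)).trans ?_
    nlinarith
  -- some row correlates well with the spins
  obtain ⟨i₀, hi₀⟩ : ∃ i₀, 0.929 * (n : ℝ) ≤ sgn (σ i₀) * h i₀ := by
    have h1 := (abs_le.1 (abs_frobenius_quad_le (by positivity) hD2
      (sum_sgn_sq σ).le)).1
    have e : ∑ i, sgn (σ i) * h i =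
        ∑ j, ∑ k, sgn (σ j) * D j k * sgn (σ k) + (n : ℝ) ^ 2 := by
      have e1 : (n : ℝ) ^ 2 = ∑ i : Fin n, ∑ j : Fin n, (1 : ℝ) := by simp [sq]
      rw [e1]
      simp only [hh, Finset.mul_sum, ← Finset.sum_add_distrib]
      refine Finset.sum_congr rfl fun j _ => Finset.sum_congr rfl fun k _ => ?_
      simp only [hDdef, spinMatrix, Matrix.of_apply]
      have e2 := sgn_mul_self (σ j)
      have e3 := sgn_mul_self (σ k)
      linear_combination e2 * (sgn (σ k) * sgn (σ k)) + e3
    have : ∑ _i : Fin n, 0.929 * (n : ℝ) ≤ ∑ i, sgn (σ i) * h i := by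
      rw [e]
      simp only [Finset.sum_const, Finset.card_univ, Fintype.card_fin, nsmul_eq_mul]
      nlinarith
    have hne : (Finset.univ : Finset (Fin n)).Nonempty := ⟨⟨0, hn⟩, Finset.mem_univ _⟩
    obtain ⟨i₀, _, hi₀⟩ := Finset.exists_le_of_sum_le hne this
    exact ⟨i₀, hi₀⟩
  have h1 : (0.929 * (n : ℝ)) ^ 2 ≤ h i₀ ^ 2 := by
    have e : h i₀ ^ 2 = (sgn (σ i₀) * h i₀) ^ 2 := by
      rw [mul_pow, sq (sgn _), sgn_mul_self, one_mul]
    rw [e]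
    gcongr
  have h2 := (abs_le.1 (hscore i₀)).1
  have hn2 : (0 : ℝ) < n ^ 2 := by positivity
  have h3 := hi ⟨i₀, by nlinarith⟩ i₀
  have h4 := (abs_le.1 (hscore i)).2
  have h5 : (0.8 * (n : ℝ)) ^ 2 ≤ h i ^ 2 := by nlinarith
  have h6 : 0.8 * (n : ℝ) ≤ |h i| := by
    have := sq_le_sq.1 h5
    rwa [abs_of_pos (by positivity)] at this
  have h7 := le_card_rowSpins i σ (hW i)
  rcases le_total 0 (h i) with h0 | h0
  · left
    rw [abs_of_nonneg h0] at h6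
    have := h7.1
    change h i ≤ _ at this
    linarith
  · right
    rw [abs_of_nonpos h0] at h6
    have := h7.2
    change -h i ≤ _ at this
    linarith

end Rows

/-! ### The algorithm recovers the spins -/

open Classical in
/-- The objective matrix `⌊√n⌋ A - J` of the algorithm. -/
noncomputable def sdpMatrix {n : ℕ} (G : SimpleGraph (Fin n)) : Matrix (Fin n) (Fin n) ℤ :=
  Matrix.of fun i j => (Nat.sqrt n : ℤ) * (if G.Adj i j then 1 else 0) - 1

theorem isObjective_sdpMatrix {n : ℕ} (G : SimpleGraph (Fin n)) : IsObjective (sdpMatrix G) := by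
  refine ⟨fun i j => ?_, fun i j => ?_⟩
  · by_cases h : G.Adj i j
    · simp [sdpMatrix, h, h.symm]
    · have h' : ¬ G.Adj j i := fun h' => h h'.symm
      simp [sdpMatrix, h, h']
  · have hn := one_le_cast i
    have h1 : (Nat.sqrt n : ℝ) ≤ n := by exact_mod_cast Nat.sqrt_le_self n
    have h2 : (0 : ℝ) ≤ Nat.sqrt n := Nat.cast_nonneg _
    simp only [sdpMatrix, Matrix.of_apply]
    rw [abs_le]
    split_ifs <;> push_cast <;> constructor <;> linarith

theorem offDiagObjective_eq {n : ℕ} (hn : 0 < n) (G : SimpleGraph (Fin n))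
    (Z : Matrix (Fin n) (Fin n) ℝ) :
    offDiagObjective G (1 / (Nat.sqrt n : ℝ)) Z = pairing (sdpMatrix G) Z / (Nat.sqrt n : ℝ) := by
  have hm : (Nat.sqrt n : ℝ) ≠ 0 := by exact_mod_cast (Nat.sqrt_pos.2 hn).ne'
  simp only [offDiagObjective, pairing, Finset.sum_div]
  refine Finset.sum_congr rfl fun i _ => Finset.sum_congr rfl fun j _ => ?_
  simp only [sdpMatrix, Matrix.of_apply]
  split_ifs <;> push_cast <;> field_simp

/-- The sum of all responses of the algorithm. -/
noncomputable def sdpIterate {n : ℕ} (G : SimpleGraph (Fin n)) : Matrix (Fin n) (Fin n) ℤ :=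
  iterate (sdpMatrix G) (n ^ 20)

/-- On the good event the rows of largest score recover the spins. The matrix `Z` of
`exists_nearOptimal` becomes feasible after division by `1 + 1 / n ^ 3`, which costs at most `1` in
the objective, so it correlates with the spins and is close to `σ σᵀ` in Frobenius norm. -/
theorem isPartialRecovery_sdpIterate {a b : ℝ} {n : ℕ} {σ : Spins n} {H G : SimpleGraph (Fin n)}
    (hn : 2000 ≤ n) (hb : 0 ≤ b) (hab : b < a) (ha : 4 ≤ a) (han : a ≤ n)
    (habn : a + b ≤ Nat.sqrt n) (hgap : 10 ^ 10 * (2 * (a + b)) < (a - b) ^ 2)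
    (hcut : IsCutBounded a b σ H) (hmono : IsMonotoneChange σ H G)
    (hbal : IsBalanced (1 / (Nat.sqrt n : ℝ)) σ) {i : Fin n}
    (hi : (∃ j, 0 < rowScore (sdpIterate G) j) →
      ∀ j, rowScore (sdpIterate G) j ≤ rowScore (sdpIterate G) i) :
    IsPartialRecovery 0.6 (rowSpins (toReal (sdpIterate G)) i) σ := by
  have hn0 : 0 < n := by omega
  have hnR : (2000 : ℝ) ≤ n := by exact_mod_cast hn
  have hn' : (0 : ℝ) < n := by linarith
  have hm0 : 0 < Nat.sqrt n := Nat.sqrt_pos.2 hn0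
  have hm1 : (1 : ℝ) ≤ Nat.sqrt n := by exact_mod_cast hm0
  have hmm : (Nat.sqrt n : ℝ) * Nat.sqrt n ≤ n := by exact_mod_cast Nat.sqrt_le n
  have hM := isObjective_sdpMatrix G
  obtain ⟨Z, hZ, hZd, hRZ, hopt⟩ := exists_nearOptimal (by omega) hM σ
  -- scaling to a feasible matrix
  set s : ℝ := 1 + 1 / n ^ 3 with hs
  have hs1 : 1 ≤ s := by rw [hs]; linarith [(by positivity : (0 : ℝ) ≤ 1 / n ^ 3)]
  have hs0 : 0 < s := by linarith
  have hZds : ∀ i, Z i i ≤ s := fun i => by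
    have := (abs_le.1 (hZd i)).2
    rw [hs]; linarith
  have hZs : ∀ i j, |Z i j| ≤ s := fun i j => by
    have := two_mul_abs_le_of_posSemidef hZ i j
    linarith [hZds i, hZds j]
  set Y : Matrix (Fin n) (Fin n) ℝ := (1 / s) • Z with hY
  have hYij : ∀ i j, Y i j = Z i j / s := fun i j => by
    rw [hY, Matrix.smul_apply, smul_eq_mul]; ring
  have hYpsd : Y.PosSemidef := hZ.smul (by positivity)
  have hYd : ∀ i, Y i i ≤ 1 := fun i => by
    rw [hYij, div_le_one hs0]; exact hZds i
  have hYZ : ∀ i j, |Z i j - Y i j| ≤ 1 / n ^ 3 := fun i j => by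
    have e : Z i j - Y i j = Z i j * (1 / n ^ 3) / s := by
      rw [hYij, show (1 : ℝ) / n ^ 3 = s - 1 by rw [hs]; ring]; field_simp
    rw [e, abs_div, abs_mul, abs_of_pos hs0, div_le_iff₀ hs0,
      abs_of_pos (by positivity : (0 : ℝ) < 1 / n ^ 3), mul_comm]
    have := hZs i j
    gcongr
  have hYopt : pairing (sdpMatrix G) (spinMatrix σ) - 2 ≤ pairing (sdpMatrix G) Y := by
    have h1 := (abs_le.1 (abs_pairing_le hM (Z := Z - Y) hYZ)).2
    have h2 : pairing (sdpMatrix G) (Z - Y) =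
        pairing (sdpMatrix G) Z - pairing (sdpMatrix G) Y := by
      simp only [pairing, Matrix.sub_apply, mul_sub, Finset.sum_sub_distrib]
    have h3 : (n : ℝ) ^ 3 * (1 / n ^ 3) = 1 := by field_simp
    rw [h2, h3] at h1
    linarith
  have hlam : (a + b) / (2 * n) ≤ 1 / (Nat.sqrt n : ℝ) := by
    rw [div_le_div_iff₀ (by positivity) (by positivity)]
    nlinarith
  have hoff : offDiagObjective G (1 / (Nat.sqrt n : ℝ)) (fun i j => sgn (σ i) * sgn (σ j)) - 2 ≤
      offDiagObjective G (1 / (Nat.sqrt n : ℝ)) Y := by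
    change offDiagObjective G (1 / (Nat.sqrt n : ℝ)) (spinMatrix σ) - 2 ≤ _
    rw [offDiagObjective_eq hn0, offDiagObjective_eq hn0, le_div_iff₀ (by linarith), sub_mul,
      div_mul_cancel₀ _ (by linarith)]
    linarith
  have key := correlation_of_nearOptimal hn0 hb hab hcut hmono hbal hlam hYpsd hYd hoff
  set q := ∑ i, ∑ j, sgn (σ i) * Y i j * sgn (σ j) with hq
  -- the correlation is almost perfect
  have hq2 : n ^ 2 - q ≤ 0.00055 * (n : ℝ) ^ 2 := by
    have hpos : 0 < a + b := by linarith
    have hr2 : 2 ≤ √(a + b) := by rw [Real.le_sqrt (by norm_num) hpos.le]; linarith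
    have hrr : √(a + b) ^ 2 = a + b := Real.sq_sqrt hpos.le
    have hd : 0 < a - b := by linarith
    have hgap' : 140000 * √(a + b) ≤ a - b := by
      refine le_of_sq_le_sq ?_ hd.le
      rw [mul_pow, hrr]; linarith
    rw [div_mul_eq_mul_div, div_le_iff₀ (by positivity)] at key
    have h1 : (a - b) * (n ^ 2 - q) ≤ 76 * √(a + b) * n ^ 2 := by
      have : (36 * n * √(a + b) + n + a + 2) * (2 * n) ≤ 38 * n * √(a + b) * (2 * n) := by
        gcongr
        nlinarith
      linarith
    have h2 : 76 * √(a + b) * n ^ 2 ≤ (a - b) * (0.00055 * (n : ℝ) ^ 2) := by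
      have : 76 * √(a + b) ≤ (a - b) * 0.00055 := by linarith
      calc _ ≤ (a - b) * 0.00055 * (n : ℝ) ^ 2 := by gcongr
        _ = _ := by ring
    exact le_of_mul_le_mul_left (h1.trans h2) hd
  have hY1 := abs_le_one_of_posSemidef hYpsd hYd
  have hfro : ∑ i, ∑ j, (Y i j - spinMatrix σ i j) ^ 2 ≤ 2 * (n ^ 2 - q) := by
    have e : 2 * ((n : ℝ) ^ 2 - q) =
        ∑ i : Fin n, ∑ j : Fin n, 2 * (1 - sgn (σ i) * Y i j * sgn (σ j)) := by
      simp only [hq, ← Finset.mul_sum, Finset.sum_sub_distrib]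
      simp [sq]
    rw [e]
    refine Finset.sum_le_sum fun i _ => Finset.sum_le_sum fun j _ => ?_
    have h1 : (sgn (σ i) * sgn (σ j)) ^ 2 = 1 := by
      rw [mul_pow, sq, sq, sgn_mul_self, sgn_mul_self, one_mul]
    have h2 : Y i j ^ 2 ≤ 1 := by
      rw [← sq_abs]; exact pow_le_one₀ (abs_nonneg _) (hY1 i j)
    simp only [spinMatrix, Matrix.of_apply]
    nlinarith
  -- the computed matrix
  have hp46 : (0 : ℝ) < n ^ 46 := by positivity
  set W : Matrix (Fin n) (Fin n) ℝ := Matrix.of fun i j => sdpIterate G i j / (n : ℝ) ^ 46 with hWdef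
  have hWij : ∀ i j, W i j = sdpIterate G i j / (n : ℝ) ^ 46 := fun _ _ => rfl
  have hWY : ∀ i j, |W i j - Y i j| ≤ 2 / n := fun i j => by
    have h1 := abs_le.1 (hRZ i j)
    have h2 := abs_le.1 (hYZ i j)
    have h3 : (1 : ℝ) / n ^ 3 ≤ 1 / n := by
      gcongr
      calc (n : ℝ) = n ^ 1 := by ring
        _ ≤ n ^ 3 := pow_le_pow_right₀ (by linarith) (by norm_num)
    have h4 : (2 : ℝ) / n = 1 / n + 1 / n := by ring
    rw [hWij, abs_le, h4]
    unfold sdpIterate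
    constructor <;> linarith
  have h2n : 2 / (n : ℝ) ≤ 0.001 := by
    rw [div_le_iff₀ hn']; linarith
  have hWbound : ∀ i j, |W i j| ≤ 1.01 := fun i j => by
    have h1 := abs_le.1 (hWY i j)
    have h2 := abs_le.1 (hY1 i j)
    rw [abs_le]
    constructor <;> linarith
  have hWfro : ∑ i, ∑ j, (W i j - spinMatrix σ i j) ^ 2 ≤ 0.005 * n ^ 2 := by
    calc _ ≤ ∑ i, ∑ j, (2 * (Y i j - spinMatrix σ i j) ^ 2 + 0.000002) := by
          refine Finset.sum_le_sum fun i _ => Finset.sum_le_sum fun j _ => ?_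
          have h1 : (W i j - Y i j) ^ 2 ≤ 0.000001 := by
            rw [← sq_abs]
            have := (hWY i j).trans h2n
            have := abs_nonneg (W i j - Y i j)
            nlinarith
          nlinarith [sq_nonneg ((W i j - Y i j) - (Y i j - spinMatrix σ i j))]
      _ = 2 * ∑ i, ∑ j, (Y i j - spinMatrix σ i j) ^ 2 + 0.000002 * n ^ 2 := by
          simp only [Finset.sum_add_distrib, ← Finset.mul_sum, Finset.sum_const,
            Finset.card_univ, Fintype.card_fin, nsmul_eq_mul]
          ring
      _ ≤ _ := by nlinarith
  have hspins : rowSpins (toReal (sdpIterate G)) i = rowSpins W i := by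
    funext j
    have h : (0 : ℝ) < toReal (sdpIterate G) i j ↔ 0 < W i j := by
      rw [hWij, div_pos_iff_of_pos_right hp46, toReal_apply]
    simp only [rowSpins, h]
  have hsc : ∀ j, rowScore W j = rowScore (sdpIterate G) j / ((n : ℝ) ^ 46) ^ 3 := by
    intro j
    simp only [rowScore, hWij]
    push_cast
    simp only [Finset.sum_div]
    refine Finset.sum_congr rfl fun k _ => Finset.sum_congr rfl fun l _ => ?_
    field_simp
  rw [hspins]
  refine isPartialRecovery_rowSpins hn0 hWbound hWfro ?_
  rintro ⟨j, hj⟩ k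
  rw [hsc] at hj ⊢
  rw [hsc]
  have h1 : (0 : ℝ) < rowScore (sdpIterate G) j := by
    by_contra h
    push Not at h
    exact absurd hj (not_lt.2 (div_nonpos_of_nonpos_of_nonneg h (by positivity)))
  have h2 := hi ⟨j, by exact_mod_cast h1⟩ k
  gcongr

/-- An estimator that returns the signs of a row of largest score of the iterated matrix achieves
partial recovery. -/
theorem achievesPartialRecovery_of_rowSpins {f : Estimator}
    (hf : ∀ n : ℕ, 1 ≤ n → ∀ G : SimpleGraph (Fin n), ∃ i,
      f n G = rowSpins (toReal (sdpIterate G)) i ∧ ((∃ j, 0 < rowScore (sdpIterate G) j) →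
        ∀ j, rowScore (sdpIterate G) j ≤ rowScore (sdpIterate G) i))
    {a b : ℝ} (hb : 0 ≤ b) (hab : b < a) (ha : 4 ≤ a)
    (hgap : 10 ^ 10 * (2 * (a + b)) < (a - b) ^ 2) : AchievesPartialRecovery a b f := by
  refine ⟨0.6, by norm_num, ?_⟩
  have hsq : Tendsto Nat.sqrt atTop atTop := by
    refine tendsto_atTop.2 fun c => ?_
    filter_upwards [eventually_ge_atTop (c * c)] with n hn
    exact Nat.le_sqrt.2 hn
  have hsqR : Tendsto (fun n : ℕ => (Nat.sqrt n : ℝ)) atTop atTop :=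
    tendsto_natCast_atTop_atTop.comp hsq
  refine holdsAAS_of_good hb hab ha (lam := fun n => 1 / (Nat.sqrt n : ℝ))
    (fun n => by positivity) (tendsto_const_nhds.div_atTop hsqR) ?_
  filter_upwards [eventually_ge_atTop 2000, eventually_ge_atTop ⌈a⌉₊,
    hsqR.eventually_ge_atTop (a + b)] with n hn hna hsn σ H G hbal hcut hmono
  have han : a ≤ n := (Nat.le_ceil a).trans (by exact_mod_cast hna)
  obtain ⟨i, hi, hmax⟩ := hf n (by omega) G
  rw [hi]
  exact isPartialRecovery_sdpIterate hn hb hab ha han hsn hgap hcut hmono hbal hmax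

/-! ### Programs for matrix arithmetic -/

section Matrices

variable {V n : ℕ} {s : Memory}

/-- The number of steps of an assignment to all cells of a matrix. -/
def cellsTime (n : ℕ) : ℕ := n * (n * 3 + 4) + 2

/-- The entry of array `x` at the row and column held by the variables `y` and `z`. -/
abbrev Expr.entry (x y z : ℕ) : Expr := .get x (.cell y z)

theorem Holds.congr {s t : Memory} {x : ℕ} {M : Matrix (Fin n) (Fin n) ℤ} (h : Holds s x M)
    (hst : t x = s x) : Holds t x M := fun i j => by rw [hst]; exact h i j

theorem eval_entry {x y z : ℕ} {M : Matrix (Fin n) (Fin n) ℤ} (h : Holds s x M) (hn : s 0 0 = n)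
    {i j : Fin n} (hi : s y 0 = (i : ℕ)) (hj : s z 0 = (j : ℕ)) :
    (Expr.entry x y z).eval s = M i j := by
  simp only [Expr.cell, Expr.eval, hn, hi, hj]
  exact h i j

/-- The product of the first `k` columns of `P` with the first `k` rows of `S`. -/
def partialMul (P S : Matrix (Fin n) (Fin n) ℤ) (k : ℕ) : Matrix (Fin n) (Fin n) ℤ :=
  Matrix.of fun i j => ∑ l : Fin n, if (l : ℕ) < k then P i l * S l j else 0

theorem partialMul_succ (P S : Matrix (Fin n) (Fin n) ℤ) (k : Fin n) (i j : Fin n) :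
    partialMul P S (k + 1) i j = partialMul P S k i j + P i k * S k j := by
  have e : P i k * S k j = ∑ l : Fin n, if l = k then P i l * S l j else 0 := by simp
  simp only [partialMul, Matrix.of_apply]
  rw [e, ← Finset.sum_add_distrib]
  refine Finset.sum_congr rfl fun l _ => ?_
  rcases lt_trichotomy (l : ℕ) k with h | h | h
  · have : l ≠ k := fun e => by simp [e] at h
    simp [h, this, Nat.lt_succ_of_lt h]
  · have : l = k := Fin.ext h
    simp [this]
  · have : l ≠ k := fun e => by simp [e] at h
    simp [this, not_lt.2 h.le, not_lt.2 (Nat.succ_le_of_lt h)]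

theorem partialMul_self (P S : Matrix (Fin n) (Fin n) ℤ) : partialMul P S n = P * S := by
  ext i j
  simp [partialMul, Matrix.mul_apply]

theorem natAbs_partialMul_le {P S : Matrix (Fin n) (Fin n) ℤ} {i j : Fin n}
    (h : ∑ l, (P i l).natAbs * (S l j).natAbs ≤ V) (k : ℕ) :
    (partialMul P S k i j).natAbs ≤ V := by
  refine le_trans ?_ h
  simp only [partialMul, Matrix.of_apply]
  refine (Int.natAbs_sum_le _ _).trans (Finset.sum_le_sum fun l _ => ?_)
  split_ifs
  · rw [Int.natAbs_mul]
  · simp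

/-- Multiply the matrix in array `5` by the one in array `4`, using array `6`. -/
def mulProgram : Program :=
  .seq (forCells 6 (.lit 0)) (.seq
    (forLoop 12 (.var 0) (forCells 6
      (.add (.entry 6 10 11) (.mul (.entry 5 10 12) (.entry 4 12 11)))))
    (forCells 5 (.entry 6 10 11)))

/-- The number of steps of `mulProgram`. -/
def mulTime (n : ℕ) : ℕ := cellsTime n + (n * (cellsTime n + 2) + 2 + cellsTime n)

theorem runs_mulProgram (hV : 2 ≤ V) (hnV : n ≤ V) (hs : MemLE V s) (hn : s 0 0 = n)
    {P S : Matrix (Fin n) (Fin n) ℤ} (hP : Holds s 5 P) (hS : Holds s 4 S)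
    (hPS : ∀ i j, ∑ l, (P i l).natAbs * (S l j).natAbs ≤ V) :
    ∃ t, Runs V mulProgram s (mulTime n) t ∧ MemLE V t ∧ Frame {5, 6, 10, 11, 12} s t ∧
      Holds t 5 (P * S) := by
  obtain ⟨s1, r1, m1, f1, h1⟩ := runs_forCells (x := 6) (e := .lit 0) hV hnV (by decide)
    (by decide) hs hn (partialMul P S 0) (fun i j => natAbs_partialMul_le (hPS i j) 0)
    (fun i j s' _ _ _ _ => by simp [Expr.eval, partialMul])
  obtain ⟨s2, r2, m2, f2, h2⟩ := runs_forLoop (V := V) (x := 12) (m := cellsTime n) (N := n)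
    (bound := .var 0) (s := s1)
    (p := forCells 6 (.add (.entry 6 10 11) (.mul (.entry 5 10 12) (.entry 4 12 11))))
    (I := fun k s' => MemLE V s' ∧ Frame {6, 10, 11, 12} s s' ∧ Holds s' 6 (partialMul P S k))
    hV (by decide) m1
    (fun k s' h => ⟨h.1, by simp only [Expr.eval]; rw [h.2.1 0 (by decide), hn]⟩)
    ⟨m1.store (by simp), (f1.mono (by decide)).store (by decide),
      h1.congr (store_of_ne (by decide))⟩
    (fun k hk s' ⟨hm, hf, hh⟩ hk12 => by
      have hn' : s' 0 0 = n := by rw [hf 0 (by decide), hn]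
      obtain ⟨t, rt, mt, ft, ht⟩ := runs_forCells (x := 6)
        (e := .add (.entry 6 10 11) (.mul (.entry 5 10 12) (.entry 4 12 11))) hV hnV (by decide)
        (by decide) hm hn' (partialMul P S (k + 1))
        (fun i j => natAbs_partialMul_le (hPS i j) _)
        (fun i j s'' hf' h10 h11 hcell => by
          have hn'' : s'' 0 0 = n := by rw [hf' 0 (by decide), hn']
          have e5 := eval_entry (hP.congr ((hf' 5 (by decide)).trans (hf 5 (by decide)))) hn''
            h10 (j := ⟨k, hk⟩) (z := 12) (by rw [hf' 12 (by decide), hk12])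
          have e4 := eval_entry (hS.congr ((hf' 4 (by decide)).trans (hf 4 (by decide)))) hn''
            (i := ⟨k, hk⟩) (y := 12) (by rw [hf' 12 (by decide), hk12]) h11
          have e6 : (Expr.entry 6 10 11).eval s'' = partialMul P S k i j := by
            simp only [Expr.cell, Expr.eval, hn'', h10, h11]
            rw [hcell, hh i j]
          change (Expr.entry 6 10 11).eval s'' +
            (Expr.entry 5 10 12).eval s'' * (Expr.entry 4 12 11).eval s'' = _
          rw [e4, e5, e6]
          exact (partialMul_succ P S ⟨k, hk⟩ i j).symm)
      have ft' : Frame {6, 10, 11, 12} s t := hf.trans (ft.mono (by decide))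
      exact ⟨t, rt, mt, by rw [ft 12 (by decide), hk12],
        mt.store (by omega), ft'.store (by decide), ht.congr (store_of_ne (by decide))⟩)
  have hn2 : s2 0 0 = n := by rw [f2 0 (by decide), hn]
  obtain ⟨s3, r3, m3, f3, h3⟩ := runs_forCells (x := 5) (e := .entry 6 10 11) hV hnV (by decide)
    (by decide) m2 hn2 (P * S)
    (fun i j => by rw [← partialMul_self]; exact natAbs_partialMul_le (hPS i j) n)
    (fun i j s' hf' h10 h11 _ => by
      rw [eval_entry (h2.congr (hf' 6 (by decide))) (by rw [hf' 0 (by decide), hn2]) h10 h11,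
        partialMul_self])
  exact ⟨s3, r1.seq (r2.seq r3), m3, (f2.mono (by decide)).trans (f3.mono (by decide)), h3⟩

/-- The expression `n ^ k`. -/
def Expr.pow : ℕ → Expr
  | 0 => .lit 1
  | k + 1 => .mul (Expr.pow k) (.var 0)

theorem eval_pow (hn : s 0 0 = n) (k : ℕ) : (Expr.pow k).eval s = (n : ℤ) ^ k := by
  induction k with
  | zero => rfl
  | succ k ih => simp only [Expr.pow, Expr.eval, ih, hn, pow_succ]

theorem size_pow (k : ℕ) : (Expr.pow k).size = 3 * k + 1 := by
  induction k with
  | zero => rfl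
  | succ k ih => simp only [Expr.pow, Expr.size, ih]; omega

theorem maxLit_pow (k : ℕ) : (Expr.pow k).maxLit = 1 := by
  induction k with
  | zero => rfl
  | succ k ih => simp [Expr.pow, Expr.maxLit, ih]

/-- The expression that is `1` on the diagonal and `0` elsewhere: `1 / (1 + (i - j) ^ 2)`. -/
def Expr.delta : Expr :=
  .div (.lit 1) (.add (.lit 1) (.mul (.sub (.var 10) (.var 11)) (.sub (.var 10) (.var 11))))

theorem eval_delta {i j : Fin n} (hi : s 10 0 = (i : ℕ)) (hj : s 11 0 = (j : ℕ)) :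
    Expr.delta.eval s = if i = j then 1 else 0 := by
  simp only [Expr.delta, Expr.eval, hi, hj]
  split_ifs with h
  · simp [h]
  · have h1 : ((i : ℕ) : ℤ) - (j : ℕ) ≠ 0 := fun e => h (Fin.ext (by omega))
    refine Int.ediv_eq_zero_of_lt (by norm_num) ?_
    have := mul_self_pos.2 h1
    linarith

/-- Write the `n ^ 60`-th power of the matrix in array `4` to array `5`. -/
def powProgram : Program := .seq (forCells 5 .delta) (forLoop 13 (.pow 60) mulProgram)

/-- The number of steps of `powProgram`. -/
def powTime (n : ℕ) : ℕ := cellsTime n + (n ^ 60 * (mulTime n + 2) + 2)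

theorem runs_powProgram (hV : 2 ≤ V) (hnV : n ≤ V) (hqV : n ^ 60 ≤ V) (hs : MemLE V s)
    (hn : s 0 0 = n) {S : Matrix (Fin n) (Fin n) ℤ} (hS : Holds s 4 S)
    (hb : ∀ r < n ^ 60, ∀ i j, ∑ l, ((S ^ r) i l).natAbs * (S l j).natAbs ≤ V) :
    ∃ t, Runs V powProgram s (powTime n) t ∧ MemLE V t ∧ Frame {5, 6, 10, 11, 12, 13} s t ∧
      Holds t 5 (S ^ (n ^ 60)) := by
  obtain ⟨s1, r1, m1, f1, h1⟩ := runs_forCells (x := 5) (e := .delta) hV hnV (by decide)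
    (by decide) hs hn 1
    (fun i j => by rw [Matrix.one_apply]; split_ifs <;> (simp; try omega))
    (fun i j s' _ h10 h11 _ => by rw [eval_delta h10 h11, Matrix.one_apply])
  obtain ⟨s2, r2, m2, f2, h2⟩ := runs_forLoop (V := V) (x := 13) (m := mulTime n) (N := n ^ 60)
    (bound := .pow 60) (s := s1) (p := mulProgram)
    (I := fun r s' => MemLE V s' ∧ Frame {5, 6, 10, 11, 12, 13} s s' ∧ Holds s' 5 (S ^ r))
    hV (by simp [Expr.Small, Expr.size, Expr.maxLit, size_pow, maxLit_pow]) m1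
    (fun k s' h => ⟨h.1, by rw [eval_pow (by rw [h.2.1 0 (by decide), hn])]; push_cast; rfl⟩)
    ⟨m1.store (by simp), (f1.mono (by decide)).store (by decide), by
      rw [pow_zero]; exact h1.congr (store_of_ne (by decide))⟩
    (fun r hr s' ⟨hm, hf, hh⟩ hr13 => by
      obtain ⟨t, rt, mt, ft, ht⟩ := runs_mulProgram hV hnV hm (by rw [hf 0 (by decide), hn]) hh
        (hS.congr (hf 4 (by decide))) (hb r hr)
      have ft' : Frame {5, 6, 10, 11, 12, 13} s t := hf.trans (ft.mono (by decide))
      refine ⟨t, rt, mt, by rw [ft 13 (by decide), hr13], mt.store (by omega),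
        ft'.store (by decide), ?_⟩
      rw [pow_succ]
      exact ht.congr (store_of_ne (by decide)))
  exact ⟨s2, r1.seq r2, m2, f2, h2⟩

/-- Write the trace of the matrix in array `5` to the variable `20`. -/
def traceProgram : Program :=
  .seq (.assign 20 (.lit 0) (.lit 0))
    (forLoop 10 (.var 0) (.assign 20 (.lit 0) (.add (.var 20) (.entry 5 10 10))))

/-- The number of steps of `traceProgram`. -/
def traceTime (n : ℕ) : ℕ := 1 + (n * (1 + 2) + 2)

theorem runs_traceProgram (hV : 2 ≤ V) (hnV : n ≤ V) (hs : MemLE V s) (hn : s 0 0 = n)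
    {P : Matrix (Fin n) (Fin n) ℤ} (hP : Holds s 5 P) (hb : ∑ i, (P i i).natAbs ≤ V) :
    ∃ t, Runs V traceProgram s (traceTime n) t ∧ MemLE V t ∧ Frame {10, 20} s t ∧
      t 20 0 = P.trace := by
  have hpart : ∀ k : ℕ, (∑ i : Fin n, if (i : ℕ) < k then P i i else 0).natAbs ≤ V := fun k => by
    refine (Int.natAbs_sum_le _ _).trans ((Finset.sum_le_sum fun i _ => ?_).trans hb)
    split_ifs <;> simp
  have r1 := runs_assign (x := 20) (i := .lit 0) (e := .lit 0) hV hs (by decide) (by decide)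
  set s1 := store s 20 ((Expr.lit 0).eval s) ((Expr.lit 0).eval s) with hs1
  have m1 : MemLE V s1 := hs.store (by simp [Expr.eval])
  have f1 : Frame {10, 20} s s1 := (Frame.refl _ _).store (by decide)
  obtain ⟨s2, r2, m2, f2, h2⟩ := runs_forLoop (V := V) (x := 10) (m := 1) (N := n)
    (bound := .var 0) (s := s1)
    (p := .assign 20 (.lit 0) (.add (.var 20) (.entry 5 10 10)))
    (I := fun k s' => MemLE V s' ∧ Frame {10, 20} s s' ∧
      s' 20 0 = ∑ i : Fin n, if (i : ℕ) < k then P i i else 0)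
    hV (by decide) m1
    (fun k s' h => ⟨h.1, by simp only [Expr.eval]; rw [h.2.1 0 (by decide), hn]⟩)
    ⟨m1.store (by simp), f1.store (by decide), by
      rw [store_of_ne (by decide), hs1]; simp [Expr.eval, store_apply]⟩
    (fun k hk s' ⟨hm, hf, hh⟩ h10 => by
      have hn' : s' 0 0 = n := by rw [hf 0 (by decide), hn]
      have e5 := eval_entry (hP.congr (hf 5 (by decide))) hn' (i := ⟨k, hk⟩) (j := ⟨k, hk⟩) h10 h10
      have hval : (Expr.add (.var 20) (.entry 5 10 10)).eval s' =
          ∑ i : Fin n, if (i : ℕ) < k + 1 then P i i else 0 := by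
        rw [Expr.eval, e5]
        simp only [Expr.eval]
        rw [hh]
        have e : P ⟨k, hk⟩ ⟨k, hk⟩ = ∑ i : Fin n, if i = ⟨k, hk⟩ then P i i else 0 := by simp
        rw [e, ← Finset.sum_add_distrib]
        refine Finset.sum_congr rfl fun i _ => ?_
        rcases lt_trichotomy (i : ℕ) k with h | h | h
        · have : i ≠ ⟨k, hk⟩ := fun e => by simp [e] at h
          simp [h, this, Nat.lt_succ_of_lt h]
        · have : i = ⟨k, hk⟩ := Fin.ext h
          simp [this]
        · have : i ≠ ⟨k, hk⟩ := fun e => by simp [e] at h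
          simp [this, not_lt.2 h.le, not_lt.2 (Nat.succ_le_of_lt h)]
      have hr := runs_assign (x := 20) (i := .lit 0) (e := .add (.var 20) (.entry 5 10 10)) hV hm
        (by decide) (by decide)
      have hm' : MemLE V (store s' 20 ((Expr.lit 0).eval s')
          ((Expr.add (.var 20) (.entry 5 10 10)).eval s')) := hm.store (by
        rw [hval]; exact hpart _)
      refine ⟨_, hr, hm', ?_, hm'.store (by omega), (hf.store (by decide)).store (by decide), ?_⟩
      · rw [store_of_ne (by decide)]; exact h10
      · rw [store_of_ne (by decide), store_apply, hval]; simp [Expr.eval])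
  refine ⟨s2, r1.seq r2, m2, f2, ?_⟩
  rw [h2]
  simp [Matrix.trace]

end Matrices

open scoped Matrix

/-! ### The program -/

section Program

variable {V n : ℕ} {s : Memory}

/-- The expression for the entries of the penalized objective. -/
def penalizedExpr : Expr :=
  .add (.mul (.pow 30) (.sub (.mul (.var 21) (.entry 1 10 11)) (.lit 1)))
    (.mul .delta (.sub (.add (.mul (.mul (.lit 2) (.lit 2)) (.pow 47)) (.mul (.var 14) (.pow 26)))
      (.entry 3 10 11)))

/-- The expression for the entries of the accumulated matrix. -/
def accumulateExpr : Expr :=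
  .add (.entry 3 10 11) (.div (.mul (.mul (.var 0) (.pow 26)) (.entry 5 10 11)) (.var 20))

theorem small_penalizedExpr : penalizedExpr.Small := by
  simp [penalizedExpr, Expr.delta, Expr.cell, Expr.Small, Expr.size, Expr.maxLit, size_pow,
    maxLit_pow]

theorem small_accumulateExpr : accumulateExpr.Small := by
  simp [accumulateExpr, Expr.cell, Expr.Small, Expr.size, Expr.maxLit, size_pow, maxLit_pow]

/-- One step of the iteration, on the matrix in array `3`. -/
def stepProgram : Program :=
  .seq (forCells 4 penalizedExpr) (.seq powProgram (.seq traceProgram (forCells 3 accumulateExpr)))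

/-- The number of steps of `stepProgram`. -/
def stepTime (n : ℕ) : ℕ := cellsTime n + (powTime n + (traceTime n + cellsTime n))

open Classical in
/-- The adjacency matrix as an integer matrix. -/
noncomputable def adjInt (G : SimpleGraph (Fin n)) : Matrix (Fin n) (Fin n) ℤ :=
  Matrix.of fun i j => if G.Adj i j then 1 else 0

/-- A bound for all numbers that occur in the computation. -/
structure IsWordBound (n V : ℕ) : Prop where
  two_le : 2 ≤ V
  node_le : n ≤ V
  counter_le : n ^ 60 ≤ V
  entry_le : 7 * n ^ 47 ≤ V
  power_le : n * (n * (7 * n ^ 47)) ^ (n ^ 60) ≤ V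
  cube_le : n ^ 143 ≤ V

theorem natAbs_le_of_abs_le {z : ℤ} {m : ℕ} (h : |(z : ℝ)| ≤ m) : z.natAbs ≤ m := by
  have : ((z.natAbs : ℤ) : ℝ) ≤ m := by rw [Int.natCast_natAbs]; exact_mod_cast h
  exact_mod_cast this

theorem natAbs_mul_le {A B : Matrix (Fin n) (Fin n) ℤ} {a b : ℕ} (hA : ∀ i j, (A i j).natAbs ≤ a)
    (hB : ∀ i j, (B i j).natAbs ≤ b) (i j : Fin n) :
    ∑ l, (A i l).natAbs * (B l j).natAbs ≤ n * (a * b) := by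
  calc _ ≤ ∑ _l : Fin n, a * b := Finset.sum_le_sum fun l _ => Nat.mul_le_mul (hA i l) (hB l j)
    _ = _ := by simp

theorem natAbs_matrix_mul_le {A B : Matrix (Fin n) (Fin n) ℤ} {a b : ℕ}
    (hA : ∀ i j, (A i j).natAbs ≤ a) (hB : ∀ i j, (B i j).natAbs ≤ b) (i j : Fin n) :
    ((A * B) i j).natAbs ≤ n * (a * b) := by
  rw [← partialMul_self]
  exact natAbs_partialMul_le (natAbs_mul_le hA hB i j) n

theorem natAbs_pow_le {S : Matrix (Fin n) (Fin n) ℤ} {L : ℕ} (hS : ∀ i j, (S i j).natAbs ≤ L)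
    (r : ℕ) (i j : Fin n) : ((S ^ r) i j).natAbs ≤ (n * L) ^ r := by
  induction r generalizing i j with
  | zero =>
    rw [pow_zero, pow_zero, Matrix.one_apply]
    split_ifs <;> simp
  | succ r ih =>
    rw [pow_succ, pow_succ]
    refine (natAbs_matrix_mul_le ih hS i j).trans (le_of_eq (by ring))

theorem natAbs_penalized_le {M R : Matrix (Fin n) (Fin n) ℤ} {t : ℕ} (hM : IsObjective M)
    (hR : IsAccumulated t R) (ht : t ≤ n ^ 20) (i j : Fin n) :
    (penalized M t R i j).natAbs ≤ 7 * n ^ 47 :=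
  natAbs_le_of_abs_le (by push_cast; exact abs_penalized_le hM hR ht i j)

theorem natAbs_accumulated_le {R : Matrix (Fin n) (Fin n) ℤ} {t : ℕ} (hR : IsAccumulated t R)
    (ht : t ≤ n ^ 20) (i j : Fin n) : (R i j).natAbs ≤ n ^ 47 := by
  refine natAbs_le_of_abs_le ((hR i j).trans ?_)
  have ht' : (t : ℝ) ≤ n ^ 20 := by exact_mod_cast ht
  push_cast
  calc (t : ℝ) * n ^ 27 ≤ n ^ 20 * n ^ 27 := by gcongr
    _ = _ := by ring

theorem runs_stepProgram (hV : IsWordBound n V) (hs : MemLE V s) {G : SimpleGraph (Fin n)}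
    {R : Matrix (Fin n) (Fin n) ℤ} {t : ℕ} (hn : s 0 0 = n) (hA : Holds s 1 (adjInt G))
    (hm : s 21 0 = (Nat.sqrt n : ℕ)) (ht : s 14 0 = t) (hR : Holds s 3 R)
    (hacc : IsAccumulated t R) (htn : t < n ^ 20) :
    ∃ u, Runs V stepProgram s (stepTime n) u ∧ MemLE V u ∧
      Frame {3, 4, 5, 6, 10, 11, 12, 13, 20} s u ∧ Holds u 3 (accumulate (sdpMatrix G) t R) := by
  have hM := isObjective_sdpMatrix G
  set M := sdpMatrix G with hMdef
  have hLe := natAbs_penalized_le hM hacc htn.le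
  obtain ⟨s1, r1, m1, f1, h1⟩ := runs_forCells (x := 4) (e := penalizedExpr) hV.two_le hV.node_le
    (by decide) small_penalizedExpr hs hn (penalized M t R)
    (fun i j => (hLe i j).trans hV.entry_le)
    (fun i j s' hf h10 h11 _ => by
      have hn' : s' 0 0 = n := by rw [hf 0 (by decide), hn]
      have e1 := eval_entry (hA.congr (hf 1 (by decide))) hn' h10 h11
      have e3 := eval_entry (hR.congr (hf 3 (by decide))) hn' h10 h11
      have e14 : s' 14 0 = t := by rw [hf 14 (by decide), ht]
      have e21 : s' 21 0 = (Nat.sqrt n : ℕ) := by rw [hf 21 (by decide), hm]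
      change (Expr.pow 30).eval s' * (s' 21 0 * (Expr.entry 1 10 11).eval s' - 1) +
        Expr.delta.eval s' * (2 * 2 * (Expr.pow 47).eval s' + s' 14 0 * (Expr.pow 26).eval s' -
          (Expr.entry 3 10 11).eval s') = _
      rw [eval_pow hn', eval_pow hn', eval_pow hn', eval_delta h10 h11, e1, e3, e14, e21]
      simp only [penalized, hMdef, sdpMatrix, adjInt, Matrix.of_apply]
      by_cases h : i = j
      · subst h; simp
      · simp [h])
  have hn1 : s1 0 0 = n := by rw [f1 0 (by decide), hn]
  obtain ⟨s2, r2, m2, f2, h2⟩ := runs_powProgram hV.two_le hV.node_le hV.counter_le m1 hn1 h1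
    (fun r hr i j => by
      refine (natAbs_mul_le (natAbs_pow_le hLe r) hLe i j).trans (le_trans ?_ hV.power_le)
      have hn0 : 0 < n := i.pos
      calc n * ((n * (7 * n ^ 47)) ^ r * (7 * n ^ 47)) = (n * (7 * n ^ 47)) ^ (r + 1) := by ring
        _ ≤ (n * (7 * n ^ 47)) ^ (n ^ 60) :=
            Nat.pow_le_pow_right (by positivity) hr
        _ ≤ _ := Nat.le_mul_of_pos_left _ hn0)
  have hn2 : s2 0 0 = n := by rw [f2 0 (by decide), hn1]
  obtain ⟨s3, r3, m3, f3, h3⟩ := runs_traceProgram hV.two_le hV.node_le m2 hn2 h2 (by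
      refine le_trans (le_trans (Finset.sum_le_sum fun i _ => natAbs_pow_le hLe (n ^ 60) i i) ?_)
        hV.power_le
      simp)
  have hn3 : s3 0 0 = n := by rw [f3 0 (by decide), hn2]
  have hR3 : Holds s3 3 R := hR.congr (by
    rw [f3 3 (by decide), f2 3 (by decide), f1 3 (by decide)])
  have hP3 : Holds s3 5 (response M t R) := h2.congr (f3 5 (by decide))
  obtain ⟨s4, r4, m4, f4, h4⟩ := runs_forCells (x := 3) (e := accumulateExpr) hV.two_le hV.node_le
    (by decide) small_accumulateExpr m3 hn3 (accumulate M t R)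
    (fun i j => by
      refine (natAbs_accumulated_le (isAccumulated_accumulate hM hacc htn.le) htn i j).trans
        (le_trans ?_ hV.entry_le)
      omega)
    (fun i j s' hf h10 h11 hcell => by
      have hn' : s' 0 0 = n := by rw [hf 0 (by decide), hn3]
      have e3 : (Expr.entry 3 10 11).eval s' = R i j := by
        simp only [Expr.cell, Expr.eval, hn', h10, h11]
        rw [hcell, hR3 i j]
      have e5 := eval_entry (hP3.congr (hf 5 (by decide))) hn' h10 h11
      have e20 : s' 20 0 = (response M t R).trace := by rw [hf 20 (by decide), h3]; rfl
      change (Expr.entry 3 10 11).eval s' + s' 0 0 * (Expr.pow 26).eval s' *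
        (Expr.entry 5 10 11).eval s' / s' 20 0 = _
      rw [eval_pow hn', e3, e5, e20, hn']
      rfl)
  refine ⟨s4, r1.seq (r2.seq (r3.seq r4)), m4, ?_, h4⟩
  exact (f1.mono (by decide)).trans ((f2.mono (by decide)).trans ((f3.mono (by decide)).trans
    (f4.mono (by decide))))

/-- Write `⌊√n⌋` to the variable `21`. -/
def sqrtProgram : Program :=
  .loop (.sub (.add (.var 0) (.lit 1))
      (.mul (.add (.var 21) (.lit 1)) (.add (.var 21) (.lit 1))))
    (.assign 21 (.lit 0) (.add (.var 21) (.lit 1)))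

/-- The number of steps of `sqrtProgram`. -/
def sqrtTime (n : ℕ) : ℕ := n * (1 + 1) + 1

theorem runs_sqrtProgram (hV : 2 ≤ V) (hnV : n ≤ V) (hs : MemLE V s) (hn : s 0 0 = n)
    (h0 : s 21 0 = 0) :
    ∃ t, Runs V sqrtProgram s (sqrtTime n) t ∧ MemLE V t ∧ Frame {21} s t ∧
      t 21 0 = (Nat.sqrt n : ℕ) := by
  obtain ⟨t, rt, mt, ft, ht⟩ := runs_loop (V := V) (m := 1) (s := s)
    (e := .sub (.add (.var 0) (.lit 1))
      (.mul (.add (.var 21) (.lit 1)) (.add (.var 21) (.lit 1))))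
    (p := .assign 21 (.lit 0) (.add (.var 21) (.lit 1))) hV (by decide) (N := Nat.sqrt n)
    (I := fun i s' => MemLE V s' ∧ Frame {21} s s' ∧ s' 21 0 = i)
    (fun i s' h => h.1)
    (fun i hi s' ⟨_, hf, h⟩ => by
      have h1 : (i + 1) * (i + 1) ≤ n := Nat.le_sqrt.1 hi
      have h2 : (((i : ℤ) + 1) * ((i : ℤ) + 1)) ≤ n := by exact_mod_cast h1
      simp only [Expr.eval]
      rw [h, hf 0 (by decide), hn]
      linarith)
    (fun s' ⟨_, hf, h⟩ => by
      have h1 : n < (Nat.sqrt n + 1) * (Nat.sqrt n + 1) := Nat.lt_succ_sqrt n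
      have h2 : (n : ℤ) + 1 ≤ ((Nat.sqrt n : ℤ) + 1) * ((Nat.sqrt n : ℤ) + 1) := by
        exact_mod_cast h1
      simp only [Expr.eval]
      rw [h, hf 0 (by decide), hn]
      linarith)
    (fun i hi s' ⟨hm, hf, h⟩ => by
      have hsn := Nat.sqrt_le_self n
      have hval : (Expr.add (.var 21) (.lit 1)).eval s' = ((i + 1 : ℕ) : ℤ) := by
        simp only [Expr.eval]; rw [h]; push_cast; rfl
      refine ⟨_, runs_assign hV hm (by decide) (by decide), hm.store ?_, hf.store (by decide), ?_⟩
      · rw [hval]; omega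
      · rw [store_apply, hval]; simp [Expr.eval])
    ⟨hs, Frame.refl _ _, by rw [h0]; rfl⟩
  refine ⟨t, rt.mono ?_, mt, ft, ht⟩
  have := Nat.sqrt_le_self n
  unfold sqrtTime
  gcongr

/-- Write a row of largest diagonal entry of the matrix in array `5` to the variable `23`, and that
entry to the variable `22`, provided the matrix has a positive diagonal entry. -/
def argmaxProgram : Program :=
  forLoop 10 (.var 0) (.branch (.sub (.entry 5 10 10) (.var 22))
    (.seq (.assign 22 (.lit 0) (.entry 5 10 10)) (.assign 23 (.lit 0) (.var 10))) .skip)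

/-- The number of steps of `argmaxProgram`. -/
def argmaxTime (n : ℕ) : ℕ := n * (3 + 2) + 2

theorem runs_argmaxProgram (hV : 2 ≤ V) (hnV : n ≤ V) (hs : MemLE V s) (hn : s 0 0 = n)
    {P : Matrix (Fin n) (Fin n) ℤ} (hP : Holds s 5 P) (h22 : s 22 0 = 0) (h23 : s 23 0 = 0) :
    ∃ t, Runs V argmaxProgram s (argmaxTime n) t ∧ MemLE V t ∧ Frame {10, 22, 23} s t ∧
      (∀ i, P i i ≤ t 22 0) ∧
      ((t 22 0 = 0 ∧ t 23 0 = 0) ∨ ∃ i : Fin n, t 23 0 = (i : ℕ) ∧ t 22 0 = P i i) := by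
  obtain ⟨t, rt, mt, ft, hmax, harg⟩ := runs_forLoop (V := V) (x := 10) (m := 3) (N := n)
    (bound := .var 0) (s := s)
    (p := .branch (.sub (.entry 5 10 10) (.var 22))
      (.seq (.assign 22 (.lit 0) (.entry 5 10 10)) (.assign 23 (.lit 0) (.var 10))) .skip)
    (I := fun k s' => MemLE V s' ∧ Frame {10, 22, 23} s s' ∧
      (∀ i : Fin n, (i : ℕ) < k → P i i ≤ s' 22 0) ∧
      ((s' 22 0 = 0 ∧ s' 23 0 = 0) ∨ ∃ i : Fin n, s' 23 0 = (i : ℕ) ∧ s' 22 0 = P i i))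
    hV (by decide) hs
    (fun k s' h => ⟨h.1, by simp only [Expr.eval]; rw [h.2.1 0 (by decide), hn]⟩)
    ⟨hs.store (by simp), (Frame.refl _ _).store (by decide), by simp, Or.inl (by
      rw [store_of_ne (by decide), store_of_ne (by decide)]; exact ⟨h22, h23⟩)⟩
    (fun k hk s' ⟨hm, hf, hmax, harg⟩ h10 => by
      have hn' : s' 0 0 = n := by rw [hf 0 (by decide), hn]
      have e5 := eval_entry (hP.congr (hf 5 (by decide))) hn' (i := ⟨k, hk⟩) (j := ⟨k, hk⟩) h10 h10
      have htest : (Expr.sub (.entry 5 10 10) (.var 22)).eval s' =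
          P ⟨k, hk⟩ ⟨k, hk⟩ - s' 22 0 := by rw [Expr.eval, e5]; rfl
      by_cases h : s' 22 0 < P ⟨k, hk⟩ ⟨k, hk⟩
      · have ra := runs_assign (x := 22) (i := .lit 0) (e := .entry 5 10 10) hV hm (by decide)
          (by decide)
        set s1 := store s' 22 ((Expr.lit 0).eval s') ((Expr.entry 5 10 10).eval s') with hs1
        have m1 : MemLE V s1 := hm.store (hm 5 _)
        have f1 : Frame {10, 22, 23} s s1 := hf.store (by decide)
        have e10 : s1 10 0 = k := by rw [hs1, store_of_ne (by decide), h10]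
        have rb := runs_assign (x := 23) (i := .lit 0) (e := .var 10) hV m1 (by decide) (by decide)
        set s2 := store s1 23 ((Expr.lit 0).eval s1) ((Expr.var 10).eval s1) with hs2
        have m2 : MemLE V s2 := m1.store (m1 10 _)
        have f2 : Frame {10, 22, 23} s s2 := f1.store (by decide)
        have e22 : s2 22 0 = P ⟨k, hk⟩ ⟨k, hk⟩ := by
          rw [hs2, store_of_ne (by decide), hs1, store_apply, e5]; simp [Expr.eval]
        have e23 : s2 23 0 = k := by
          rw [hs2, store_apply]; simp [Expr.eval, e10]
        have hpos : 0 < (Expr.sub (.entry 5 10 10) (.var 22)).eval s' := by rw [htest]; linarith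
        have rab := runs_branch_pos (q := .skip) hV hm (by decide) hpos (ra.seq rb)
        refine ⟨s2, rab.mono (by omega), m2,
          ?_, m2.store (by omega), f2.store (by decide), fun i hi => ?_, Or.inr ⟨⟨k, hk⟩, ?_⟩⟩
        · rw [hs2, store_of_ne (by decide), e10]
        · rw [store_of_ne (by decide), e22]
          rcases Nat.lt_succ_iff_lt_or_eq.1 hi with h' | h'
          · exact (hmax i h').trans h.le
          · have : i = ⟨k, hk⟩ := Fin.ext h'
            rw [this]
        · rw [store_of_ne (by decide), store_of_ne (by decide)]
          exact ⟨e23, e22⟩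
      · refine ⟨s', (runs_branch_nonpos hV hm (by decide) (by rw [htest]; linarith)
          (runs_skip V s')).mono (by omega), hm, h10, hm.store (by omega), hf.store (by decide),
          fun i hi => ?_, ?_⟩
        · rw [store_of_ne (by decide)]
          rcases Nat.lt_succ_iff_lt_or_eq.1 hi with h' | h'
          · exact hmax i h'
          · have : i = ⟨k, hk⟩ := Fin.ext h'
            rw [this]; exact not_lt.1 h
        · rw [store_of_ne (by decide), store_of_ne (by decide)]; exact harg)
  exact ⟨t, rt, mt, ft, fun i => hmax i i.2, harg⟩

/-- Select a row of largest score of the matrix `R` in array `3`, as a largest diagonal entry of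
`R * R * Rᵀ`, and copy it to the rows of array `2`. -/
def selectProgram : Program :=
  .seq (forCells 5 (.entry 3 10 11)) (.seq (forCells 4 (.entry 3 10 11)) (.seq mulProgram
    (.seq (forCells 4 (.entry 3 11 10)) (.seq mulProgram (.seq argmaxProgram
      (forCells 2 (.entry 3 23 11)))))))

/-- The number of steps of `selectProgram`. -/
def selectTime (n : ℕ) : ℕ :=
  cellsTime n + (cellsTime n + (mulTime n + (cellsTime n + (mulTime n +
    (argmaxTime n + cellsTime n)))))

theorem rowScore_eq (R : Matrix (Fin n) (Fin n) ℤ) (i : Fin n) :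
    (R * R * Rᵀ) i i = rowScore R i := by
  simp only [rowScore, Matrix.mul_apply, Matrix.transpose_apply, Finset.sum_mul]
  rw [Finset.sum_comm]

theorem runs_selectProgram (hV : IsWordBound n V) (hs : MemLE V s) (hn : s 0 0 = n)
    {R : Matrix (Fin n) (Fin n) ℤ} (hR : Holds s 3 R) (hb : ∀ i j, (R i j).natAbs ≤ n ^ 47)
    (h22 : s 22 0 = 0) (h23 : s 23 0 = 0) :
    ∃ t, Runs V selectProgram s (selectTime n) t ∧ (1 ≤ n → ∃ i : Fin n,
      (∀ j : Fin n, t 2 (j : ℤ) = R i j) ∧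
        ((∃ j, 0 < rowScore R j) → ∀ j, rowScore R j ≤ rowScore R i)) := by
  have h47 : n ^ 47 ≤ V := by have := hV.entry_le; omega
  have hbV : ∀ i j, (R i j).natAbs ≤ V := fun i j => (hb i j).trans h47
  have copy : ∀ (x : ℕ) (hx : x ∉ ({0, 3, 10, 11} : Finset ℕ)) (s' : Memory), MemLE V s' →
      s' 0 0 = n → Holds s' 3 R → ∃ t, Runs V (forCells x (.entry 3 10 11)) s' (cellsTime n) t ∧
        MemLE V t ∧ Frame {x, 10, 11} s' t ∧ Holds t x R := by
    intro x hx s' hm hn' hR'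
    simp only [Finset.mem_insert, Finset.mem_singleton, not_or] at hx
    refine runs_forCells hV.two_le hV.node_le (by simp [hx]) (by decide) hm hn' R hbV
      fun i j s'' hf h10 h11 _ => ?_
    exact eval_entry (hR'.congr (hf 3 (by simp [Ne.symm hx.2.1])))
      (by rw [hf 0 (by simp [Ne.symm hx.1]), hn']) h10 h11
  obtain ⟨s1, r1, m1, f1, h1⟩ := copy 5 (by decide) s hs hn hR
  have hn1 : s1 0 0 = n := by rw [f1 0 (by decide), hn]
  have hR1 : Holds s1 3 R := hR.congr (f1 3 (by decide))
  obtain ⟨s2, r2, m2, f2, h2⟩ := copy 4 (by decide) s1 m1 hn1 hR1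
  have hn2 : s2 0 0 = n := by rw [f2 0 (by decide), hn1]
  have hR2 : Holds s2 3 R := hR1.congr (f2 3 (by decide))
  obtain ⟨s3, r3, m3, f3, h3⟩ := runs_mulProgram hV.two_le hV.node_le m2 hn2
    (h1.congr (f2 5 (by decide))) h2 (fun i j => by
      refine (natAbs_mul_le hb hb i j).trans (le_trans ?_ hV.cube_le)
      have hn0 : 0 < n := i.pos
      calc n * (n ^ 47 * n ^ 47) = n ^ 95 := by ring
        _ ≤ _ := Nat.pow_le_pow_right hn0 (by norm_num))
  have hn3 : s3 0 0 = n := by rw [f3 0 (by decide), hn2]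
  have hR3 : Holds s3 3 R := hR2.congr (f3 3 (by decide))
  obtain ⟨s4, r4, m4, f4, h4⟩ := runs_forCells (x := 4) (e := .entry 3 11 10) hV.two_le hV.node_le
    (by decide) (by decide) m3 hn3 Rᵀ (fun i j => hbV j i) (fun i j s' hf h10 h11 _ =>
      eval_entry (hR3.congr (hf 3 (by decide))) (by rw [hf 0 (by decide), hn3]) h11 h10)
  have hn4 : s4 0 0 = n := by rw [f4 0 (by decide), hn3]
  have hR4 : Holds s4 3 R := hR3.congr (f4 3 (by decide))
  obtain ⟨s5, r5, m5, f5, h5⟩ := runs_mulProgram hV.two_le hV.node_le m4 hn4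
    (h3.congr (f4 5 (by decide))) h4 (fun i j => by
      refine (natAbs_mul_le (natAbs_matrix_mul_le hb hb) (fun i j => hb j i) i j).trans
        (le_trans (le_of_eq ?_) hV.cube_le)
      ring)
  have hn5 : s5 0 0 = n := by rw [f5 0 (by decide), hn4]
  have hR5 : Holds s5 3 R := hR4.congr (f5 3 (by decide))
  have e22 : s5 22 0 = 0 := by
    rw [f5 22 (by decide), f4 22 (by decide), f3 22 (by decide), f2 22 (by decide),
      f1 22 (by decide), h22]
  have e23 : s5 23 0 = 0 := by
    rw [f5 23 (by decide), f4 23 (by decide), f3 23 (by decide), f2 23 (by decide),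
      f1 23 (by decide), h23]
  obtain ⟨s6, r6, m6, f6, hmax, harg⟩ := runs_argmaxProgram hV.two_le hV.node_le m5 hn5 h5 e22 e23
  have hn6 : s6 0 0 = n := by rw [f6 0 (by decide), hn5]
  have hR6 : Holds s6 3 R := hR5.congr (f6 3 (by decide))
  have hrow : ∃ b : ℕ, (1 ≤ n → b < n) ∧ s6 23 0 = b := by
    rcases harg with h | ⟨i, hi, -⟩
    · exact ⟨0, fun h => h, by simpa using h.2⟩
    · exact ⟨i, fun _ => i.2, hi⟩
  obtain ⟨b, hbn, hb6⟩ := hrow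
  obtain ⟨s7, r7, m7, f7, h7⟩ := runs_forCells (x := 2) (e := .entry 3 23 11) hV.two_le hV.node_le
    (by decide) (by decide) m6 hn6 (Matrix.of fun i j => R ⟨b, hbn i.pos⟩ j)
    (fun i j => hbV _ _) (fun i j s' hf h10 h11 _ =>
      eval_entry (hR6.congr (hf 3 (by decide))) (by rw [hf 0 (by decide), hn6])
        (i := ⟨b, hbn i.pos⟩) (by rw [hf 23 (by decide), hb6]) h11)
  refine ⟨s7, r1.seq (r2.seq (r3.seq (r4.seq (r5.seq (r6.seq r7))))), fun h1n => ?_⟩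
  refine ⟨⟨b, hbn h1n⟩, fun j => ?_, ?_⟩
  · have := h7 ⟨0, h1n⟩ j
    simpa using this
  · rintro ⟨j, hj⟩ k
    have hk : ∀ k, rowScore R k ≤ s6 22 0 := fun k => by rw [← rowScore_eq]; exact hmax k
    rcases harg with h | ⟨i, hi, hi2⟩
    · have := hk j
      omega
    · have hib : i = ⟨b, hbn h1n⟩ := Fin.ext (by
        have : ((i : ℕ) : ℤ) = (b : ℤ) := by rw [← hi, hb6]
        exact_mod_cast this)
      rw [← hib, ← rowScore_eq R i, ← hi2]
      exact hk k

/-- The whole algorithm. Array `3` holds the accumulated matrix, arrays `4` and `5` the penalized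
objective and its power, and array `6` intermediate products. The variables `10` to `14` are loop
counters, `14` being the number of the round; `20` holds the trace of the response, `21` the number
`⌊√n⌋`, and `22` and `23` the largest score and its row. -/
def sdpProgram : Program := .seq sqrtProgram (.seq (forLoop 14 (.pow 20) stepProgram) selectProgram)

/-- The number of steps of `sdpProgram`. -/
def sdpTime (n : ℕ) : ℕ := sqrtTime n + (n ^ 20 * (stepTime n + 2) + 2 + selectTime n)

theorem holds_inputMemory (G : SimpleGraph (Fin n)) : Holds (inputMemory G) 1 (adjInt G) := by
  classical
  intro i j
  have h1 : (∃ u v : Fin n, G.Adj u v ∧ ((i : ℕ) : ℤ) * n + (j : ℕ) = (u : ℤ) * n + (v : ℤ)) ↔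
      G.Adj i j := by
    constructor
    · rintro ⟨u, v, huv, h⟩
      obtain ⟨rfl, rfl⟩ := cell_inj (i := i) (j := j) (i' := u) (j' := v) (by exact_mod_cast h)
      exact huv
    · exact fun h => ⟨i, j, h, rfl⟩
  simp [inputMemory, adjInt, h1]

theorem memLE_inputMemory (hV : 2 ≤ V) (hnV : n ≤ V) (G : SimpleGraph (Fin n)) :
    MemLE V (inputMemory G) := by
  classical
  intro x i
  simp only [inputMemory]
  split_ifs <;> simp <;> omega

theorem inputMemory_eq_zero (G : SimpleGraph (Fin n)) {x : ℕ} (hx : 2 ≤ x) (i : ℤ) :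
    inputMemory G x i = 0 := by
  classical
  have h0 : x ≠ 0 := by omega
  have h1 : x ≠ 1 := by omega
  simp [inputMemory, h0, h1]

theorem runs_sdpProgram (hV : IsWordBound n V) (G : SimpleGraph (Fin n)) :
    ∃ t, Runs V sdpProgram (inputMemory G) (sdpTime n) t ∧ (1 ≤ n → ∃ i : Fin n,
      (∀ j : Fin n, t 2 (j : ℤ) = sdpIterate G i j) ∧ ((∃ j, 0 < rowScore (sdpIterate G) j) →
        ∀ j, rowScore (sdpIterate G) j ≤ rowScore (sdpIterate G) i)) := by
  have hn : inputMemory G 0 0 = n := by simp [inputMemory]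
  have hM := isObjective_sdpMatrix G
  have hz : ∀ {x : ℕ}, 2 ≤ x → ∀ i, inputMemory G x i = 0 := fun hx i =>
    inputMemory_eq_zero G hx i
  obtain ⟨s1, r1, m1, f1, h1⟩ := runs_sqrtProgram hV.two_le hV.node_le
    (memLE_inputMemory hV.two_le hV.node_le G) hn (hz (by norm_num) 0)
  have h20 : n ^ 20 ≤ V := by
    refine le_trans ?_ hV.counter_le
    rcases Nat.eq_zero_or_pos n with rfl | h
    · simp
    · exact Nat.pow_le_pow_right h (by norm_num)
  obtain ⟨s2, r2, m2, f2, h2⟩ := runs_forLoop (V := V) (x := 14) (m := stepTime n) (N := n ^ 20)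
    (bound := .pow 20) (s := s1) (p := stepProgram)
    (I := fun t s' => MemLE V s' ∧
      Frame {3, 4, 5, 6, 10, 11, 12, 13, 14, 20, 21} (inputMemory G) s' ∧
      s' 21 0 = (Nat.sqrt n : ℕ) ∧ Holds s' 3 (iterate (sdpMatrix G) t))
    hV.two_le (by simp [Expr.Small, Expr.size, Expr.maxLit, size_pow, maxLit_pow]) m1
    (fun k s' h => ⟨h.1, by rw [eval_pow (by rw [h.2.1 0 (by decide), hn])]; push_cast; rfl⟩)
    ⟨m1.store (by simp), (f1.mono (by decide)).store (by decide), by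
      rw [store_of_ne (by decide), h1], fun i j => by
      rw [store_of_ne (by decide), f1 3 (by decide), hz (by norm_num)]; rfl⟩
    (fun t ht s' ⟨hm, hf, h21, hh⟩ h14 => by
      obtain ⟨u, ru, mu, fu, hu⟩ := runs_stepProgram hV hm (by rw [hf 0 (by decide), hn])
        ((holds_inputMemory G).congr (hf 1 (by decide))) h21 h14 hh
        (isAccumulated_iterate hM ht.le) ht
      have fu' : Frame {3, 4, 5, 6, 10, 11, 12, 13, 14, 20, 21} (inputMemory G) u :=
        hf.trans (fu.mono (by decide))
      exact ⟨u, ru, mu, by rw [fu 14 (by decide), h14], mu.store (by omega),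
        fu'.store (by decide), by rw [store_of_ne (by decide), fu 21 (by decide), h21],
        hu.congr (store_of_ne (by decide))⟩)
  obtain ⟨s3, r3, h3⟩ := runs_selectProgram hV m2 (by rw [f2 0 (by decide), hn]) h2.2
    (natAbs_accumulated_le (isAccumulated_iterate hM le_rfl) le_rfl)
    (by rw [f2 22 (by decide), hz (by norm_num)]) (by rw [f2 23 (by decide), hz (by norm_num)])
  exact ⟨s3, r1.seq (r2.seq r3), h3⟩

end Program

/-! ### The running time is polynomial -/

/-- The function `f` agrees with a polynomial that has natural coefficients. -/
def IsPolynomial (f : ℕ → ℕ) : Prop := ∃ P : Polynomial ℕ, ∀ n, P.eval n = f n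

theorem isPolynomial_const (c : ℕ) : IsPolynomial fun _ => c :=
  ⟨Polynomial.C c, fun n => by simp⟩

theorem isPolynomial_id : IsPolynomial fun n => n := ⟨Polynomial.X, fun n => by simp⟩

section Closure

variable {f g : ℕ → ℕ}

theorem IsPolynomial.add (hf : IsPolynomial f) (hg : IsPolynomial g) :
    IsPolynomial fun n => f n + g n := by
  obtain ⟨P, hP⟩ := hf
  obtain ⟨Q, hQ⟩ := hg
  exact ⟨P + Q, fun n => by rw [Polynomial.eval_add, hP, hQ]⟩

theorem IsPolynomial.mul (hf : IsPolynomial f) (hg : IsPolynomial g) :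
    IsPolynomial fun n => f n * g n := by
  obtain ⟨P, hP⟩ := hf
  obtain ⟨Q, hQ⟩ := hg
  exact ⟨P * Q, fun n => by rw [Polynomial.eval_mul, hP, hQ]⟩

theorem IsPolynomial.pow (hf : IsPolynomial f) (c : ℕ) : IsPolynomial fun n => f n ^ c := by
  obtain ⟨P, hP⟩ := hf
  exact ⟨P ^ c, fun n => by rw [Polynomial.eval_pow, hP]⟩

end Closure

theorem isPolynomial_cellsTime : IsPolynomial cellsTime :=
  (isPolynomial_id.mul ((isPolynomial_id.mul (isPolynomial_const 3)).add
    (isPolynomial_const 4))).add (isPolynomial_const 2)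

theorem isPolynomial_mulTime : IsPolynomial mulTime :=
  isPolynomial_cellsTime.add (((isPolynomial_id.mul (isPolynomial_cellsTime.add
    (isPolynomial_const 2))).add (isPolynomial_const 2)).add isPolynomial_cellsTime)

theorem isPolynomial_powTime : IsPolynomial powTime :=
  isPolynomial_cellsTime.add (((isPolynomial_id.pow 60).mul (isPolynomial_mulTime.add
    (isPolynomial_const 2))).add (isPolynomial_const 2))

theorem isPolynomial_traceTime : IsPolynomial traceTime :=
  (isPolynomial_const 1).add ((isPolynomial_id.mul (isPolynomial_const (1 + 2))).add
    (isPolynomial_const 2))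

theorem isPolynomial_stepTime : IsPolynomial stepTime :=
  isPolynomial_cellsTime.add (isPolynomial_powTime.add (isPolynomial_traceTime.add
    isPolynomial_cellsTime))

theorem isPolynomial_sqrtTime : IsPolynomial sqrtTime :=
  (isPolynomial_id.mul (isPolynomial_const (1 + 1))).add (isPolynomial_const 1)

theorem isPolynomial_argmaxTime : IsPolynomial argmaxTime :=
  (isPolynomial_id.mul (isPolynomial_const (3 + 2))).add (isPolynomial_const 2)

theorem isPolynomial_selectTime : IsPolynomial selectTime :=
  isPolynomial_cellsTime.add (isPolynomial_cellsTime.add (isPolynomial_mulTime.add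
    (isPolynomial_cellsTime.add (isPolynomial_mulTime.add (isPolynomial_argmaxTime.add
      isPolynomial_cellsTime)))))

theorem isPolynomial_sdpTime : IsPolynomial sdpTime :=
  isPolynomial_sqrtTime.add ((((isPolynomial_id.pow 20).mul (isPolynomial_stepTime.add
    (isPolynomial_const 2))).add (isPolynomial_const 2)).add isPolynomial_selectTime)

/-- The number of bits that suffices for all numbers in the computation. It is dominated by the
`n ^ 60`-th power of an integer matrix with entries of size `7 * n ^ 47`. -/
def wordBits (n : ℕ) : ℕ := 143 * n + 3 + (48 * n + 3) * n ^ 60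

theorem isPolynomial_wordBits : IsPolynomial wordBits :=
  (((isPolynomial_const 143).mul isPolynomial_id).add (isPolynomial_const 3)).add
    ((((isPolynomial_const 48).mul isPolynomial_id).add (isPolynomial_const 3)).mul
      (isPolynomial_id.pow 60))

theorem isPolynomial_unitCost : IsPolynomial fun n => unitCost (2 ^ wordBits n) := by
  have h : (fun n => unitCost (2 ^ wordBits n)) =
      fun n => 2 * 1000000 * (wordBits n + 1 + 1) := by
    funext n
    rw [unitCost, Nat.size_pow]
  rw [h]
  exact (isPolynomial_const _).mul ((isPolynomial_wordBits.add (isPolynomial_const 1)).add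
    (isPolynomial_const 1))

theorem pow_le_two_pow_mul (n c : ℕ) : n ^ c ≤ 2 ^ (n * c) := by
  rw [pow_mul]
  exact Nat.pow_le_pow_left Nat.lt_two_pow_self.le c

theorem isWordBound_two_pow_wordBits (n : ℕ) : IsWordBound n (2 ^ wordBits n) := by
  have two : ∀ {k}, k ≤ wordBits n → 2 ^ k ≤ 2 ^ wordBits n := fun h =>
    Nat.pow_le_pow_right (by norm_num) h
  have hpow : ∀ c ≤ 143, n ^ c ≤ 2 ^ wordBits n := fun c hc =>
    (pow_le_two_pow_mul n c).trans (two (by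
      have := Nat.mul_le_mul_left n hc
      unfold wordBits
      omega))
  have hseven : 7 ≤ 2 ^ 3 := by norm_num
  refine ⟨?_, ?_, hpow 60 (by norm_num), ?_, ?_, hpow 143 le_rfl⟩
  · calc 2 = 2 ^ 1 := by norm_num
      _ ≤ _ := two (by unfold wordBits; omega)
  · simpa using hpow 1 (by norm_num)
  · calc 7 * n ^ 47 ≤ 2 ^ 3 * 2 ^ (n * 47) := Nat.mul_le_mul hseven (pow_le_two_pow_mul n 47)
      _ = 2 ^ (3 + n * 47) := (pow_add _ _ _).symm
      _ ≤ _ := two (by unfold wordBits; omega)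
  · have hbase : n * (7 * n ^ 47) ≤ 2 ^ (48 * n + 3) := by
      calc n * (7 * n ^ 47) ≤ 2 ^ n * (2 ^ 3 * 2 ^ (n * 47)) :=
            Nat.mul_le_mul Nat.lt_two_pow_self.le
              (Nat.mul_le_mul hseven (pow_le_two_pow_mul n 47))
        _ = 2 ^ (48 * n + 3) := by rw [← pow_add, ← pow_add]; congr 1; ring
    calc n * (n * (7 * n ^ 47)) ^ (n ^ 60)
        ≤ 2 ^ n * (2 ^ (48 * n + 3)) ^ (n ^ 60) :=
          Nat.mul_le_mul Nat.lt_two_pow_self.le (Nat.pow_le_pow_left hbase _)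
      _ = 2 ^ (n + (48 * n + 3) * n ^ 60) := by rw [← pow_mul, ← pow_add]
      _ ≤ _ := two (by unfold wordBits; omega)

/-! ### The estimator -/

/-- The memory in which `sdpProgram` halts on the graph `G`. -/
noncomputable def sdpMemory {n : ℕ} (G : SimpleGraph (Fin n)) : Memory :=
  (runs_sdpProgram (isWordBound_two_pow_wordBits n) G).choose

/-- The spins computed by `sdpProgram`. -/
noncomputable def sdpEstimator : Estimator := fun n G => readSpins n (sdpMemory G)

theorem isPolyTime_sdpEstimator : IsPolyTime sdpEstimator := by
  obtain ⟨P, hP⟩ := isPolynomial_sdpTime.mul isPolynomial_unitCost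
  refine ⟨sdpProgram, P, fun n G => ?_⟩
  obtain ⟨k, hk, hle⟩ := (runs_sdpProgram (isWordBound_two_pow_wordBits n) G).choose_spec.1
  exact ⟨k, sdpMemory G, hk, hle.trans (hP n).ge, rfl⟩

theorem sdpEstimator_eq_rowSpins {n : ℕ} (hn : 1 ≤ n) (G : SimpleGraph (Fin n)) :
    ∃ i, sdpEstimator n G = rowSpins (toReal (sdpIterate G)) i ∧
      ((∃ j, 0 < rowScore (sdpIterate G) j) →
        ∀ j, rowScore (sdpIterate G) j ≤ rowScore (sdpIterate G) i) := by
  obtain ⟨i, hrow, hmax⟩ :=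
    (runs_sdpProgram (isWordBound_two_pow_wordBits n) G).choose_spec.2 hn
  refine ⟨i, ?_, hmax⟩
  funext j
  have h : sdpMemory G 2 (j : ℤ) = sdpIterate G i j := hrow j
  simp only [sdpEstimator, readSpins, rowSpins, h, toReal_apply, Int.cast_pos]

end SemirandomSDP

theorem mainTheorem5 :
    -- partial recovery in polynomial time, by one algorithm that does not know `a` and `b`
    (∃ C : ℝ, 1 < C ∧ ∃ f : SemirandomSDP.Estimator, SemirandomSDP.IsPolyTime f ∧
      ∀ a b k ε : ℝ, 0 ≤ b → b < a → 20 < a → k = (a + b) / 2 → ε = b / (a + b) →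
        C < k * (1 - 2 * ε) ^ 2 → SemirandomSDP.AchievesPartialRecovery a b f) ∧
    -- the semidefinite program with its rounding always has an output
    (∀ (n : ℕ) (G : SimpleGraph (Fin n)), 1 ≤ n →
      ∃ τ, SemirandomSDP.IsSDPOutput G (Real.log n / n) τ) ∧
    -- every such output achieves `η`-partial recovery a.a.s.
    (∀ a b η : ℝ, 0 ≤ b → b < a → 20 < a → η < 1 →
      10 ^ 4 * ((1 - η) ^ 2)⁻¹ * (a + b) ≤ (a - b) ^ 2 →
        SemirandomSDP.HoldsAAS a b fun n σ G =>
          ∀ τ, SemirandomSDP.IsSDPOutput G (Real.log n / n) τ →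
            SemirandomSDP.IsPartialRecovery η τ σ) := by
  refine ⟨⟨10 ^ 10, by norm_num, SemirandomSDP.sdpEstimator,
    SemirandomSDP.isPolyTime_sdpEstimator, ?_⟩, ?_, ?_⟩
  · rintro a b k ε hb hab ha rfl rfl hC
    refine SemirandomSDP.achievesPartialRecovery_of_rowSpins
      (fun n hn G => SemirandomSDP.sdpEstimator_eq_rowSpins hn G) hb hab (by linarith) ?_
    have hpos : 0 < a + b := by linarith
    have h : (a + b) / 2 * (1 - 2 * (b / (a + b))) ^ 2 = (a - b) ^ 2 / (2 * (a + b)) := by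
      field_simp
      ring
    rw [h, lt_div_iff₀ (by linarith)] at hC
    exact hC
  · exact fun n G hn => SemirandomSDP.exists_isSDPOutput hn G _
  · exact fun a b η hb hab ha hη h => SemirandomSDP.holdsAAS_isSDPOutput hb hab ha hη h
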